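/- Let $d\ge 1$, $g\in\mathbf R$ and $T>0$. For functions $\eta,f$ on $\mathbf R^d$, let $\phi$ be the variational solution of $$\Delta_{x,y}\phi=0\ \text{ in }\ \mathcal S=\{(x,y)\in\mathbf R^d\times\mathbf R:\ y<\eta(x)\},\qquad \phi|_{y=\eta}=f,\qquad \nabla_{x,y}\phi\in L^2(\mathcal S),$$ and let $G(\eta)f=\sqrt{1+|\nabla\eta|^2}\,\partial_n\phi|_{y=\eta}$ be the (rescaled) Dirichlet–Neumann operator, where $n$ is the outward unit normal to the graph of $\eta$ and the normal derivative is understood in the variational sense: $$\int_{\mathcal S}\nabla_{x,y}\phi\cdot\nabla_{x,y}\Phi\,dx\,dy=\int_{\mathbf R^d}(G(\eta)f)(x)\,\Phi(x,\eta(x))\,dx\qquad\text{for all }\Phi\in C_c^\infty(\mathbf R^d\times\mathbf R).$$ Let $(\eta,\psi)$ be a smooth solution on $[0,T]$, with initial data $(\eta_0,\psi_0)$, of the water-wave system $$\partial_t\eta-G(\eta)\psi=0,\qquad \partial_t\psi+g\eta+\frac12|\nabla\psi|^2-\frac{(G(\eta)\psi+\nabla\eta\cdot\nabla\psi)^2}{2(1+|\nabla\eta|^2)}=0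 .$$ Here smooth means $\eta,\psi\in C^\infty([0,T];H^\infty(\mathbf R^d))$, that is, $\eta$ and $\psi$ are $C^\infty$ on $[0,T]\times\mathbf R^d$ and all their derivatives in $(t,x)$ are in $L^2(\mathbf R^d)$ uniformly in $t\in[0,T]$; being a solution includes that $G(\eta(t))\psi(t)$ is defined, as a locally integrable function, for every $t\in[0,T]$. Put $$H(\eta,\psi)=\int_{\mathbf R^d}\big(g|\eta|^2+\psi\,G(\eta)\psi\big)\,dx .$$ Then for every $t\in[0,T]$ the integrand of $H(\eta(t),\psi(t))$ is integrable and $$H(\eta(t),\psi(t))=H(\eta_0,\psi_0).$$ -/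

import Mathlib

open Set Filter Topology MeasureTheory
open scoped ContDiff NNReal ENNReal Gradient Laplacian

noncomputable section

namespace WaterWave

/-- The horizontal space `ℝ^d`, with its Euclidean structure and Lebesgue measure. -/
abbrev Space (d : ℕ) : Type := EuclideanSpace ℝ (Fin d)

variable {d : ℕ}

/-- The region `{(x, y) : y < η(x)}` below the graph of `η` (infinite depth). -/
def fluidDomain (η : Space d → ℝ) : Set (Space d × ℝ) :=
  {p | p.2 < η p.1}

/-- The horizontal gradient of a function of `(x, y)`. -/
def gradX (φ : Space d × ℝ → ℝ) (p : Space d × ℝ) : Space d :=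
  ∇ (fun x : Space d => φ (x, p.2)) p.1

/-- The vertical derivative `∂φ/∂y` of a function of `(x, y)`. -/
def derivY (φ : Space d × ℝ → ℝ) (p : Space d × ℝ) : ℝ :=
  deriv (fun y : ℝ => φ (p.1, y)) p.2

/-- The Laplacian in all the variables `(x, y)`. -/
def laplacianXY (φ : Space d × ℝ → ℝ) (p : Space d × ℝ) : ℝ :=
  Δ (fun x : Space d => φ (x, p.2)) p.1 + iteratedDeriv 2 (fun y : ℝ => φ (p.1, y)) p.2

/-- `φ` is the variational solution of `Δφ = 0` below the graph of `η`, `φ = f` on the graph: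
it is harmonic (hence smooth) in the open fluid domain, its full gradient is square integrable
there, and its trace on the graph, taken along vertical lines, is `f`. -/
structure IsHarmonicExtension (η f : Space d → ℝ) (φ : Space d × ℝ → ℝ) : Prop where
  smooth : ContDiffOn ℝ ∞ φ (fluidDomain η)
  harmonic : ∀ p ∈ fluidDomain η, laplacianXY φ p = 0
  finite_energy : IntegrableOn (fun p => ‖gradX φ p‖ ^ 2 + derivY φ p ^ 2) (fluidDomain η)
  trace : ∀ᵐ x : Space d, Tendsto (fun y : ℝ => φ (x, y)) (𝓝[<] (η x)) (𝓝 (f x))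

/-- The function `N` on `ℝ^d` is the rescaled outward normal derivative
`√(1 + |∇η|²) ∂_n φ` of `φ` on the graph of `η`, in the variational sense, that is through
Green's formula `∫_{y < η} ∇φ · ∇Φ = ∫ N(x) Φ(x, η(x)) dx` for all test functions `Φ`
(the surface element of the graph is `√(1 + |∇η|²) dx`). -/
def IsNormalDeriv (η : Space d → ℝ) (φ : Space d × ℝ → ℝ) (N : Space d → ℝ) : Prop :=
  LocallyIntegrable N ∧
    ∀ Φ : Space d × ℝ → ℝ, ContDiff ℝ ∞ Φ → HasCompactSupport Φ →
      ∫ p in fluidDomain η, (inner ℝ (gradX φ p) (gradX Φ p) + derivY φ p * derivY Φ p) =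
        ∫ x : Space d, N x * Φ (x, η x)

/-- `f` lies in the domain of the Dirichlet-Neumann operator `G(η)` and `G(η) f = N`
(almost everywhere). -/
def IsDirichletNeumann (η f N : Space d → ℝ) : Prop :=
  ∃ φ : Space d × ℝ → ℝ, IsHarmonicExtension η f φ ∧ IsNormalDeriv η φ N

open Classical in
/-- The Dirichlet-Neumann operator: `G η f` is the function `G(η) f`, which is determined up to
equality almost everywhere (and is given the value `0` if `f` is not in the domain of `G(η)`). -/
def G (η f : Space d → ℝ) : Space d → ℝ :=
  if h : ∃ N, IsDirichletNeumann η f N then h.choose else 0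

/-- `u ∈ C^∞([0, T]; H^∞(ℝ^d))`: `u` is smooth on `[0, T] × ℝ^d`, and its derivatives of every
order in `(t, x)` are square integrable in `x`, uniformly in `t ∈ [0, T]`. -/
def IsSobolevSmooth (T : ℝ) (u : ℝ → Space d → ℝ) : Prop :=
  ContDiffOn ℝ ∞ (fun q : ℝ × Space d => u q.1 q.2) (Icc 0 T ×ˢ univ) ∧
    ∀ n : ℕ, ∃ C : ℝ≥0, ∀ t ∈ Icc 0 T,
      eLpNorm (fun x : Space d =>
        iteratedFDerivWithin ℝ n (fun q : ℝ × Space d => u q.1 q.2) (Icc 0 T ×ˢ univ) (t, x))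
        2 volume ≤ C

/-- The time derivative on `[0, T]` (one-sided at the endpoints). -/
def dt (T : ℝ) (u : ℝ → Space d → ℝ) (t : ℝ) (x : Space d) : ℝ :=
  derivWithin (fun τ => u τ x) (Icc 0 T) t

/-- `(η, ψ)` is a smooth solution on `[0, T]` of the water-wave system in infinite depth with
gravity `g`, in the Zakharov-Craig-Sulem formulation. The field `mem_domain` says that the term
`G(η)ψ` in the equations is meaningful. -/
structure IsSmoothSolution (g T : ℝ) (η ψ : ℝ → Space d → ℝ) : Prop where
  smooth_eta : IsSobolevSmooth T η
  smooth_psi : IsSobolevSmooth T ψ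
  mem_domain : ∀ t ∈ Icc 0 T, ∃ N, IsDirichletNeumann (η t) (ψ t) N
  kinematic : ∀ t ∈ Icc 0 T, ∀ᵐ x : Space d, dt T η t x - G (η t) (ψ t) x = 0
  dynamic : ∀ t ∈ Icc 0 T, ∀ᵐ x : Space d,
    dt T ψ t x + g * η t x + 1 / 2 * ‖∇ (ψ t) x‖ ^ 2
      - (G (η t) (ψ t) x + inner ℝ (∇ (η t) x) (∇ (ψ t) x)) ^ 2
          / (2 * (1 + ‖∇ (η t) x‖ ^ 2)) = 0

/-- The integrand `g |η|² + ψ G(η)ψ` of the total energy. -/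
def energyDensity (g : ℝ) (η ψ : Space d → ℝ) (x : Space d) : ℝ :=
  g * |η x| ^ 2 + ψ x * G η ψ x

/-- The total energy `H(η, ψ)`. -/
def H (g : ℝ) (η ψ : Space d → ℝ) : ℝ :=
  ∫ x : Space d, energyDensity g η ψ x

end WaterWave

end

noncomputable section

namespace WaterWave

variable {d : ℕ}

/-! ### Sobolev embedding -/

/-! Write N = ∂ₜη, which is G(η)ψ by the kinematic equation; hence N is as smooth and as integrable
as η. The kinetic energy E = ∫ N ψ is the Dirichlet energy of the potential φ over the fluid
(`SliceData.integral_mul_eq`). Formally, E' comes from differentiating a Dirichlet integral over a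
moving domain. But nothing is assumed about how φ depends on time, and at the surface φ is
controlled only through its trace and Green's formula. The proof therefore never differentiates φ in
time.

Freeze a time t. Let χ be an explicit smooth function with the Cauchy data of φ on the graph: trace
ψ and normal derivative N. Because these data agree, u = φ - χ, extended by zero above the graph,
satisfies -Δu = F weakly on the whole space, where F is Δχ cut off to the fluid; no surface term
appears (`SliceData.weakData_remainder`). Comparing this equation with its vertical translates
bounds the L² norm of ∇u(x, y + δ) - ∇u(x, y) by δ‖F‖. Since ∇u vanishes above the graph, its L²
norm over the layer of depth δ below the graph is at most δ‖F‖ (`SliceData.setIntegral_shell_le`).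

Now use χ + u as a competitor in the Dirichlet principle at a nearby time s, with fluid domain Ω(s):
E(s) ≥ 2 ∫ N(s) (χ + u)(x, η(s)) - ∫_{Ω(s)} |∇(χ + u)|². By the layer estimate, the terms involving
u are bounded below by a constant up to O(|s - t|^{3/2}) (`SliceData.exists_energy_lower_bound`).
What remains involves only χ and smooth functions of time, so it is differentiable in s, and it
equals E at s = t. Since E is differentiable too, the two derivatives at t agree
(`hasDerivAt_eq_zero_of_ge`). This gives `deriv_kinetic_eq`: E' = 2 ∫ (∂ₜN ψ + B N²) - ∫ |∇χ|² N,
with B the vertical velocity on the surface.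

Differentiating ∫ N ψ directly gives E' = ∫ (∂ₜN ψ + N ∂ₜψ). On the graph the dynamic equation says
|∇χ|² = 2BN - 2∂ₜψ - 2gη. Substituting it gives E' = 2E' + 2g ∫ η N, so E' = -2g ∫ η N, which
cancels the derivative of the potential energy g ∫ η². -/

theorem norm_iteratedFDeriv_iteratedFDeriv {E F : Type*} [NormedAddCommGroup E] [NormedSpace ℝ E]
    [NormedAddCommGroup F] [NormedSpace ℝ F] (f : E → F) (n i : ℕ) (x : E) :
    ‖iteratedFDeriv ℝ i (iteratedFDeriv ℝ n f) x‖ = ‖iteratedFDeriv ℝ (n + i) f x‖ := by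
  induction n generalizing i with
  | zero =>
    rw [iteratedFDeriv_zero_eq_comp, LinearIsometryEquiv.norm_iteratedFDeriv_comp_left, zero_add]
  | succ n ih =>
    have h := LinearIsometryEquiv.norm_iteratedFDeriv_comp_left (𝕜 := ℝ)
      (F := E →L[ℝ] (E [×n]→L[ℝ] F)) (G := E [×(n + 1)]→L[ℝ] F)
      (continuousMultilinearCurryLeftEquiv ℝ (fun _ : Fin (n + 1) => E) F).symm
      (fderiv ℝ (iteratedFDeriv ℝ n f)) x i
    rw [norm_iteratedFDeriv_fderiv, ih, ← iteratedFDeriv_succ_eq_comp_left] at h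
    rw [h, show n + (i + 1) = n + 1 + i by ring]

/-- The fundamental theorem of calculus is applied along the coordinates of `s` one after another,
each costing one derivative and one integration. In the sup norm of `ι → ℝ` the coordinate vectors
have norm at most 1, so no constant appears. -/
theorem enorm_le_lmarginal_iteratedFDeriv {ι F : Type*} [Fintype ι] [DecidableEq ι]
    [NormedAddCommGroup F] [NormedSpace ℝ F] {h : (ι → ℝ) → F} (hh : ContDiff ℝ ∞ h)
    (hc : HasCompactSupport h) (s : Finset ι) (x : ι → ℝ) :
    ‖h x‖ₑ ≤ (∫⋯∫⁻_s, (fun y => ‖iteratedFDeriv ℝ s.card h y‖ₑ) ∂(fun _ => volume)) x := by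
  have hcont : ∀ n : ℕ, Continuous (iteratedFDeriv ℝ n h) := fun n =>
    hh.continuous_iteratedFDeriv (by exact_mod_cast le_top)
  induction s using Finset.induction_on with
  | empty =>
    rw [lmarginal_empty, Finset.card_empty, ← ofReal_norm, ← ofReal_norm, norm_iteratedFDeriv_zero]
  | insert i s hi ih =>
    rw [lmarginal_insert' _ (hcont _).enorm.measurable hi]
    refine ih.trans (lmarginal_mono (fun y => ?_) x)
    have hk : ContDiff ℝ ∞ (iteratedFDeriv ℝ s.card h) :=
      hh.iteratedFDeriv_right (by exact_mod_cast le_top)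
    have hk1 : ContDiff ℝ 1 (iteratedFDeriv ℝ s.card h) := hk.of_le (by exact_mod_cast le_top)
    have h1 : ContDiff ℝ 1 (iteratedFDeriv ℝ s.card h ∘ Function.update y i) :=
      hk1.comp (contDiff_update 1 y i)
    have h2 : HasCompactSupport (iteratedFDeriv ℝ s.card h ∘ Function.update y i) :=
      (hc.iteratedFDeriv s.card).comp_isClosedEmbedding (isClosedEmbedding_update y i)
    calc ‖iteratedFDeriv ℝ s.card h y‖ₑ
        ≤ ∫⁻ z in Iic (y i), ‖deriv (iteratedFDeriv ℝ s.card h ∘ Function.update y i) z‖ₑ := by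
          have := h2.enorm_le_lintegral_Ici_deriv h1 (y i)
          simpa using this
      _ ≤ ∫⁻ z, ‖deriv (iteratedFDeriv ℝ s.card h ∘ Function.update y i) z‖ₑ :=
          setLIntegral_le_lintegral _ _
      _ ≤ ∫⁻ z, ‖iteratedFDeriv ℝ (insert i s).card h (Function.update y i z)‖ₑ := by
          refine lintegral_mono fun z => ?_
          rw [fderiv_comp_deriv _ (hk1.differentiable one_ne_zero).differentiableAt
            (hasDerivAt_update y i z).differentiableAt, Finset.card_insert_of_notMem hi,
            (hasDerivAt_update y i z).deriv]
          rw [← ofReal_norm, ← ofReal_norm]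
          refine ENNReal.ofReal_le_ofReal ?_
          rw [← norm_fderiv_iteratedFDeriv]
          refine (ContinuousLinearMap.le_opNorm _ _).trans ?_
          have : ‖(Pi.single i (1 : ℝ) : ι → ℝ)‖ ≤ 1 := by
            rw [Pi.norm_single]; simp
          exact mul_le_of_le_one_right (norm_nonneg _) this

theorem enorm_le_lintegral_iteratedFDeriv {F : Type*}
    [NormedAddCommGroup F] [NormedSpace ℝ F] {h : Space d → F} (hh : ContDiff ℝ ∞ h)
    (hc : HasCompactSupport h) (x : Space d) :
    ‖h x‖ₑ ≤ ∫⁻ y, ENNReal.ofReal (‖((EuclideanSpace.equiv (Fin d) ℝ).symm :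
      (Fin d → ℝ) →L[ℝ] Space d)‖ ^ d) * ‖iteratedFDeriv ℝ d h y‖ₑ := by
  set e : (Fin d → ℝ) →L[ℝ] Space d := ((EuclideanSpace.equiv (Fin d) ℝ).symm :
      (Fin d → ℝ) →L[ℝ] Space d)
  have h1 : ContDiff ℝ ∞ (h ∘ e) := hh.comp e.contDiff
  have h2 : HasCompactSupport (h ∘ e) :=
    hc.comp_homeomorph (EuclideanSpace.equiv (Fin d) ℝ).symm.toHomeomorph
  have h3 := enorm_le_lmarginal_iteratedFDeriv h1 h2 Finset.univ (EuclideanSpace.equiv (Fin d) ℝ x)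
  rw [lmarginal_univ, Finset.card_fin] at h3
  have h4 : (h ∘ e) (EuclideanSpace.equiv (Fin d) ℝ x) = h x := by simp [e]
  rw [h4] at h3
  refine h3.trans ?_
  have hmp := PiLp.volume_preserving_toLp (Fin d)
  rw [← hmp.lintegral_comp_emb (MeasurableEquiv.toLp 2 (Fin d → ℝ)).measurableEmbedding]
  refine lintegral_mono fun y => ?_
  rw [← ofReal_norm, ← ofReal_norm, ← ENNReal.ofReal_mul (by positivity)]
  refine ENNReal.ofReal_le_ofReal ?_
  rw [e.iteratedFDeriv_comp_right hh y (by exact_mod_cast le_top), mul_comm]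
  refine (ContinuousMultilinearMap.norm_compContinuousLinearMap_le _ _).trans (le_of_eq ?_)
  simp only [Finset.prod_const, Finset.card_univ, Fintype.card_fin]
  rfl

/-- Multiply `v` by a bump centred at `x`, bound the product by the L¹ norm of its derivative of
order `d`, then use Leibniz and Cauchy–Schwarz. Translating the bump does not change its L² norms,
so `K` depends on neither `v` nor `x`; bounds uniform in time rely on this. -/
theorem exists_sup_bound_of_eLpNorm_iteratedFDeriv_le {F : Type*} [NormedAddCommGroup F]
    [NormedSpace ℝ F] (C : ℕ → ℝ≥0) :
    ∃ K : ℝ≥0, ∀ v : Space d → F, ContDiff ℝ ∞ v →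
      (∀ n, eLpNorm (iteratedFDeriv ℝ n v) 2 volume ≤ C n) → ∀ x, ‖v x‖ ≤ K := by
  let Θ : ContDiffBump (0 : Space d) := ⟨1, 2, one_pos, one_lt_two⟩
  have hΘs : ContDiff ℝ ∞ Θ := Θ.contDiff
  have hΘc : HasCompactSupport Θ := Θ.hasCompactSupport
  set c : ℝ≥0∞ := ENNReal.ofReal (‖((EuclideanSpace.equiv (Fin d) ℝ).symm :
      (Fin d → ℝ) →L[ℝ] Space d)‖ ^ d) with hc
  set B : ℝ≥0∞ := c * ∑ i ∈ Finset.range (d + 1), (d.choose i : ℝ≥0∞) *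
    (eLpNorm (iteratedFDeriv ℝ i Θ) 2 volume * C (d - i)) with hB
  have hΘi : ∀ i : ℕ, Continuous (iteratedFDeriv ℝ i Θ) := fun i =>
    hΘs.continuous_iteratedFDeriv (by exact_mod_cast le_top)
  have hBtop : B ≠ (⊤ : ℝ≥0∞) := by
    refine ENNReal.mul_ne_top ENNReal.ofReal_ne_top (ENNReal.sum_ne_top.2 fun i _ => ?_)
    refine ENNReal.mul_ne_top (ENNReal.natCast_ne_top _) (ENNReal.mul_ne_top ?_ ENNReal.coe_ne_top)
    exact ((hΘi i).memLp_of_hasCompactSupport (hΘc.iteratedFDeriv i)).eLpNorm_ne_top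
  refine ⟨B.toNNReal, fun v hv hC x => ?_⟩
  have hvi : ∀ i : ℕ, Continuous (iteratedFDeriv ℝ i v) := fun i =>
    hv.continuous_iteratedFDeriv (by exact_mod_cast le_top)
  have hτ : ContDiff ℝ ∞ (fun y => Θ (y - x)) := hΘs.comp (contDiff_id.sub contDiff_const)
  have hh : ContDiff ℝ ∞ (fun y => Θ (y - x) • v y) := hτ.smul hv
  have hcs : HasCompactSupport (fun y => Θ (y - x) • v y) :=
    HasCompactSupport.smul_right (hΘc.comp_homeomorph (Homeomorph.subRight x))
  have key : ‖v x‖ₑ ≤ B := by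
    have h1 := enorm_le_lintegral_iteratedFDeriv hh hcs x
    have h2 : Θ (x - x) • v x = v x := by
      rw [sub_self, Θ.one_of_mem_closedBall (by simp [Θ]), one_smul]
    simp only [h2] at h1
    refine h1.trans ?_
    rw [lintegral_const_mul' _ _ ENNReal.ofReal_ne_top, hB]
    refine mul_le_mul_right ?_ _
    calc ∫⁻ y, ‖iteratedFDeriv ℝ d (fun y => Θ (y - x) • v y) y‖ₑ
        ≤ ∫⁻ y, ∑ i ∈ Finset.range (d + 1), (d.choose i : ℝ≥0∞) *
            (‖iteratedFDeriv ℝ i Θ (y - x)‖ₑ * ‖iteratedFDeriv ℝ (d - i) v y‖ₑ) := by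
          refine lintegral_mono fun y => ?_
          have := norm_iteratedFDeriv_smul_le (n := d) hτ hv y (by exact_mod_cast le_top)
          rw [← ofReal_norm]
          refine (ENNReal.ofReal_le_ofReal this).trans (le_of_eq ?_)
          rw [ENNReal.ofReal_sum_of_nonneg (fun _ _ => by positivity)]
          refine Finset.sum_congr rfl fun i _ => ?_
          rw [ENNReal.ofReal_mul (by positivity), ENNReal.ofReal_mul (by positivity),
            ENNReal.ofReal_natCast, ofReal_norm, ofReal_norm, mul_assoc]
          simp only [iteratedFDeriv_comp_sub]
      _ = ∑ i ∈ Finset.range (d + 1), (d.choose i : ℝ≥0∞) *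
            ∫⁻ y, (‖iteratedFDeriv ℝ i Θ (y - x)‖ₑ * ‖iteratedFDeriv ℝ (d - i) v y‖ₑ) := by
          have hm : ∀ i, Measurable fun y => ‖iteratedFDeriv ℝ i Θ (y - x)‖ₑ *
              ‖iteratedFDeriv ℝ (d - i) v y‖ₑ := fun i =>
            (((hΘi i).comp (continuous_id.sub continuous_const)).enorm.measurable).mul
              (hvi _).enorm.measurable
          rw [lintegral_finsetSum _ fun i _ => (hm i).const_mul _]
          exact Finset.sum_congr rfl fun i _ => lintegral_const_mul _ (hm i)
      _ ≤ _ := by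
          refine Finset.sum_le_sum fun i _ => mul_le_mul_right ?_ _
          have h3 := eLpNorm_smul_le_mul_eLpNorm (p := 2) (q := 2) (r := 1) (μ := volume)
            (f := fun y => ‖iteratedFDeriv ℝ (d - i) v y‖)
            (φ := fun y => ‖iteratedFDeriv ℝ i Θ (y - x)‖) (hvi _).norm.aestronglyMeasurable
            ((hΘi i).comp (continuous_id.sub continuous_const)).norm.aestronglyMeasurable
          rw [eLpNorm_one_eq_lintegral_enorm] at h3
          have e1 : eLpNorm (fun y => ‖iteratedFDeriv ℝ i Θ (y - x)‖) 2 volume =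
              eLpNorm (iteratedFDeriv ℝ i Θ) 2 volume := by
            rw [eLpNorm_norm]
            exact eLpNorm_comp_measurePreserving (hΘi i).aestronglyMeasurable
              (measurePreserving_sub_right volume x)
          rw [e1, eLpNorm_norm] at h3
          refine le_trans (le_of_eq ?_) (h3.trans (mul_le_mul_right (hC _) _))
          refine lintegral_congr fun y => ?_
          simp [enorm_mul]
  have := ENNReal.toReal_mono hBtop key
  rwa [toReal_enorm] at this

/-! ### Sobolev-smooth functions of space and time -/

theorem uniqueDiffOn_slab {T : ℝ} (hT : 0 < T) :
    UniqueDiffOn ℝ (Icc 0 T ×ˢ (univ : Set (Space d))) :=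
  (uniqueDiffOn_Icc hT).prod uniqueDiffOn_univ

theorem IsSobolevSmooth.contDiff_slice {T : ℝ} {u : ℝ → Space d → ℝ} (hu : IsSobolevSmooth T u)
    {t : ℝ} (ht : t ∈ Icc 0 T) : ContDiff ℝ ∞ (u t) := by
  rw [← contDiffOn_univ]
  exact hu.1.comp (f := fun x : Space d => (t, x)) (contDiff_const.prodMk contDiff_id).contDiffOn
    fun x _ => ⟨ht, mem_univ _⟩

-- The slice is the function on the slab composed with the affine map x ↦ (t, x), whose linear part
-- has norm at most 1. The chain rule used here is for linear maps, so the slab is first translated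
-- to bring (t, 0) to the origin.
open scoped Pointwise in
theorem IsSobolevSmooth.norm_iteratedFDeriv_slice_le {T : ℝ} (hT : 0 < T) {u : ℝ → Space d → ℝ}
    (hu : IsSobolevSmooth T u) {t : ℝ} (ht : t ∈ Icc 0 T) (n : ℕ) (x : Space d) :
    ‖iteratedFDeriv ℝ n (u t) x‖ ≤ ‖iteratedFDerivWithin ℝ n (fun q : ℝ × Space d => u q.1 q.2)
      (Icc 0 T ×ˢ univ) (t, x)‖ := by
  set S : Set (ℝ × Space d) := Icc 0 T ×ˢ univ with hS
  set U : ℝ × Space d → ℝ := fun q => u q.1 q.2 with hU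
  set a : ℝ × Space d := (t, 0) with ha
  set S' : Set (ℝ × Space d) := (-a) +ᵥ S with hS'
  have hmem : ∀ q, q ∈ S' ↔ a + q ∈ S := fun q => by
    rw [hS', Set.mem_vadd_set_iff_neg_vadd_mem, neg_neg, vadd_eq_add]
  have haS : a +ᵥ S' = S := by rw [hS', vadd_vadd, add_neg_cancel, zero_vadd]
  have hS'prod : S' = Icc (-t) (T - t) ×ˢ univ := by
    ext q
    rw [hmem]
    simp only [hS, ha, mem_prod, Prod.fst_add, mem_Icc, mem_univ, and_true]
    constructor <;> rintro ⟨h1, h2⟩ <;> constructor <;> linarith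
  have hud : UniqueDiffOn ℝ S' := by
    rw [hS'prod]
    exact (uniqueDiffOn_Icc (by linarith)).prod uniqueDiffOn_univ
  let g : Space d →L[ℝ] ℝ × Space d := ContinuousLinearMap.inr ℝ ℝ (Space d)
  have hpre : g ⁻¹' S' = univ := by
    ext y
    simp only [mem_preimage, hmem, mem_univ, iff_true]
    simpa [g, ha, hS] using ht
  have hV : ContDiffOn ℝ ∞ (fun q => U (a + q)) S' :=
    hu.1.comp (contDiff_const.add contDiff_id).contDiffOn fun q hq => (hmem q).1 hq
  have h1 := g.iteratedFDerivWithin_comp_right hV hud (by rw [hpre]; exact uniqueDiffOn_univ)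
    (x := x) (by have : x ∈ g ⁻¹' S' := hpre ▸ mem_univ x
                 exact this) (i := n) (by exact_mod_cast le_top)
  have h2 : (fun q => U (a + q)) ∘ g = u t := by
    ext y; simp [U, g, ha]
  rw [h2, hpre, iteratedFDerivWithin_univ, iteratedFDerivWithin_comp_add_left, haS] at h1
  have h3 : a + g x = (t, x) := by simp [g, ha]
  rw [h3] at h1
  rw [h1]
  refine (ContinuousMultilinearMap.norm_compContinuousLinearMap_le _ _).trans ?_
  refine mul_le_of_le_one_right (norm_nonneg _) (Finset.prod_le_one (fun _ _ => norm_nonneg _) ?_)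
  exact fun _ _ => ContinuousLinearMap.norm_inr_le_one ℝ ℝ (Space d)

theorem IsSobolevSmooth.hasDerivWithinAt_dt {T : ℝ} {u : ℝ → Space d → ℝ}
    (hu : IsSobolevSmooth T u) {t : ℝ} (ht : t ∈ Icc 0 T) (x : Space d) :
    HasDerivWithinAt (fun τ => u τ x) (dt T u t x) (Icc 0 T) t := by
  have h : ContDiffOn ℝ ∞ (fun τ => u τ x) (Icc 0 T) :=
    hu.1.comp (f := fun τ : ℝ => (τ, x)) (contDiff_id.prodMk contDiff_const).contDiffOn
      fun τ hτ => ⟨hτ, mem_univ _⟩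
  exact ((h.differentiableOn (by simp)) t ht).hasDerivWithinAt

theorem IsSobolevSmooth.dt_eq {T : ℝ} (hT : 0 < T) {u : ℝ → Space d → ℝ}
    (hu : IsSobolevSmooth T u) {t : ℝ} (ht : t ∈ Icc 0 T) (x : Space d) :
    dt T u t x = fderivWithin ℝ (fun q : ℝ × Space d => u q.1 q.2) (Icc 0 T ×ˢ univ) (t, x)
      (1, 0) := by
  have h1 := ((hu.1.differentiableOn (by simp)) (t, x) ⟨ht, mem_univ _⟩).hasFDerivWithinAt
  have h2 : HasDerivWithinAt (fun τ : ℝ => (τ, x)) ((1 : ℝ), (0 : Space d)) (Icc 0 T) t :=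
    (hasDerivWithinAt_id t _).prodMk (hasDerivWithinAt_const t _ x)
  have hm : MapsTo (fun τ : ℝ => (τ, x)) (Icc 0 T) (Icc 0 T ×ˢ univ) :=
    fun τ hτ => ⟨hτ, mem_univ _⟩
  have h3 := h1.comp_hasDerivWithinAt t h2 hm
  exact h3.derivWithin ((uniqueDiffOn_Icc hT) t ht)

theorem IsSobolevSmooth.dt {T : ℝ} (hT : 0 < T) {u : ℝ → Space d → ℝ}
    (hu : IsSobolevSmooth T u) : IsSobolevSmooth T (WaterWave.dt T u) := by
  have hud := uniqueDiffOn_slab (d := d) hT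
  have hEq : EqOn (fun q : ℝ × Space d => WaterWave.dt T u q.1 q.2)
      (fun q => fderivWithin ℝ (fun q : ℝ × Space d => u q.1 q.2) (Icc 0 T ×ˢ univ) q (1, 0))
      (Icc 0 T ×ˢ univ) := fun q hq => hu.dt_eq hT hq.1 q.2
  have hD : ContDiffOn ℝ ∞ (fderivWithin ℝ (fun q : ℝ × Space d => u q.1 q.2) (Icc 0 T ×ˢ univ))
      (Icc 0 T ×ˢ univ) := hu.1.fderivWithin hud (by exact_mod_cast le_top)
  refine ⟨(hD.clm_apply contDiffOn_const).congr hEq, fun n => ?_⟩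
  obtain ⟨C, hC⟩ := hu.2 (n + 1)
  refine ⟨C, fun t ht => le_trans (eLpNorm_mono fun x => ?_) (hC t ht)⟩
  have hx : (t, x) ∈ Icc 0 T ×ˢ (univ : Set (Space d)) := ⟨ht, mem_univ _⟩
  rw [iteratedFDerivWithin_congr hEq hx n]
  refine (norm_iteratedFDerivWithin_clm_apply_const (hD _ hx) hud hx
    (by exact_mod_cast le_top)).trans ?_
  rw [norm_iteratedFDerivWithin_fderivWithin hud hx]
  refine mul_le_of_le_one_left (norm_nonneg _) ?_
  simp [Prod.norm_def]

theorem IsSobolevSmooth.hasDerivAt_dt {T : ℝ} {u : ℝ → Space d → ℝ}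
    (hu : IsSobolevSmooth T u) {t : ℝ} (ht : t ∈ Ioo 0 T) (x : Space d) :
    HasDerivAt (fun τ => u τ x) (WaterWave.dt T u t x) t :=
  (hu.hasDerivWithinAt_dt (Ioo_subset_Icc_self ht) x).hasDerivAt (Icc_mem_nhds ht.1 ht.2)

theorem IsSobolevSmooth.eLpNorm_iteratedFDeriv_slice_le {T : ℝ} (hT : 0 < T)
    {u : ℝ → Space d → ℝ} (hu : IsSobolevSmooth T u) :
    ∃ C : ℕ → ℝ≥0, ∀ t ∈ Icc 0 T, ∀ n, eLpNorm (iteratedFDeriv ℝ n (u t)) 2 volume ≤ C n := by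
  choose C hC using hu.2
  exact ⟨C, fun t ht n => (eLpNorm_mono fun x =>
    hu.norm_iteratedFDeriv_slice_le hT ht n x).trans (hC n t ht)⟩

/-- Smooth functions with bounded derivatives of every order. -/
structure TameB (a : Space d → ℝ) : Prop where
  smooth : ContDiff ℝ ∞ a
  bdd : ∀ n : ℕ, ∃ C : ℝ, ∀ x, ‖iteratedFDeriv ℝ n a x‖ ≤ C

/-- Smooth functions whose derivatives of every order are bounded and square integrable. -/
structure TameL2 (a : Space d → ℝ) : Prop extends TameB a where
  memLp : ∀ n : ℕ, MemLp (iteratedFDeriv ℝ n a) 2 volume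

theorem IsSobolevSmooth.tameL2 {T : ℝ} (hT : 0 < T) {u : ℝ → Space d → ℝ}
    (hu : IsSobolevSmooth T u) {t : ℝ} (ht : t ∈ Icc 0 T) : TameL2 (u t) := by
  obtain ⟨C, hC⟩ := hu.eLpNorm_iteratedFDeriv_slice_le hT
  have hs := hu.contDiff_slice ht
  have hi : ∀ n : ℕ, ContDiff ℝ ∞ (iteratedFDeriv ℝ n (u t)) := fun n =>
    hs.iteratedFDeriv_right (by exact_mod_cast le_top)
  refine ⟨⟨hs, fun n => ?_⟩, fun n => ⟨(hi n).continuous.aestronglyMeasurable,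
    (hC t ht n).trans_lt ENNReal.coe_lt_top⟩⟩
  obtain ⟨K, hK⟩ := exists_sup_bound_of_eLpNorm_iteratedFDeriv_le (d := d)
    (F := (Space d) [×n]→L[ℝ] ℝ) (fun m => C (n + m))
  refine ⟨K, hK _ (hi n) fun m => ?_⟩
  refine le_trans (le_of_eq (eLpNorm_congr_norm_ae (ae_of_all _ fun x => ?_))) (hC t ht (n + m))
  exact norm_iteratedFDeriv_iteratedFDeriv _ _ _ _

theorem IsSobolevSmooth.exists_bound {T : ℝ} (hT : 0 < T) {u : ℝ → Space d → ℝ}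
    (hu : IsSobolevSmooth T u) : ∃ K : ℝ, ∀ t ∈ Icc 0 T, ∀ x, |u t x| ≤ K := by
  obtain ⟨C, hC⟩ := hu.eLpNorm_iteratedFDeriv_slice_le hT
  obtain ⟨K, hK⟩ := exists_sup_bound_of_eLpNorm_iteratedFDeriv_le (d := d) (F := ℝ) C
  exact ⟨K, fun t ht x => hK _ (hu.contDiff_slice ht) (hC t ht) x⟩

theorem IsSobolevSmooth.memLp_slab {T : ℝ} (hT : 0 < T) {u : ℝ → Space d → ℝ}
    (hu : IsSobolevSmooth T u) : MemLp (fun q : ℝ × Space d => u q.1 q.2) 2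
      ((volume.restrict (Icc 0 T)).prod volume) := by
  obtain ⟨C, hC⟩ := hu.eLpNorm_iteratedFDeriv_slice_le hT
  have hm : AEStronglyMeasurable (fun q : ℝ × Space d => u q.1 q.2)
      ((volume.restrict (Icc 0 T)).prod volume) := by
    have := hu.1.continuousOn.aestronglyMeasurable (μ := volume)
      (measurableSet_Icc.prod MeasurableSet.univ)
    rwa [Measure.volume_eq_prod, ← Measure.prod_restrict, Measure.restrict_univ] at this
  refine ⟨hm, ?_⟩
  have h2 := fun (μ : Measure (ℝ × Space d)) (f : ℝ × Space d → ℝ) =>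
    eLpNorm_nnreal_pow_eq_lintegral (f := f) (μ := μ) (p := 2) two_ne_zero
  have h3 := fun (f : Space d → ℝ) =>
    eLpNorm_nnreal_pow_eq_lintegral (f := f) (μ := volume) (p := 2) two_ne_zero
  have h4 : eLpNorm (fun q : ℝ × Space d => u q.1 q.2) 2
      ((volume.restrict (Icc 0 T)).prod volume) ^ (2 : ℝ) < ⊤ := by
    have := h2 ((volume.restrict (Icc 0 T)).prod volume) (fun q : ℝ × Space d => u q.1 q.2)
    simp only [NNReal.coe_ofNat, ENNReal.coe_ofNat] at this
    rw [this, lintegral_prod _ (hm.enorm.pow_const _)]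
    calc ∫⁻ t in Icc 0 T, ∫⁻ x, ‖u t x‖ₑ ^ (2 : ℝ) ≤ ∫⁻ t in Icc 0 T, (C 0 : ℝ≥0∞) ^ (2 : ℝ) := by
          refine setLIntegral_mono measurable_const fun t ht => ?_
          have h5 := h3 (u t)
          simp only [NNReal.coe_ofNat, ENNReal.coe_ofNat] at h5
          rw [← h5]
          refine ENNReal.rpow_le_rpow ?_ zero_le_two
          refine le_trans (le_of_eq (eLpNorm_congr_norm_ae (ae_of_all _ fun x => ?_))) (hC t ht 0)
          rw [norm_iteratedFDeriv_zero]
      _ < ⊤ := by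
          rw [setLIntegral_const]
          exact ENNReal.mul_lt_top (ENNReal.rpow_lt_top_of_nonneg zero_le_two ENNReal.coe_ne_top)
            (by simp)
  by_contra h
  rw [not_lt, top_le_iff] at h
  rw [h] at h4
  simp at h4

/-- Since ∂ₜ(u²) = 2u ∂ₜu ≤ u² + (∂ₜu)², the value u(t, x)² is at most u(0, x)² plus the integral of
u² + (∂ₜu)² over [0, T]. That bound does not depend on t and is integrable in x by Fubini; its
square root is the majorant needed to differentiate under the integral sign. -/
theorem IsSobolevSmooth.exists_dominating {T : ℝ} (hT : 0 < T) {u : ℝ → Space d → ℝ}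
    (hu : IsSobolevSmooth T u) :
    ∃ W : Space d → ℝ, MemLp W 2 volume ∧ ∀ t ∈ Icc 0 T, ∀ x, |u t x| ≤ W x := by
  have h0 : (0 : ℝ) ∈ Icc 0 T := ⟨le_rfl, hT.le⟩
  set Q : Space d → ℝ := fun x => u 0 x ^ 2 +
    ∫ σ in Icc 0 T, (u σ x ^ 2 + WaterWave.dt T u σ x ^ 2) with hQ
  have hQ0 : ∀ x, 0 ≤ Q x := fun x =>
    add_nonneg (sq_nonneg _) (integral_nonneg fun σ => by positivity)
  have hu0 : MemLp (u 0) 2 volume := by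
    have h1 := (hu.tameL2 hT h0).memLp 0
    refine h1.of_le (hu.contDiff_slice h0).continuous.aestronglyMeasurable (ae_of_all _ fun x => ?_)
    rw [norm_iteratedFDeriv_zero]
  have hQi : Integrable Q volume :=
    hu0.integrable_sq.add ((hu.memLp_slab hT).integrable_sq.add
      ((hu.dt hT).memLp_slab hT).integrable_sq).integral_prod_right
  refine ⟨fun x => √(Q x), ?_, fun t ht x => ?_⟩
  · rw [memLp_two_iff_integrable_sq (Real.continuous_sqrt.comp_aestronglyMeasurable
      hQi.aestronglyMeasurable)]
    exact hQi.congr (ae_of_all _ fun x => (Real.sq_sqrt (hQ0 x)).symm)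
  · refine Real.abs_le_sqrt ?_
    have hcu : ContinuousOn (fun σ => u σ x) (Icc 0 T) := fun σ hσ =>
      (hu.hasDerivWithinAt_dt hσ x).continuousWithinAt
    have hcd : ContinuousOn (fun σ => WaterWave.dt T u σ x) (Icc 0 T) := fun σ hσ =>
      ((hu.dt hT).hasDerivWithinAt_dt hσ x).continuousWithinAt
    have hsub : Icc 0 t ⊆ Icc 0 T := Icc_subset_Icc le_rfl ht.2
    have hftc : ∫ σ in (0 : ℝ)..t, 2 * u σ x * WaterWave.dt T u σ x = u t x ^ 2 - u 0 x ^ 2 := by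
      refine intervalIntegral.integral_eq_sub_of_hasDeriv_right_of_le (f := fun σ => u σ x ^ 2) ht.1
        ((hcu.mono hsub).pow 2) (fun σ hσ => ?_) ?_
      · have := (hu.hasDerivAt_dt ⟨hσ.1, hσ.2.trans_le ht.2⟩ x).fun_pow 2
        simpa using this.hasDerivWithinAt
      · refine ContinuousOn.intervalIntegrable ?_
        rw [uIcc_of_le ht.1]
        exact (continuousOn_const.mul (hcu.mono hsub)).mul (hcd.mono hsub)
    have hint : IntegrableOn (fun σ => u σ x ^ 2 + WaterWave.dt T u σ x ^ 2) (Icc 0 T) :=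
      ((hcu.pow 2).add (hcd.pow 2)).integrableOn_compact isCompact_Icc
    have h1 : ∫ σ in (0 : ℝ)..t, 2 * u σ x * WaterWave.dt T u σ x ≤
        ∫ σ in Icc 0 T, (u σ x ^ 2 + WaterWave.dt T u σ x ^ 2) := by
      rw [intervalIntegral.integral_of_le ht.1]
      have hs' : Ioc 0 t ⊆ Icc 0 T := Ioc_subset_Icc_self.trans hsub
      refine le_trans (setIntegral_mono_on ?_ (hint.mono_set hs') measurableSet_Ioc
        fun σ _ => ?_) (setIntegral_mono_set hint (ae_of_all _ fun σ => ?_) (hs'.eventuallyLE))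
      · exact (((continuousOn_const.mul (hcu.mono hsub)).mul (hcd.mono hsub)).integrableOn_compact
          isCompact_Icc).mono_set Ioc_subset_Icc_self
      · nlinarith [sq_nonneg (u σ x - WaterWave.dt T u σ x)]
      · simp only [Pi.zero_apply]; positivity
    simp only [hQ]
    linarith

/-! ### Algebra of tame functions -/

theorem TameB.const (c : ℝ) : TameB (fun _ : Space d => c) where
  smooth := contDiff_const
  bdd n := by
    rcases Nat.eq_zero_or_pos n with rfl | hn
    · exact ⟨‖c‖, fun x => by rw [norm_iteratedFDeriv_zero]⟩
    · exact ⟨0, fun x => by rw [iteratedFDeriv_const_of_ne hn.ne']; simp⟩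

theorem TameB.add {a b : Space d → ℝ} (ha : TameB a) (hb : TameB b) :
    TameB (fun x => a x + b x) where
  smooth := ha.smooth.add hb.smooth
  bdd n := by
    obtain ⟨A, hA⟩ := ha.bdd n
    obtain ⟨B, hB⟩ := hb.bdd n
    refine ⟨A + B, fun x => ?_⟩
    rw [fun_iteratedFDeriv_add_apply (ha.smooth.of_le (by exact_mod_cast le_top)).contDiffAt
      (hb.smooth.of_le (by exact_mod_cast le_top)).contDiffAt]
    exact (norm_add_le _ _).trans (add_le_add (hA x) (hB x))

theorem TameL2.add {a b : Space d → ℝ} (ha : TameL2 a) (hb : TameL2 b) :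
    TameL2 (fun x => a x + b x) where
  toTameB := ha.toTameB.add hb.toTameB
  memLp n := by
    have : iteratedFDeriv ℝ n (fun x => a x + b x) =
        iteratedFDeriv ℝ n a + iteratedFDeriv ℝ n b :=
      fun_iteratedFDeriv_add (ha.smooth.of_le (by exact_mod_cast le_top))
        (hb.smooth.of_le (by exact_mod_cast le_top))
    rw [this]
    exact (ha.memLp n).add (hb.memLp n)

theorem TameB.mul {a b : Space d → ℝ} (ha : TameB a) (hb : TameB b) :
    TameB (fun x => a x * b x) where
  smooth := ha.smooth.mul hb.smooth
  bdd n := by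
    choose A hA using ha.bdd
    choose B hB using hb.bdd
    refine ⟨∑ i ∈ Finset.range (n + 1), (n.choose i : ℝ) * A i * B (n - i), fun x => ?_⟩
    refine (norm_iteratedFDeriv_mul_le ha.smooth hb.smooth x
      (by exact_mod_cast le_top)).trans (Finset.sum_le_sum fun i _ => ?_)
    have := (norm_nonneg _).trans (hA i x)
    gcongr
    · exact hA i x
    · exact hB _ x

theorem TameB.mul_tameL2 {a b : Space d → ℝ} (ha : TameB a) (hb : TameL2 b) :
    TameL2 (fun x => a x * b x) where
  toTameB := ha.mul hb.toTameB
  memLp n := by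
    choose A hA using ha.bdd
    have hs : ContDiff ℝ ∞ (fun x => a x * b x) := ha.smooth.mul hb.smooth
    have h1 : MemLp (fun x => ∑ i ∈ Finset.range (n + 1),
        (n.choose i : ℝ) * A i * ‖iteratedFDeriv ℝ (n - i) b x‖) 2 volume :=
      memLp_finsetSum _ fun i _ => ((hb.memLp (n - i)).norm).const_mul _
    refine h1.of_le
      (hs.continuous_iteratedFDeriv (by exact_mod_cast le_top)).aestronglyMeasurable
      (ae_of_all _ fun x => ?_)
    refine (norm_iteratedFDeriv_mul_le ha.smooth hb.smooth x
      (by exact_mod_cast le_top)).trans (le_trans (Finset.sum_le_sum fun i _ => ?_)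
        (le_abs_self _))
    gcongr
    exact hA i x

theorem TameB.fderiv_apply {a : Space d → ℝ} (ha : TameB a) (e : Space d) :
    TameB (fun x => fderiv ℝ a x e) where
  smooth := (ha.smooth.fderiv_right (by exact_mod_cast le_top)).clm_apply contDiff_const
  bdd n := by
    obtain ⟨A, hA⟩ := ha.bdd (n + 1)
    refine ⟨‖e‖ * A, fun x => ?_⟩
    have h1 : ContDiff ℝ ∞ (fderiv ℝ a) := ha.smooth.fderiv_right (by exact_mod_cast le_top)
    refine (norm_iteratedFDeriv_clm_apply_const h1.contDiffAt (by exact_mod_cast le_top)).trans ?_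
    rw [norm_iteratedFDeriv_fderiv]
    gcongr
    exact hA x

theorem TameL2.fderiv_apply {a : Space d → ℝ} (ha : TameL2 a) (e : Space d) :
    TameL2 (fun x => fderiv ℝ a x e) where
  toTameB := ha.toTameB.fderiv_apply e
  memLp n := by
    have h1 : ContDiff ℝ ∞ (fderiv ℝ a) := ha.smooth.fderiv_right (by exact_mod_cast le_top)
    refine ((ha.memLp (n + 1)).norm.const_mul ‖e‖).of_le
      (((ha.toTameB.fderiv_apply e).smooth.continuous_iteratedFDeriv
        (by exact_mod_cast le_top)).aestronglyMeasurable) (ae_of_all _ fun x => ?_)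
    refine (norm_iteratedFDeriv_clm_apply_const h1.contDiffAt (by exact_mod_cast le_top)).trans ?_
    rw [norm_iteratedFDeriv_fderiv, norm_mul, norm_norm, norm_norm]

/-- From D(a⁻¹) = -a⁻² Da, the derivative of order n + 1 of a⁻¹ involves a⁻¹ only up to order n, so
Leibniz and strong induction suffice. The lower bound on `a` settles order zero. -/
theorem TameB.inv {a : Space d → ℝ} (ha : TameB a) (h1 : ∀ x, 1 ≤ a x) :
    TameB (fun x => (a x)⁻¹) := by
  have h0 : ∀ x, a x ≠ 0 := fun x => (zero_lt_one.trans_le (h1 x)).ne'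
  have hs : ContDiff ℝ ∞ (fun x => (a x)⁻¹) := ha.smooth.inv h0
  refine ⟨hs, fun n => ?_⟩
  induction n using Nat.strong_induction_on with
  | _ n ih =>
    rcases n with _ | n
    · refine ⟨1, fun x => ?_⟩
      rw [norm_iteratedFDeriv_zero, Real.norm_eq_abs, abs_inv, abs_of_pos (by linarith [h1 x])]
      exact inv_le_one_of_one_le₀ (h1 x)
    -- The statement is vacuous from n + 1 on, so that `choose` produces a total sequence of
    -- constants.
    · have ih' : ∀ i : ℕ, ∃ C : ℝ, i < n + 1 →
          ∀ x, ‖iteratedFDeriv ℝ i (fun x => (a x)⁻¹) x‖ ≤ C := fun i => by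
        by_cases hi : i < n + 1
        · obtain ⟨C, hC⟩ := ih i hi
          exact ⟨C, fun _ => hC⟩
        · exact ⟨0, fun h => absurd h hi⟩
      choose C hC using ih'
      choose A hA using ha.bdd
      have hsq : ContDiff ℝ ∞ (fun x => (a x)⁻¹ * (a x)⁻¹) := hs.mul hs
      have hda : ContDiff ℝ ∞ (fun x => - fderiv ℝ a x) :=
        (ha.smooth.fderiv_right (by exact_mod_cast le_top)).neg
      have hfd : fderiv ℝ (fun x => (a x)⁻¹) =
          fun x => ((a x)⁻¹ * (a x)⁻¹) • (- fderiv ℝ a x) := by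
        ext x v
        have := (hasFDerivAt_inv (h0 x)).comp x
          (ha.smooth.differentiable (by simp) x).hasFDerivAt
        have h2 : fderiv ℝ (fun x => (a x)⁻¹) x = _ := this.fderiv
        rw [h2]
        simp
        ring
      refine ⟨∑ i ∈ Finset.range (n + 1), (n.choose i : ℝ) *
        (∑ j ∈ Finset.range (i + 1), (i.choose j : ℝ) * C j * C (i - j)) * A (n - i + 1),
        fun x => ?_⟩
      rw [← norm_iteratedFDeriv_fderiv, hfd]
      refine (norm_iteratedFDeriv_smul_le hsq hda x (by exact_mod_cast le_top)).trans
        (Finset.sum_le_sum fun i hi => ?_)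
      rw [Finset.mem_range] at hi
      have hsum : ‖iteratedFDeriv ℝ i (fun x => (a x)⁻¹ * (a x)⁻¹) x‖ ≤
          ∑ j ∈ Finset.range (i + 1), (i.choose j : ℝ) * C j * C (i - j) := by
        refine (norm_iteratedFDeriv_mul_le hs hs x (by exact_mod_cast le_top)).trans
          (Finset.sum_le_sum fun j hj => ?_)
        rw [Finset.mem_range] at hj
        have h3 := hC j (by omega) x
        have h4 := hC (i - j) (by omega) x
        have := (norm_nonneg _).trans h3
        gcongr
      have hneg : ‖iteratedFDeriv ℝ (n - i) (fun x => - fderiv ℝ a x) x‖ ≤ A (n - i + 1) := by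
        have : (fun x => - fderiv ℝ a x) = - fderiv ℝ a := rfl
        rw [this, iteratedFDeriv_neg_apply, norm_neg, norm_iteratedFDeriv_fderiv]
        exact hA _ x
      have := (norm_nonneg _).trans hsum
      gcongr

theorem inner_gradient_gradient (a b : Space d → ℝ) (x : Space d) :
    inner ℝ (∇ a x) (∇ b x) = ∑ i, fderiv ℝ a x (EuclideanSpace.single i 1) *
      fderiv ℝ b x (EuclideanSpace.single i 1) := by
  rw [← (EuclideanSpace.basisFun (Fin d) ℝ).sum_inner_mul_inner]
  refine Finset.sum_congr rfl fun i _ => ?_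
  rw [EuclideanSpace.basisFun_apply, gradient, gradient, InnerProductSpace.toDual_symm_apply,
    real_inner_comm, InnerProductSpace.toDual_symm_apply]

theorem TameB.sum {ι : Type*} (s : Finset ι) {a : ι → Space d → ℝ} (ha : ∀ i, TameB (a i)) :
    TameB (fun x => ∑ i ∈ s, a i x) := by
  classical
  induction s using Finset.induction_on with
  | empty => simpa using TameB.const 0
  | insert i s hi ih => simpa [Finset.sum_insert hi] using (ha i).add ih

theorem TameL2.zero : TameL2 (fun _ : Space d => (0 : ℝ)) where
  toTameB := TameB.const 0
  memLp n := by
    have : iteratedFDeriv ℝ n (fun _ : Space d => (0 : ℝ)) = 0 := iteratedFDeriv_fun_zero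
    rw [this]
    exact MemLp.zero

theorem TameL2.sum {ι : Type*} (s : Finset ι) {a : ι → Space d → ℝ} (ha : ∀ i, TameL2 (a i)) :
    TameL2 (fun x => ∑ i ∈ s, a i x) := by
  classical
  induction s using Finset.induction_on with
  | empty => simpa using TameL2.zero
  | insert i s hi ih => simpa [Finset.sum_insert hi] using (ha i).add ih

theorem TameB.inner_gradient {a b : Space d → ℝ} (ha : TameB a) (hb : TameB b) :
    TameB (fun x => inner ℝ (∇ a x) (∇ b x)) := by
  simp only [inner_gradient_gradient]
  exact TameB.sum _ fun i => (ha.fderiv_apply _).mul (hb.fderiv_apply _)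

theorem TameB.inner_gradient_tameL2 {a b : Space d → ℝ} (ha : TameB a) (hb : TameL2 b) :
    TameL2 (fun x => inner ℝ (∇ a x) (∇ b x)) := by
  simp only [inner_gradient_gradient]
  exact TameL2.sum _ fun i => (ha.fderiv_apply _).mul_tameL2 (hb.fderiv_apply _)

theorem TameL2.memLp_self {a : Space d → ℝ} (ha : TameL2 a) : MemLp a 2 volume :=
  (ha.memLp 0).of_le ha.smooth.continuous.aestronglyMeasurable
    (ae_of_all _ fun x => by rw [norm_iteratedFDeriv_zero])

/-- The vertical velocity on the graph of `η` of a potential with trace `ψ` and rescaled normal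
derivative `N`. -/
def vertVel (η ψ N : Space d → ℝ) (x : Space d) : ℝ :=
  (1 + ‖∇ η x‖ ^ 2)⁻¹ * (N x + inner ℝ (∇ η x) (∇ ψ x))

theorem tameL2_vertVel {η ψ N : Space d → ℝ} (hη : TameB η) (hψ : TameL2 ψ) (hN : TameL2 N) :
    TameL2 (vertVel η ψ N) := by
  refine TameB.mul_tameL2 (TameB.inv ?_ fun x => by nlinarith [norm_nonneg (∇ η x)])
    (hN.add (hη.inner_gradient_tameL2 hψ))
  have := (TameB.const (d := d) 1).add (hη.inner_gradient hη)
  simpa only [real_inner_self_eq_norm_sq] using this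

/-! ### Extensions of functions on the graph to the whole space -/

/-- Smooth functions on `ℝ^d × ℝ` supported in a horizontal slab, whose derivatives are dominated
by square integrable functions of the horizontal variable. -/
structure GoodExt (c : Space d × ℝ → ℝ) : Prop where
  smooth : ContDiff ℝ ∞ c
  supp : ∃ R : ℝ, ∀ p, R < |p.2| → c p = 0
  dom : ∀ n : ℕ, ∃ W : Space d → ℝ, MemLp W 2 volume ∧ ∀ p, ‖iteratedFDeriv ℝ n c p‖ ≤ W p.1

theorem GoodExt.add {a b : Space d × ℝ → ℝ} (ha : GoodExt a) (hb : GoodExt b) :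
    GoodExt (fun p => a p + b p) where
  smooth := ha.smooth.add hb.smooth
  supp := by
    obtain ⟨R, hR⟩ := ha.supp
    obtain ⟨S, hS⟩ := hb.supp
    refine ⟨max R S, fun p hp => ?_⟩
    rw [hR p ((le_max_left _ _).trans_lt hp), hS p ((le_max_right _ _).trans_lt hp), add_zero]
  dom n := by
    obtain ⟨W, hW, h1⟩ := ha.dom n
    obtain ⟨V, hV, h2⟩ := hb.dom n
    refine ⟨fun x => W x + V x, hW.add hV, fun p => ?_⟩
    rw [fun_iteratedFDeriv_add_apply (ha.smooth.of_le (by exact_mod_cast le_top)).contDiffAt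
      (hb.smooth.of_le (by exact_mod_cast le_top)).contDiffAt]
    exact (norm_add_le _ _).trans (add_le_add (h1 p) (h2 p))

theorem norm_iteratedFDeriv_comp_fst_le {a : Space d → ℝ} (ha : ContDiff ℝ ∞ a) (n : ℕ)
    (p : Space d × ℝ) :
    ‖iteratedFDeriv ℝ n (fun q : Space d × ℝ => a q.1) p‖ ≤ ‖iteratedFDeriv ℝ n a p.1‖ := by
  have h := (ContinuousLinearMap.fst ℝ (Space d) ℝ).iteratedFDeriv_comp_right ha p (i := n)
    (by exact_mod_cast le_top)
  have h2 : a ∘ (ContinuousLinearMap.fst ℝ (Space d) ℝ) = fun q : Space d × ℝ => a q.1 := rfl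
  rw [h2] at h
  rw [h]
  refine (ContinuousMultilinearMap.norm_compContinuousLinearMap_le _ _).trans ?_
  refine mul_le_of_le_one_right (norm_nonneg _) (Finset.prod_le_one (fun _ _ => norm_nonneg _) ?_)
  exact fun _ _ => ContinuousLinearMap.norm_fst_le ℝ (Space d) ℝ

/-- Orders start at 1 because y - η(x) itself is unbounded; only its derivatives are bounded. -/
theorem exists_bound_iteratedFDeriv_height {η : Space d → ℝ} (hη : TameB η) (n : ℕ) :
    ∃ C : ℝ, ∀ p, ‖iteratedFDeriv ℝ (n + 1) (fun q : Space d × ℝ => q.2 - η q.1) p‖ ≤ C := by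
  obtain ⟨C, hC⟩ := hη.bdd (n + 1)
  have hsnd : ∃ B : ℝ, ∀ p,
      ‖iteratedFDeriv ℝ (n + 1) (fun q : Space d × ℝ => q.2) p‖ ≤ B := by
    have hf : fderiv ℝ (fun q : Space d × ℝ => q.2) =
        fun _ => ContinuousLinearMap.snd ℝ (Space d) ℝ := by
      ext1 p; exact fderiv_snd
    rcases Nat.eq_zero_or_pos n with rfl | hn
    · exact ⟨‖ContinuousLinearMap.snd ℝ (Space d) ℝ‖, fun p => by
        rw [← norm_iteratedFDeriv_fderiv, hf, norm_iteratedFDeriv_zero]⟩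
    · exact ⟨0, fun p => by
        rw [← norm_iteratedFDeriv_fderiv, hf, iteratedFDeriv_const_of_ne hn.ne']; simp⟩
  obtain ⟨B, hB⟩ := hsnd
  refine ⟨B + C, fun p => ?_⟩
  have h1 : ContDiff ℝ (n + 1 : ℕ) (fun q : Space d × ℝ => q.2) := contDiff_snd
  have h2 : ContDiff ℝ (n + 1 : ℕ) (fun q : Space d × ℝ => η q.1) :=
    (hη.smooth.of_le (by exact_mod_cast le_top)).comp contDiff_fst
  rw [fun_iteratedFDeriv_sub_apply h1.contDiffAt h2.contDiffAt]
  exact (norm_sub_le _ _).trans (add_le_add (hB p)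
    ((norm_iteratedFDeriv_comp_fst_le hη.smooth _ p).trans (hC _)))

theorem exists_bound_iteratedFDeriv_comp_height {η : Space d → ℝ} (hη : TameB η) {m : ℝ → ℝ}
    (hm : ContDiff ℝ ∞ m) (hmc : HasCompactSupport m) (n : ℕ) :
    ∃ C : ℝ, ∀ p, ‖iteratedFDeriv ℝ n (fun q : Space d × ℝ => m (q.2 - η q.1)) p‖ ≤ C := by
  have hmb : ∀ i : ℕ, ∃ B : ℝ, ∀ z, ‖iteratedFDeriv ℝ i m z‖ ≤ B := fun i => by
    have hcont : Continuous (iteratedFDeriv ℝ i m) :=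
      hm.continuous_iteratedFDeriv (by exact_mod_cast le_top)
    exact hcont.bounded_above_of_compact_support (hmc.iteratedFDeriv i)
  choose B hB using hmb
  choose C hC using exists_bound_iteratedFDeriv_height hη
  -- The estimate for derivatives of a composition asks for the i-th derivative of the inner
  -- function to be at most D ^ i. A number D ≥ 1 above all the constants works for every i ≥ 1.
  set D : ℝ := 1 + ∑ i ∈ Finset.range n, |C i| with hD
  have hD1 : 1 ≤ D := by
    have : 0 ≤ ∑ i ∈ Finset.range n, |C i| := Finset.sum_nonneg fun _ _ => abs_nonneg _
    linarith
  have hs : ContDiff ℝ ∞ (fun q : Space d × ℝ => q.2 - η q.1) :=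
    contDiff_snd.sub (hη.smooth.comp contDiff_fst)
  refine ⟨(n.factorial : ℝ) * (∑ i ∈ Finset.range (n + 1), |B i|) * D ^ n, fun p => ?_⟩
  refine norm_iteratedFDeriv_comp_le (g := m) (f := fun q : Space d × ℝ => q.2 - η q.1) hm hs
    (by exact_mod_cast le_top) p (fun i hi => ?_) fun i hi1 hi => ?_
  · refine ((hB i _).trans (le_abs_self _)).trans ?_
    exact Finset.single_le_sum (f := fun i => |B i|) (fun _ _ => abs_nonneg _)
      (Finset.mem_range.2 (by omega))
  · obtain ⟨j, rfl⟩ : ∃ j, i = j + 1 := ⟨i - 1, by omega⟩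
    refine ((hC j p).trans (le_abs_self _)).trans ?_
    refine le_trans ?_ (le_self_pow₀ hD1 (by omega))
    have := Finset.single_le_sum (f := fun i => |C i|) (fun _ _ => abs_nonneg _)
      (Finset.mem_range.2 (show j < n by omega))
    linarith

/-- Boundedness of `η` turns a compact support in y - η(x) into a support in a horizontal slab; the
square integrable majorants are inherited from the derivatives of `a`. -/
theorem TameL2.goodExt {a η : Space d → ℝ} (ha : TameL2 a) (hη : TameB η) {m : ℝ → ℝ}
    (hm : ContDiff ℝ ∞ m) (hmc : HasCompactSupport m) :
    GoodExt (fun p : Space d × ℝ => a p.1 * m (p.2 - η p.1)) := by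
  have h1 : ContDiff ℝ ∞ (fun q : Space d × ℝ => a q.1) := ha.smooth.comp contDiff_fst
  have h2 : ContDiff ℝ ∞ (fun q : Space d × ℝ => m (q.2 - η q.1)) :=
    hm.comp (contDiff_snd.sub (hη.smooth.comp contDiff_fst))
  refine ⟨h1.mul h2, ?_, fun n => ?_⟩
  · obtain ⟨K, hK⟩ := hη.bdd 0
    obtain ⟨r, hr⟩ := hmc.isCompact.isBounded.subset_closedBall 0
    refine ⟨r + K, fun p hp => ?_⟩
    have hz : p.2 - η p.1 ∉ tsupport m := fun h => by
      have h3 := mem_closedBall_zero_iff.1 (hr h)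
      have h4 := hK p.1
      rw [norm_iteratedFDeriv_zero] at h4
      rw [Real.norm_eq_abs] at h3 h4
      have := abs_sub_abs_le_abs_sub p.2 (η p.1)
      linarith
    rw [image_eq_zero_of_notMem_tsupport hz, mul_zero]
  · choose C hC using exists_bound_iteratedFDeriv_comp_height hη hm hmc
    refine ⟨fun x => ∑ i ∈ Finset.range (n + 1),
      ((n.choose i : ℝ) * C (n - i)) * ‖iteratedFDeriv ℝ i a x‖,
      memLp_finsetSum _ fun i _ => (ha.memLp i).norm.const_mul _, fun p => ?_⟩
    refine (norm_iteratedFDeriv_mul_le h1 h2 p (by exact_mod_cast le_top)).trans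
      (Finset.sum_le_sum fun i _ => ?_)
    rw [mul_assoc, mul_assoc, mul_comm (C (n - i))]
    have h3 := norm_iteratedFDeriv_comp_fst_le ha.smooth i p
    have h4 := hC (n - i) p
    have h5 := (norm_nonneg _).trans h4
    gcongr

theorem memLp_prod_of_slab_bound {E : Type*} [NormedAddCommGroup E] {f : Space d × ℝ → E}
    (hf : AEStronglyMeasurable f volume) {W : Space d → ℝ} (hW : MemLp W 2 volume) {R : ℝ}
    (h1 : ∀ᵐ p : Space d × ℝ, ‖f p‖ ≤ W p.1) (h2 : ∀ p, R < |p.2| → f p = 0) :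
    MemLp f 2 volume := by
  rw [memLp_two_iff_integrable_sq_norm hf]
  have h3 : Integrable (fun p : Space d × ℝ => W p.1 ^ 2 * (Icc (-R) R).indicator 1 p.2) volume :=
    hW.integrable_sq.mul_prod
      ((integrable_indicator_iff measurableSet_Icc).2 (integrableOn_const (by simp)))
  refine h3.mono' (hf.norm.pow 2) ?_
  filter_upwards [h1] with p hp
  by_cases h : R < |p.2|
  · rw [h2 p h]
    simp only [norm_zero, ne_eq, OfNat.ofNat_ne_zero, not_false_eq_true, zero_pow]
    refine mul_nonneg (sq_nonneg _) (indicator_nonneg (fun _ _ => zero_le_one) _)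
  · have : p.2 ∈ Icc (-R) R := abs_le.1 (not_lt.1 h)
    rw [indicator_of_mem this, Pi.one_apply, mul_one, Real.norm_of_nonneg (by positivity)]
    gcongr

theorem GoodExt.iteratedFDeriv_eq_zero {c : Space d × ℝ → ℝ} {R : ℝ}
    (hR : ∀ p, R < |p.2| → c p = 0) (n : ℕ) {p : Space d × ℝ} (hp : R < |p.2|) :
    iteratedFDeriv ℝ n c p = 0 := by
  have hev : c =ᶠ[𝓝 p] fun _ => 0 := by
    have : {q : Space d × ℝ | R < |q.2|} ∈ 𝓝 p :=
      (isOpen_lt continuous_const continuous_snd.abs).mem_nhds hp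
    filter_upwards [this] with q hq using hR q hq
  have := (hev.iteratedFDeriv ℝ n).eq_of_nhds
  rw [this, iteratedFDeriv_fun_zero]
  rfl

theorem GoodExt.memLp_iteratedFDeriv {c : Space d × ℝ → ℝ} (hc : GoodExt c) (n : ℕ) :
    MemLp (iteratedFDeriv ℝ n c) 2 volume := by
  obtain ⟨R, hR⟩ := hc.supp
  obtain ⟨W, hW, h⟩ := hc.dom n
  exact memLp_prod_of_slab_bound
    (hc.smooth.continuous_iteratedFDeriv (by exact_mod_cast le_top)).aestronglyMeasurable hW
    (ae_of_all _ h) fun p hp => GoodExt.iteratedFDeriv_eq_zero hR n hp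

/-- A smooth cutoff function equal to `1` near the origin. -/
def cutoffBump : ContDiffBump (0 : ℝ) := ⟨1, 2, one_pos, one_lt_two⟩

/-- A smooth function with trace `ψ` and vertical derivative `b` on the graph of `η`, supported
near this graph. -/
def cauchyExt (η ψ b : Space d → ℝ) (p : Space d × ℝ) : ℝ :=
  ψ p.1 * cutoffBump (p.2 - η p.1) + b p.1 * ((p.2 - η p.1) * cutoffBump (p.2 - η p.1))

theorem goodExt_cauchyExt {η ψ b : Space d → ℝ} (hη : TameB η) (hψ : TameL2 ψ) (hb : TameL2 b) :
    GoodExt (cauchyExt η ψ b) :=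
  (hψ.goodExt hη cutoffBump.contDiff cutoffBump.hasCompactSupport).add
    (hb.goodExt hη (m := fun z => z * cutoffBump z) (contDiff_id.mul cutoffBump.contDiff)
      cutoffBump.hasCompactSupport.mul_left)

theorem cauchyExt_graph (η ψ b : Space d → ℝ) (x : Space d) :
    cauchyExt η ψ b (x, η x) = ψ x := by
  have : cutoffBump (0 : ℝ) = 1 := cutoffBump.one_of_mem_closedBall (by simp [cutoffBump])
  simp [cauchyExt, this]

/-- Close to the graph the cutoff is identically 1, so the extension is ψ(x) + b(x)(y - η(x)) there.
-/
theorem hasFDerivAt_cauchyExt_graph {η ψ b : Space d → ℝ} (hη : TameB η) (hψ : TameL2 ψ)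
    (hb : TameL2 b) (x : Space d) :
    HasFDerivAt (cauchyExt η ψ b)
      ((fderiv ℝ ψ x).comp (ContinuousLinearMap.fst ℝ (Space d) ℝ) +
        b x • (ContinuousLinearMap.snd ℝ (Space d) ℝ -
          (fderiv ℝ η x).comp (ContinuousLinearMap.fst ℝ (Space d) ℝ))) (x, η x) := by
  have hd : ∀ {a : Space d → ℝ}, ContDiff ℝ ∞ a → HasFDerivAt (fun q : Space d × ℝ => a q.1)
      ((fderiv ℝ a x).comp (ContinuousLinearMap.fst ℝ (Space d) ℝ)) (x, η x) := fun {a} ha =>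
    HasFDerivAt.comp (x, η x) (f := Prod.fst) (g := a)
      (ha.differentiable (by simp) x).hasFDerivAt hasFDerivAt_fst
  have hs : HasFDerivAt (fun q : Space d × ℝ => q.2 - η q.1) _ (x, η x) :=
    hasFDerivAt_snd.sub (hd hη.smooth)
  have h1 := (hd hψ.smooth).add ((hd hb.smooth).mul hs)
  have hev : cauchyExt η ψ b =ᶠ[𝓝 (x, η x)]
      ((fun q : Space d × ℝ => ψ q.1) + fun q => b q.1 * (q.2 - η q.1)) := by
    have hc : Continuous fun q : Space d × ℝ => q.2 - η q.1 :=
      continuous_snd.sub (hη.smooth.continuous.comp continuous_fst)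
    have : {q : Space d × ℝ | |q.2 - η q.1| < 1} ∈ 𝓝 (x, η x) :=
      (isOpen_lt hc.abs continuous_const).mem_nhds (by simp)
    filter_upwards [this] with q hq
    have h1 : cutoffBump (q.2 - η q.1) = 1 := cutoffBump.one_of_mem_closedBall (by
      simp only [cutoffBump, mem_closedBall_zero_iff]; exact le_of_lt hq)
    simp [cauchyExt, h1]
  refine (h1.congr_of_eventuallyEq hev).congr_fderiv ?_
  ext v <;> simp

/-! ### The full gradient -/

/-- The Euclidean space containing the values of gradients of functions on `ℝ^d × ℝ`. -/
abbrev GradSpace (d : ℕ) : Type := WithLp 2 (Space d × ℝ)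

/-- The gradient in all the variables. -/
def fullGrad (v : Space d × ℝ → ℝ) (p : Space d × ℝ) : GradSpace d :=
  WithLp.toLp 2 (gradX v p, derivY v p)

theorem inner_fullGrad (a b : Space d × ℝ → ℝ) (p : Space d × ℝ) :
    inner ℝ (fullGrad a p) (fullGrad b p) =
      inner ℝ (gradX a p) (gradX b p) + derivY a p * derivY b p := by
  simp [fullGrad, WithLp.prod_inner_apply, mul_comm]

theorem norm_sq_fullGrad (a : Space d × ℝ → ℝ) (p : Space d × ℝ) :
    ‖fullGrad a p‖ ^ 2 = ‖gradX a p‖ ^ 2 + derivY a p ^ 2 := by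
  rw [← real_inner_self_eq_norm_sq, inner_fullGrad, real_inner_self_eq_norm_sq, sq (derivY a p)]

/-- The gradient represented by a differential. -/
def gradOf (L : Space d × ℝ →L[ℝ] ℝ) : GradSpace d :=
  WithLp.toLp 2 ((InnerProductSpace.toDual ℝ (Space d)).symm
    (L.comp (ContinuousLinearMap.inl ℝ (Space d) ℝ)), L (0, 1))

theorem gradOf_add (L M : Space d × ℝ →L[ℝ] ℝ) : gradOf (L + M) = gradOf L + gradOf M := by
  rw [gradOf, ContinuousLinearMap.add_comp, map_add]; rfl

theorem gradOf_smul (c : ℝ) (L : Space d × ℝ →L[ℝ] ℝ) : gradOf (c • L) = c • gradOf L := by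
  rw [gradOf, ContinuousLinearMap.smul_comp, map_smulₛₗ]; rfl

theorem gradOf_sub (L M : Space d × ℝ →L[ℝ] ℝ) : gradOf (L - M) = gradOf L - gradOf M := by
  rw [gradOf, ContinuousLinearMap.sub_comp, map_sub]; rfl

theorem norm_gradOf_le (L : Space d × ℝ →L[ℝ] ℝ) : ‖gradOf L‖ ≤ 2 * ‖L‖ := by
  refine abs_le_of_sq_le_sq' ?_ (by positivity) |>.2
  rw [gradOf, WithLp.prod_norm_sq_eq_of_L2]
  have h1 : ‖(InnerProductSpace.toDual ℝ (Space d)).symm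
      (L.comp (ContinuousLinearMap.inl ℝ (Space d) ℝ))‖ ≤ ‖L‖ := by
    rw [LinearIsometryEquiv.norm_map]
    exact (ContinuousLinearMap.opNorm_comp_le _ _).trans (mul_le_of_le_one_right (norm_nonneg _)
      (ContinuousLinearMap.norm_inl_le_one ℝ (Space d) ℝ))
  have h2 : ‖L (0, 1)‖ ≤ ‖L‖ := by
    refine (L.le_opNorm _).trans (mul_le_of_le_one_right (norm_nonneg _) ?_)
    simp [Prod.norm_def]
  have h3 := pow_le_pow_left₀ (norm_nonneg _) h1 2
  have h4 := pow_le_pow_left₀ (norm_nonneg _) h2 2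
  have h5 : ‖(InnerProductSpace.toDual ℝ (Space d)).symm
      (L.comp (ContinuousLinearMap.inl ℝ (Space d) ℝ))‖ ^ 2 + ‖L (0, 1)‖ ^ 2 ≤ (2 * ‖L‖) ^ 2 := by
    nlinarith [sq_nonneg ‖L‖]
  exact h5

theorem continuous_gradOf : Continuous (gradOf (d := d)) := by
  refine (WithLp.prod_continuous_toLp 2 (Space d) ℝ).comp (Continuous.prodMk ?_ ?_)
  · exact (LinearIsometryEquiv.continuous _).comp
      (continuous_id.clm_comp continuous_const)
  · exact continuous_id.clm_apply continuous_const

theorem gradX_eq {v : Space d × ℝ → ℝ} {p : Space d × ℝ} (hv : DifferentiableAt ℝ v p) :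
    gradX v p = (InnerProductSpace.toDual ℝ (Space d)).symm
      ((fderiv ℝ v p).comp (ContinuousLinearMap.inl ℝ (Space d) ℝ)) := by
  have h : HasFDerivAt (fun x : Space d => v (x, p.2))
      ((fderiv ℝ v p).comp (ContinuousLinearMap.inl ℝ (Space d) ℝ)) p.1 :=
    HasFDerivAt.comp p.1 (g := v) (f := fun x => (x, p.2)) hv.hasFDerivAt
      (hasFDerivAt_prodMk_left p.1 p.2)
  rw [gradX, gradient, h.fderiv]

theorem derivY_eq {v : Space d × ℝ → ℝ} {p : Space d × ℝ} (hv : DifferentiableAt ℝ v p) :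
    derivY v p = fderiv ℝ v p (0, 1) := by
  have h := HasFDerivAt.comp_hasDerivAt p.2 (l := v) (f := fun y : ℝ => (p.1, y))
    (l' := fderiv ℝ v p) hv.hasFDerivAt ((hasDerivAt_const p.2 p.1).prodMk (hasDerivAt_id p.2))
  exact h.deriv

theorem fullGrad_eq {v : Space d × ℝ → ℝ} {p : Space d × ℝ} (hv : DifferentiableAt ℝ v p) :
    fullGrad v p = gradOf (fderiv ℝ v p) := by
  rw [fullGrad, gradX_eq hv, derivY_eq hv]; rfl

theorem hasDerivAt_vertical {v : Space d × ℝ → ℝ} {p : Space d × ℝ} (hv : DifferentiableAt ℝ v p) :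
    HasDerivAt (fun y => v (p.1, y)) (derivY v p) p.2 := by
  rw [derivY_eq hv]
  exact HasFDerivAt.comp_hasDerivAt p.2 (l := v) (f := fun y : ℝ => (p.1, y))
    (l' := fderiv ℝ v p) hv.hasFDerivAt ((hasDerivAt_const p.2 p.1).prodMk (hasDerivAt_id p.2))

theorem fullGrad_sub {a b : Space d × ℝ → ℝ} {p : Space d × ℝ} (ha : DifferentiableAt ℝ a p)
    (hb : DifferentiableAt ℝ b p) :
    fullGrad (fun q => a q - b q) p = fullGrad a p - fullGrad b p := by
  rw [fullGrad_eq ha, fullGrad_eq hb, fullGrad_eq (ha.fun_sub hb), fderiv_fun_sub ha hb, gradOf_sub]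

theorem fullGrad_mul {a b : Space d × ℝ → ℝ} {p : Space d × ℝ} (ha : DifferentiableAt ℝ a p)
    (hb : DifferentiableAt ℝ b p) :
    fullGrad (fun q => a q * b q) p = a p • fullGrad b p + b p • fullGrad a p := by
  rw [fullGrad_eq ha, fullGrad_eq hb, fullGrad_eq (ha.fun_mul hb), fderiv_fun_mul ha hb, gradOf_add,
    gradOf_smul, gradOf_smul]

theorem fullGrad_congr {a b : Space d × ℝ → ℝ} {p : Space d × ℝ} (h : a =ᶠ[𝓝 p] b) :
    fullGrad a p = fullGrad b p := by
  have h1 : (fun x : Space d => a (x, p.2)) =ᶠ[𝓝 p.1] fun x => b (x, p.2) := by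
    have hc : ContinuousAt (fun x : Space d => (x, p.2)) p.1 := by fun_prop
    exact hc.eventually (p := fun q => a q = b q) h
  have h2 : (fun y : ℝ => a (p.1, y)) =ᶠ[𝓝 p.2] fun y => b (p.1, y) := by
    have hc : ContinuousAt (fun y : ℝ => (p.1, y)) p.2 := by fun_prop
    exact hc.eventually (p := fun q => a q = b q) h
  rw [fullGrad, fullGrad, gradX, gradX, derivY, derivY, gradient, gradient, h1.fderiv_eq,
    h2.deriv_eq]

theorem norm_fullGrad_le {v : Space d × ℝ → ℝ} {p : Space d × ℝ} (hv : DifferentiableAt ℝ v p) :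
    ‖fullGrad v p‖ ≤ 2 * ‖fderiv ℝ v p‖ := by
  rw [fullGrad_eq hv]; exact norm_gradOf_le _

theorem continuous_fullGrad {v : Space d × ℝ → ℝ} (hv : ContDiff ℝ ∞ v) :
    Continuous (fullGrad v) := by
  have : fullGrad v = fun p => gradOf (fderiv ℝ v p) :=
    funext fun p => fullGrad_eq (hv.differentiable (by simp) p)
  rw [this]
  exact continuous_gradOf.comp (hv.continuous_fderiv (by simp))

theorem continuousOn_fullGrad {v : Space d × ℝ → ℝ} {s : Set (Space d × ℝ)} (hs : IsOpen s)
    (hv : ContDiffOn ℝ ∞ v s) : ContinuousOn (fullGrad v) s := by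
  refine ContinuousOn.congr (f := fun p => gradOf (fderiv ℝ v p)) ?_ fun p hp =>
    fullGrad_eq ((hv.differentiableOn (by simp)).differentiableAt (hs.mem_nhds hp))
  exact continuous_gradOf.comp_continuousOn
    (hv.continuousOn_fderiv_of_isOpen hs (by simp))

theorem inner_fullGrad_eq_sum {a b : Space d × ℝ → ℝ} {p : Space d × ℝ}
    (ha : DifferentiableAt ℝ a p) (hb : DifferentiableAt ℝ b p) :
    inner ℝ (fullGrad a p) (fullGrad b p) =
      ∑ i, fderiv ℝ a p (EuclideanSpace.single i 1, 0) * fderiv ℝ b p (EuclideanSpace.single i 1, 0)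
        + fderiv ℝ a p (0, 1) * fderiv ℝ b p (0, 1) := by
  rw [inner_fullGrad, derivY_eq ha, derivY_eq hb, gradX_eq ha, gradX_eq hb,
    ← (EuclideanSpace.basisFun (Fin d) ℝ).sum_inner_mul_inner]
  congr 1
  refine Finset.sum_congr rfl fun i _ => ?_
  rw [EuclideanSpace.basisFun_apply, InnerProductSpace.toDual_symm_apply, real_inner_comm,
    InnerProductSpace.toDual_symm_apply]
  rfl

theorem isOpen_fluidDomain {η : Space d → ℝ} (hη : Continuous η) : IsOpen (fluidDomain η) :=
  isOpen_lt continuous_snd (hη.comp continuous_fst)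

theorem GoodExt.fderiv_le {c : Space d × ℝ → ℝ} (hc : GoodExt c) :
    ∃ W : Space d → ℝ, MemLp W 2 volume ∧ ∀ p, ‖fullGrad c p‖ ≤ W p.1 := by
  obtain ⟨W, hW, h⟩ := hc.dom 1
  refine ⟨fun x => 2 * W x, hW.const_mul _, fun p => ?_⟩
  refine (norm_fullGrad_le (hc.smooth.differentiable (by simp) p)).trans ?_
  have := h p
  rw [norm_iteratedFDeriv_one] at this
  show 2 * _ ≤ 2 * W p.1
  linarith

theorem GoodExt.memLp_fullGrad {c : Space d × ℝ → ℝ} (hc : GoodExt c) :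
    MemLp (fullGrad c) 2 volume := by
  refine ((hc.memLp_iteratedFDeriv 1).norm.const_mul 2).of_le
    (continuous_fullGrad hc.smooth).aestronglyMeasurable (ae_of_all _ fun p => ?_)
  rw [norm_iteratedFDeriv_one, Real.norm_of_nonneg (by positivity)]
  exact norm_fullGrad_le (hc.smooth.differentiable (by simp) p)

/-- The Laplacian of a smooth function, as a sum of second directional derivatives. -/
def laplaceSum (c : Space d × ℝ → ℝ) (p : Space d × ℝ) : ℝ :=
  ∑ i, fderiv ℝ (fun q => fderiv ℝ c q (EuclideanSpace.single i 1, 0)) p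
      (EuclideanSpace.single i 1, 0)
    + fderiv ℝ (fun q => fderiv ℝ c q (0, 1)) p (0, 1)

theorem contDiff_fderiv_const {c : Space d × ℝ → ℝ} (hc : ContDiff ℝ ∞ c) (e : Space d × ℝ) :
    ContDiff ℝ ∞ (fun q => fderiv ℝ c q e) :=
  (hc.fderiv_right (by exact_mod_cast le_top)).clm_apply contDiff_const

theorem abs_fderiv_fderiv_le {c : Space d × ℝ → ℝ} (hc : ContDiff ℝ ∞ c) {e : Space d × ℝ}
    (he : ‖e‖ ≤ 1) (p : Space d × ℝ) :
    |fderiv ℝ (fun q => fderiv ℝ c q e) p e| ≤ ‖iteratedFDeriv ℝ 2 c p‖ := by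
  have h1 : ContDiff ℝ ∞ (fderiv ℝ c) := hc.fderiv_right (by exact_mod_cast le_top)
  have h2 := norm_iteratedFDeriv_clm_apply_const (c := e) (x := p) (n := 1) h1.contDiffAt
    (by exact_mod_cast le_top)
  rw [norm_iteratedFDeriv_one, norm_iteratedFDeriv_fderiv] at h2
  calc |fderiv ℝ (fun q => fderiv ℝ c q e) p e| ≤ ‖fderiv ℝ (fun q => fderiv ℝ c q e) p‖ * ‖e‖ :=
        (fderiv ℝ (fun q => fderiv ℝ c q e) p).le_opNorm e
    _ ≤ (‖e‖ * ‖iteratedFDeriv ℝ (1 + 1) c p‖) * ‖e‖ := by gcongr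
    _ ≤ (1 * ‖iteratedFDeriv ℝ (1 + 1) c p‖) * 1 := by gcongr
    _ = _ := by ring_nf

theorem abs_laplaceSum_le {c : Space d × ℝ → ℝ} (hc : ContDiff ℝ ∞ c) (p : Space d × ℝ) :
    |laplaceSum c p| ≤ (d + 1) * ‖iteratedFDeriv ℝ 2 c p‖ := by
  have h1 : ∀ i : Fin d, ‖((EuclideanSpace.single i (1 : ℝ) : Space d), (0 : ℝ))‖ ≤ 1 := fun i => by
    simp [Prod.norm_def]
  have h2 : ‖((0 : Space d), (1 : ℝ))‖ ≤ 1 := by simp [Prod.norm_def]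
  refine (abs_add_le _ _).trans ?_
  rw [add_mul, one_mul]
  refine add_le_add ?_ (abs_fderiv_fderiv_le hc h2 p)
  refine (Finset.abs_sum_le_sum_abs _ _).trans
    ((Finset.sum_le_sum fun i _ => abs_fderiv_fderiv_le hc (h1 i) p).trans (le_of_eq ?_))
  simp

theorem continuous_laplaceSum {c : Space d × ℝ → ℝ} (hc : ContDiff ℝ ∞ c) :
    Continuous (laplaceSum c) := by
  have h : ∀ e : Space d × ℝ, Continuous fun p => fderiv ℝ (fun q => fderiv ℝ c q e) p e :=
    fun e => (contDiff_fderiv_const (contDiff_fderiv_const hc e) e).continuous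
  exact (continuous_finsetSum _ fun i _ => h _).add (h _)

/-! ### The divergence theorem below a graph -/

/-- The shear flattening the graph of `η`. -/
def shear {η : Space d → ℝ} (hη : Continuous η) : Space d × ℝ ≃ₜ Space d × ℝ where
  toFun p := (p.1, η p.1 + p.2)
  invFun p := (p.1, p.2 - η p.1)
  left_inv p := by simp
  right_inv p := by simp
  continuous_toFun := by fun_prop
  continuous_invFun := by fun_prop

theorem measurePreserving_shear {η : Space d → ℝ} (hη : Continuous η) :
    MeasurePreserving (shear hη) volume volume := by
  refine MeasurePreserving.skew_product (f := id) (g := fun x y => η x + y)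
    (MeasurePreserving.id _) ?_ (ae_of_all _ fun x => ?_)
  · exact ((hη.comp continuous_fst).add continuous_snd).measurable
  · exact (measurePreserving_add_left volume (η x)).map_eq

theorem setIntegral_fluidDomain_eq {η : Space d → ℝ} (hη : Continuous η) (h : Space d × ℝ → ℝ) :
    ∫ p in fluidDomain η, h p = ∫ p in (univ : Set (Space d)) ×ˢ Iio (0 : ℝ), h (shear hη p) := by
  have hpre : shear hη ⁻¹' fluidDomain η = (univ : Set (Space d)) ×ˢ Iio (0 : ℝ) := by
    ext p; simp [fluidDomain, shear]
  rw [← hpre, (measurePreserving_shear hη).setIntegral_preimage_emb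
    (shear hη).measurableEmbedding]

theorem hasCompactSupport_graph {w : Space d × ℝ → ℝ} (hc : HasCompactSupport w)
    (g : Space d → ℝ) : HasCompactSupport (fun x => w (x, g x)) :=
  HasCompactSupport.intro (hc.isCompact.image continuous_fst) fun _ hx =>
    image_eq_zero_of_notMem_tsupport fun h => hx ⟨_, h, rfl⟩

theorem hasCompactSupport_vertical {w : Space d × ℝ → ℝ} (hc : HasCompactSupport w)
    (x : Space d) : HasCompactSupport (fun y => w (x, y)) :=
  HasCompactSupport.intro (hc.isCompact.image continuous_snd) fun _ hy =>
    image_eq_zero_of_notMem_tsupport fun h => hy ⟨_, h, rfl⟩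

theorem integral_halfSpace_fderiv_horizontal {w : Space d × ℝ → ℝ} (hw : ContDiff ℝ ∞ w)
    (hc : HasCompactSupport w) (e : Space d) :
    ∫ p in (univ : Set (Space d)) ×ˢ Iio (0 : ℝ), fderiv ℝ w p (e, 0) = 0 := by
  have hi : Integrable (fun p => fderiv ℝ w p (e, 0)) volume :=
    (contDiff_fderiv_const hw (e, 0)).continuous.integrable_of_hasCompactSupport
      (hc.fderiv_apply ℝ (e, 0))
  have hi2 : Integrable (fun p => fderiv ℝ w p (e, 0))
      ((volume : Measure (Space d)).prod (volume.restrict (Iio (0 : ℝ)))) := by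
    have := hi.integrableOn (s := (univ : Set (Space d)) ×ˢ Iio (0 : ℝ))
    rwa [IntegrableOn, Measure.volume_eq_prod, ← Measure.prod_restrict, Measure.restrict_univ]
      at this
  rw [Measure.volume_eq_prod, ← Measure.prod_restrict, Measure.restrict_univ,
    integral_prod_symm _ hi2]
  refine integral_eq_zero_of_ae (ae_of_all _ fun z => ?_)
  have hs : ContDiff ℝ ∞ (fun x : Space d => w (x, z)) :=
    hw.comp (contDiff_id.prodMk contDiff_const)
  have hcs : HasCompactSupport (fun x : Space d => w (x, z)) :=
    hasCompactSupport_graph hc fun _ => z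
  have hfd : ∀ x, fderiv ℝ w (x, z) (e, 0) = fderiv ℝ (fun x : Space d => w (x, z)) x e := fun x => by
    have := HasFDerivAt.comp x (g := w) (f := fun x : Space d => (x, z))
      (hw.differentiable (by simp) (x, z)).hasFDerivAt (hasFDerivAt_prodMk_left x z)
    have h2 : fderiv ℝ (fun x : Space d => w (x, z)) x = _ := this.fderiv
    rw [h2]; simp
  simp only [hfd, Pi.zero_apply]
  have hd : Integrable (fun x => fderiv ℝ (fun x : Space d => w (x, z)) x e) volume :=
    ((hs.continuous_fderiv (by simp)).clm_apply continuous_const).integrable_of_hasCompactSupport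
      (hcs.fderiv_apply ℝ e)
  have := integral_mul_fderiv_eq_neg_fderiv_mul_of_integrable (μ := (volume : Measure (Space d)))
    (f := fun _ : Space d => (1 : ℝ)) (g := fun x : Space d => w (x, z)) (v := e) (by simp)
    (by simpa using hd)
    (by simpa using hs.continuous.integrable_of_hasCompactSupport hcs)
    (fun x _ => differentiableAt_const _) (fun x _ => hs.differentiable (by simp) x)
  simpa using this

/-- The weight `a`, a function of the horizontal variable only, is there to receive the factor -∂ₑη
produced by the shear. -/
theorem integral_halfSpace_fderiv_vertical {w : Space d × ℝ → ℝ} (hw : ContDiff ℝ ∞ w)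
    (hc : HasCompactSupport w) {a : Space d → ℝ} (ha : Continuous a) :
    ∫ p in (univ : Set (Space d)) ×ˢ Iio (0 : ℝ), a p.1 * fderiv ℝ w p (0, 1) =
      ∫ x, a x * w (x, 0) := by
  have hi : Integrable (fun p : Space d × ℝ => a p.1 * fderiv ℝ w p (0, 1)) volume :=
    ((ha.comp continuous_fst).mul
      (contDiff_fderiv_const hw (0, 1)).continuous).integrable_of_hasCompactSupport
      (HasCompactSupport.mul_left (hc.fderiv_apply ℝ (0, 1)))
  rw [Measure.volume_eq_prod, setIntegral_prod _ (by
    rw [← Measure.volume_eq_prod]; exact hi.integrableOn), Measure.restrict_univ]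
  refine integral_congr_ae (ae_of_all _ fun x => ?_)
  have hs : ContDiff ℝ ∞ (fun z : ℝ => w (x, z)) :=
    hw.comp (contDiff_const.prodMk contDiff_id)
  have hcs : HasCompactSupport (fun z : ℝ => w (x, z)) :=
    hasCompactSupport_vertical hc x
  have hfd : ∀ z, fderiv ℝ w (x, z) (0, 1) = deriv (fun z : ℝ => w (x, z)) z := fun z =>
    ((derivY_eq (hw.differentiable (by simp) (x, z))).symm)
  simp only [hfd]
  rw [integral_const_mul, ← integral_Iic_eq_integral_Iio, HasCompactSupport.integral_Iic_deriv_eq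
    (hs.of_le (by exact_mod_cast le_top)) hcs]

theorem fderiv_comp_shear {η : Space d → ℝ} (hη : ContDiff ℝ ∞ η) {w : Space d × ℝ → ℝ}
    (hw : ContDiff ℝ ∞ w) (p v : Space d × ℝ) :
    fderiv ℝ (fun q => w (shear hη.continuous q)) p v =
      fderiv ℝ w (shear hη.continuous p) (v.1, fderiv ℝ η p.1 v.1 + v.2) := by
  have h1 : HasFDerivAt (fun q : Space d × ℝ => (q.1, η q.1 + q.2))
      ((ContinuousLinearMap.fst ℝ (Space d) ℝ).prod
        ((fderiv ℝ η p.1).comp (ContinuousLinearMap.fst ℝ (Space d) ℝ) +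
          ContinuousLinearMap.snd ℝ (Space d) ℝ)) p :=
    hasFDerivAt_fst.prodMk ((HasFDerivAt.comp p (g := η) (f := Prod.fst)
      (hη.differentiable (by simp) p.1).hasFDerivAt hasFDerivAt_fst).add hasFDerivAt_snd)
  have h2 := HasFDerivAt.comp p (g := w)
    (hw.differentiable (by simp) (shear hη.continuous p)).hasFDerivAt h1
  have h3 : fderiv ℝ (fun q => w (shear hη.continuous q)) p = _ := h2.fderiv
  rw [h3]
  simp

theorem contDiff_comp_shear {η : Space d → ℝ} (hη : ContDiff ℝ ∞ η) {w : Space d × ℝ → ℝ}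
    (hw : ContDiff ℝ ∞ w) : ContDiff ℝ ∞ (fun q => w (shear hη.continuous q)) :=
  hw.comp (contDiff_fst.prodMk ((hη.comp contDiff_fst).add contDiff_snd))

theorem integral_fluidDomain_fderiv_vertical {η : Space d → ℝ} (hη : ContDiff ℝ ∞ η)
    {w : Space d × ℝ → ℝ} (hw : ContDiff ℝ ∞ w) (hc : HasCompactSupport w) :
    ∫ p in fluidDomain η, fderiv ℝ w p (0, 1) = ∫ x, w (x, η x) := by
  have h := integral_halfSpace_fderiv_vertical (contDiff_comp_shear hη hw)
    (hc.comp_homeomorph (shear hη.continuous)) (a := fun _ => 1) continuous_const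
  rw [setIntegral_fluidDomain_eq hη.continuous]
  simp only [fderiv_comp_shear hη hw, one_mul, map_zero, zero_add] at h
  rw [h]
  simp [shear]

/-- In flattened coordinates ∂ₑ becomes ∂ₑ - (∂ₑη) ∂_z. The first part integrates to zero along
horizontal lines and the second leaves the boundary term. -/
theorem integral_fluidDomain_fderiv_horizontal {η : Space d → ℝ} (hη : ContDiff ℝ ∞ η)
    {w : Space d × ℝ → ℝ} (hw : ContDiff ℝ ∞ w) (hc : HasCompactSupport w) (e : Space d) :
    ∫ p in fluidDomain η, fderiv ℝ w p (e, 0) = ∫ x, -(fderiv ℝ η x e) * w (x, η x) := by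
  have hw' := contDiff_comp_shear hη hw
  have hc' : HasCompactSupport (fun q => w (shear hη.continuous q)) :=
    hc.comp_homeomorph (shear hη.continuous)
  have ha : Continuous fun x => -(fderiv ℝ η x e) :=
    ((hη.continuous_fderiv (by simp)).clm_apply continuous_const).neg
  have h1 := integral_halfSpace_fderiv_horizontal hw' hc' e
  have h2 := integral_halfSpace_fderiv_vertical hw' hc' ha
  have e0 : ∀ x, (shear hη.continuous) (x, 0) = (x, η x) := fun x => by simp [shear]
  simp only [e0] at h2
  rw [setIntegral_fluidDomain_eq hη.continuous, ← h2]
  refine Eq.trans ?_ ((congrArg (· + _) h1).trans (zero_add _))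
  rw [← integral_add]
  · refine integral_congr_ae (ae_of_all _ fun p => ?_)
    simp only [fderiv_comp_shear hη hw, map_zero, zero_add, add_zero]
    have : ((e, 0) : Space d × ℝ) = (e, fderiv ℝ η p.1 e) + (-(fderiv ℝ η p.1 e)) • (0, 1) := by
      ext <;> simp
    conv_lhs => rw [this]
    rw [map_add, map_smul, smul_eq_mul]
  · exact ((contDiff_fderiv_const hw' (e, 0)).continuous.integrable_of_hasCompactSupport
      (hc'.fderiv_apply ℝ (e, 0))).integrableOn
  · exact (((ha.comp continuous_fst).mul
      (contDiff_fderiv_const hw' (0, 1)).continuous).integrable_of_hasCompactSupport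
      (HasCompactSupport.mul_left (hc'.fderiv_apply ℝ (0, 1)))).integrableOn

/-- Green's formula below a graph for a smooth function. -/
theorem integral_inner_fullGrad_smooth {η : Space d → ℝ} (hη : ContDiff ℝ ∞ η)
    {c v : Space d × ℝ → ℝ} (hcs : ContDiff ℝ ∞ c) (hv : ContDiff ℝ ∞ v)
    (hvc : HasCompactSupport v) :
    ∫ p in fluidDomain η, inner ℝ (fullGrad c p) (fullGrad v p) =
      (∫ x, (fderiv ℝ c (x, η x) (0, 1) - ∑ i, fderiv ℝ η x (EuclideanSpace.single i 1) *
        fderiv ℝ c (x, η x) (EuclideanSpace.single i 1, 0)) * v (x, η x)) -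
      ∫ p in fluidDomain η, laplaceSum c p * v p := by
  have hDs : ∀ e, ContDiff ℝ ∞ fun q => v q * fderiv ℝ c q e := fun e =>
    hv.mul (contDiff_fderiv_const hcs e)
  have hDc : ∀ e, HasCompactSupport fun q => v q * fderiv ℝ c q e := fun e => hvc.mul_right
  have hDi : ∀ e : Space d × ℝ, Integrable (fun p => fderiv ℝ (fun q => v q * fderiv ℝ c q e) p e)
      (volume.restrict (fluidDomain η)) := fun e =>
    ((contDiff_fderiv_const (hDs e) e).continuous.integrable_of_hasCompactSupport
      ((hDc e).fderiv_apply ℝ e)).integrableOn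
  have hprod : ∀ e p, fderiv ℝ (fun q => v q * fderiv ℝ c q e) p e =
      fderiv ℝ c p e * fderiv ℝ v p e + fderiv ℝ (fun q => fderiv ℝ c q e) p e * v p := by
    intro e p
    rw [fderiv_fun_mul (hv.differentiable (by simp) p)
      ((contDiff_fderiv_const hcs e).differentiable (by simp) p)]
    simp only [add_apply, smul_apply, smul_eq_mul]
    ring
  have hL : Integrable (fun p => laplaceSum c p * v p) (volume.restrict (fluidDomain η)) :=
    (((continuous_laplaceSum hcs).mul hv.continuous).integrable_of_hasCompactSupport
      hvc.mul_left).integrableOn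
  have hpt : ∀ p, inner ℝ (fullGrad c p) (fullGrad v p) =
      (∑ i, fderiv ℝ (fun q => v q * fderiv ℝ c q (EuclideanSpace.single i 1, 0)) p
        (EuclideanSpace.single i 1, 0)
        + fderiv ℝ (fun q => v q * fderiv ℝ c q (0, 1)) p (0, 1)) - laplaceSum c p * v p := by
    intro p
    rw [inner_fullGrad_eq_sum (hcs.differentiable (by simp) p) (hv.differentiable (by simp) p)]
    simp only [hprod, laplaceSum, Finset.sum_add_distrib, add_mul, Finset.sum_mul]
    ring
  simp only [hpt]
  rw [integral_sub _ hL, integral_add _ (hDi _), integral_finsetSum _ fun i _ => hDi _]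
  · congr 1
    simp only [integral_fluidDomain_fderiv_horizontal hη (hDs _) (hDc _),
      integral_fluidDomain_fderiv_vertical hη (hDs _) (hDc _)]
    have hI : ∀ (a : Space d → ℝ) (e : Space d × ℝ), Continuous a →
        Integrable (fun x => a x * (v (x, η x) * fderiv ℝ c (x, η x) e)) volume := fun a e ha =>
      ((ha.mul ((hDs e).continuous.comp (continuous_id.prodMk hη.continuous)))
        ).integrable_of_hasCompactSupport (hasCompactSupport_graph (hDc e) η).mul_left
    have hηe : ∀ i, Continuous fun x => -(fderiv ℝ η x (EuclideanSpace.single i 1)) := fun i =>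
      ((hη.continuous_fderiv (by simp)).clm_apply continuous_const).neg
    rw [← integral_finsetSum, ← integral_add]
    · refine integral_congr_ae (ae_of_all _ fun x => ?_)
      simp only [sub_mul, Finset.sum_mul]
      rw [add_comm, sub_eq_add_neg, ← Finset.sum_neg_distrib]
      congr 1
      · ring
      · exact Finset.sum_congr rfl fun i _ => by ring
    · exact integrable_finsetSum _ fun i _ => hI _ _ (hηe i)
    · simpa using hI (fun _ => 1) (0, 1) continuous_const
    · exact fun i _ => hI _ _ (hηe i)
  · exact integrable_finsetSum _ fun i _ => hDi _
  · exact (integrable_finsetSum _ fun i _ => hDi _).add (hDi _)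

theorem vertVel_mul (η ψ N : Space d → ℝ) (x : Space d) :
    (1 + ‖∇ η x‖ ^ 2) * vertVel η ψ N x = N x + inner ℝ (∇ η x) (∇ ψ x) := by
  rw [vertVel, mul_inv_cancel_left₀ (by positivity)]

theorem sum_fderiv_sq (η : Space d → ℝ) (x : Space d) :
    ∑ i, fderiv ℝ η x (EuclideanSpace.single i 1) * fderiv ℝ η x (EuclideanSpace.single i 1) =
      ‖∇ η x‖ ^ 2 := by
  rw [← inner_gradient_gradient, real_inner_self_eq_norm_sq]

theorem fderiv_cauchyExt_vertical {η ψ b : Space d → ℝ} (hη : TameB η) (hψ : TameL2 ψ)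
    (hb : TameL2 b) (x : Space d) : fderiv ℝ (cauchyExt η ψ b) (x, η x) (0, 1) = b x := by
  rw [(hasFDerivAt_cauchyExt_graph hη hψ hb x).fderiv]
  simp

theorem fderiv_cauchyExt_horizontal {η ψ b : Space d → ℝ} (hη : TameB η) (hψ : TameL2 ψ)
    (hb : TameL2 b) (x e : Space d) : fderiv ℝ (cauchyExt η ψ b) (x, η x) (e, 0) =
      fderiv ℝ ψ x e - b x * fderiv ℝ η x e := by
  rw [(hasFDerivAt_cauchyExt_graph hη hψ hb x).fderiv]
  simp
  ring

/-- This is what fixes the vertical derivative b of the extension: its rescaled normal derivative on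
the graph is b - ∇η·(∇ψ - b∇η) = (1 + |∇η|²) b - ∇η·∇ψ, which equals N exactly when b is `vertVel η
ψ N`. -/
theorem integral_inner_fullGrad_cauchyExt {η ψ N : Space d → ℝ} (hη : TameB η) (hψ : TameL2 ψ)
    (hN : TameL2 N) {v : Space d × ℝ → ℝ} (hv : ContDiff ℝ ∞ v) (hvc : HasCompactSupport v) :
    ∫ p in fluidDomain η,
        inner ℝ (fullGrad (cauchyExt η ψ (vertVel η ψ N)) p) (fullGrad v p) =
      (∫ x, N x * v (x, η x)) -
      ∫ p in fluidDomain η, laplaceSum (cauchyExt η ψ (vertVel η ψ N)) p * v p := by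
  have hb := tameL2_vertVel hη hψ hN
  rw [integral_inner_fullGrad_smooth hη.smooth (goodExt_cauchyExt hη hψ hb).smooth hv hvc]
  congr 1
  refine integral_congr_ae (ae_of_all _ fun x => ?_)
  simp only
  congr 1
  simp only [fderiv_cauchyExt_vertical hη hψ hb, fderiv_cauchyExt_horizontal hη hψ hb, mul_sub,
    Finset.sum_sub_distrib]
  have h1 := vertVel_mul η ψ N x
  have h2 : ∑ i, fderiv ℝ η x (EuclideanSpace.single i 1) * (vertVel η ψ N x *
      fderiv ℝ η x (EuclideanSpace.single i 1)) = vertVel η ψ N x * ‖∇ η x‖ ^ 2 := by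
    rw [← sum_fderiv_sq, Finset.mul_sum]
    exact Finset.sum_congr rfl fun i _ => by ring
  rw [h2, ← inner_gradient_gradient]
  linarith

/-- Expand |∇ψ - b∇η|² + b² and use (1 + |∇η|²) b = N + ∇η·∇ψ. The right side is arranged so that
the nonlinear terms of the dynamic equation are recognisable. -/
theorem norm_sq_fullGrad_cauchyExt {η ψ N : Space d → ℝ} (hη : TameB η) (hψ : TameL2 ψ)
    (hN : TameL2 N) (x : Space d) :
    ‖fullGrad (cauchyExt η ψ (vertVel η ψ N)) (x, η x)‖ ^ 2 =
      ‖∇ ψ x‖ ^ 2 + 2 * vertVel η ψ N x * N x -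
        (N x + inner ℝ (∇ η x) (∇ ψ x)) ^ 2 / (1 + ‖∇ η x‖ ^ 2) := by
  have hb := tameL2_vertVel hη hψ hN
  have hd := (goodExt_cauchyExt hη hψ hb).smooth.differentiable (by simp) (x, η x)
  rw [← real_inner_self_eq_norm_sq, inner_fullGrad_eq_sum hd hd]
  simp only [fderiv_cauchyExt_vertical hη hψ hb, fderiv_cauchyExt_horizontal hη hψ hb]
  have h1 := vertVel_mul η ψ N x
  have h2 : (N x + inner ℝ (∇ η x) (∇ ψ x)) ^ 2 / (1 + ‖∇ η x‖ ^ 2) =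
      vertVel η ψ N x * (N x + inner ℝ (∇ η x) (∇ ψ x)) := by
    rw [vertVel]; field_simp
  have h3 : ∑ i, (fderiv ℝ ψ x (EuclideanSpace.single i 1) -
        vertVel η ψ N x * fderiv ℝ η x (EuclideanSpace.single i 1)) *
      (fderiv ℝ ψ x (EuclideanSpace.single i 1) -
        vertVel η ψ N x * fderiv ℝ η x (EuclideanSpace.single i 1)) =
      ‖∇ ψ x‖ ^ 2 - 2 * vertVel η ψ N x * inner ℝ (∇ η x) (∇ ψ x) +
        vertVel η ψ N x ^ 2 * ‖∇ η x‖ ^ 2 := by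
    rw [← sum_fderiv_sq, ← sum_fderiv_sq, inner_gradient_gradient, Finset.mul_sum, Finset.mul_sum,
      ← Finset.sum_sub_distrib, ← Finset.sum_add_distrib]
    exact Finset.sum_congr rfl fun i _ => by ring
  rw [h2, h3]
  generalize vertVel η ψ N x = b at *
  generalize (inner ℝ (∇ η x) (∇ ψ x) : ℝ) = s at *
  linear_combination b * h1

/-! ### Square integrable functions -/

theorem abs_integral_inner_le {α V : Type*} [MeasurableSpace α] {μ : Measure α}
    [NormedAddCommGroup V] [InnerProductSpace ℝ V] {f g : α → V} (hf : MemLp f 2 μ)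
    (hg : MemLp g 2 μ) :
    |∫ a, inner ℝ (f a) (g a) ∂μ| ≤ √(∫ a, ‖f a‖ ^ 2 ∂μ) * √(∫ a, ‖g a‖ ^ 2 ∂μ) := by
  have h1 := integral_mul_le_Lp_mul_Lq_of_nonneg (μ := μ) (p := 2) (q := 2)
    Real.HolderConjugate.two_two (f := fun a => ‖f a‖) (g := fun a => ‖g a‖)
    (ae_of_all _ fun _ => norm_nonneg _) (ae_of_all _ fun _ => norm_nonneg _)
    (by simpa using hf.norm) (by simpa using hg.norm)
  simp only [Real.rpow_two, ← Real.sqrt_eq_rpow] at h1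
  refine le_trans ?_ h1
  refine (norm_integral_le_integral_norm (fun a => inner ℝ (f a) (g a))).trans ?_
  have hi : Integrable (fun a => ‖f a‖ * ‖g a‖) μ := hf.norm.integrable_mul hg.norm
  exact integral_mono_of_nonneg (ae_of_all _ fun _ => norm_nonneg _) hi
    (ae_of_all _ fun _ => norm_inner_le_norm _ _)

theorem integrable_inner_of_memLp {α V : Type*} [MeasurableSpace α] {μ : Measure α}
    [NormedAddCommGroup V] [InnerProductSpace ℝ V] {f g : α → V} (hf : MemLp f 2 μ)
    (hg : MemLp g 2 μ) : Integrable (fun a => inner ℝ (f a) (g a)) μ :=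
  (hf.norm.integrable_mul hg.norm).mono' (hf.1.inner hg.1)
    (ae_of_all _ fun _ => norm_inner_le_norm _ _)

theorem MemLp.integrable_sq_norm {α V : Type*} [MeasurableSpace α] {μ : Measure α}
    [NormedAddCommGroup V] {f : α → V} (hf : MemLp f 2 μ) : Integrable (fun a => ‖f a‖ ^ 2) μ :=
  (memLp_two_iff_integrable_sq_norm hf.1).1 hf

/-- A square integrable function paired with a bounded sequence supported in sets shrinking to a
null set. -/
theorem tendsto_integral_inner_zero {α V : Type*} [MeasurableSpace α] {μ : Measure α}
    [NormedAddCommGroup V] [InnerProductSpace ℝ V] {Y : α → V} (hY : MemLp Y 2 μ)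
    {h : ℕ → α → V} (hh : ∀ n, MemLp (h n) 2 μ) {K : ℝ} (hK : ∀ n, ∫ a, ‖h n a‖ ^ 2 ∂μ ≤ K)
    {A : ℕ → Set α} (hA : ∀ n, MeasurableSet (A n)) (h0 : ∀ n, ∀ a ∉ A n, h n a = 0)
    (hev : ∀ᵐ a ∂μ, ∀ᶠ n in atTop, a ∉ A n) :
    Tendsto (fun n => ∫ a, inner ℝ (Y a) (h n a) ∂μ) atTop (𝓝 0) := by
  have hYA : ∀ n, MemLp ((A n).indicator Y) 2 μ := fun n => hY.indicator (hA n)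
  have h1 : ∀ n, |∫ a, inner ℝ (Y a) (h n a) ∂μ| ≤
      √(∫ a, ‖(A n).indicator Y a‖ ^ 2 ∂μ) * √K := fun n => by
    have e : ∫ a, inner ℝ (Y a) (h n a) ∂μ = ∫ a, inner ℝ ((A n).indicator Y a) (h n a) ∂μ := by
      refine integral_congr_ae (ae_of_all _ fun a => ?_)
      by_cases ha : a ∈ A n
      · simp [indicator_of_mem ha]
      · simp [h0 n a ha]
    rw [e]
    refine (abs_integral_inner_le (hYA n) (hh n)).trans ?_
    gcongr
    exact hK n
  have h2 : Tendsto (fun n => ∫ a, ‖(A n).indicator Y a‖ ^ 2 ∂μ) atTop (𝓝 (∫ _, (0 : ℝ) ∂μ)) := by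
    refine tendsto_integral_of_dominated_convergence (fun a => ‖Y a‖ ^ 2)
      (fun n => (hYA n).1.norm.pow 2) (MemLp.integrable_sq_norm hY) (fun n => ae_of_all _ fun a => ?_) ?_
    · rw [Real.norm_of_nonneg (by positivity)]
      gcongr
      exact norm_indicator_le_norm_self _ _
    · filter_upwards [hev] with a ha
      refine tendsto_const_nhds.congr' ?_
      filter_upwards [ha] with n hn
      simp [indicator_of_notMem hn]
  have h3 : Tendsto (fun n => √(∫ a, ‖(A n).indicator Y a‖ ^ 2 ∂μ) * √K) atTop (𝓝 0) := by
    have := (h2.sqrt).mul_const √K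
    simpa using this
  exact squeeze_zero_norm h1 h3

/-- The shear flattens the shell, and Fubini produces its thickness 2R. This factor compensates the
growth of the functions being cut off or of the gradients of the cutoffs. -/
theorem memLp_of_shell_bound {V : Type*} [NormedAddCommGroup V] {f : Space d × ℝ → V}
    (hf : AEStronglyMeasurable f volume) {W : Space d → ℝ} (hW : MemLp W 2 volume)
    {ζ : Space d → ℝ} (hζ : Continuous ζ) {R : ℝ} (hR : 0 ≤ R)
    (h1 : ∀ᵐ p : Space d × ℝ, ‖f p‖ ≤ W p.1) (h2 : ∀ p, R < |p.2 - ζ p.1| → f p = 0) :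
    MemLp f 2 volume ∧ ∫ p, ‖f p‖ ^ 2 ≤ 2 * R * ∫ x, W x ^ 2 := by
  have hK : Integrable ((Icc (-R) R).indicator (fun _ => (1 : ℝ))) volume :=
    (integrable_indicator_iff measurableSet_Icc).2 (integrableOn_const (by simp))
  have h3 : Integrable
      (fun p : Space d × ℝ => W p.1 ^ 2 * (Icc (-R) R).indicator (fun _ => (1 : ℝ)) p.2) volume :=
    hW.integrable_sq.mul_prod hK
  have hmp := (measurePreserving_shear hζ).symm (shear hζ).toMeasurableEquiv
  have h4 := hmp.integrable_comp_of_integrable h3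
  have h5 := hmp.integral_comp' (g := fun p : Space d × ℝ =>
    W p.1 ^ 2 * (Icc (-R) R).indicator (fun _ => (1 : ℝ)) p.2)
  have hsymm : ∀ p, (shear hζ).toMeasurableEquiv.symm p = (p.1, p.2 - ζ p.1) := fun p => rfl
  have hle : ∀ᵐ p : Space d × ℝ, ‖f p‖ ^ 2 ≤ W p.1 ^ 2 *
      (Icc (-R) R).indicator (fun _ => (1 : ℝ)) (p.2 - ζ p.1) := by
    filter_upwards [h1] with p hp
    by_cases h : R < |p.2 - ζ p.1|
    · rw [h2 p h]
      simp only [norm_zero, ne_eq, OfNat.ofNat_ne_zero, not_false_eq_true, zero_pow]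
      exact mul_nonneg (sq_nonneg _) (indicator_nonneg (fun _ _ => zero_le_one) _)
    · have : p.2 - ζ p.1 ∈ Icc (-R) R := abs_le.1 (not_lt.1 h)
      rw [indicator_of_mem this, mul_one]
      gcongr
  have h4' : Integrable (fun p : Space d × ℝ => W p.1 ^ 2 *
      (Icc (-R) R).indicator (fun _ => (1 : ℝ)) (p.2 - ζ p.1)) volume := h4
  refine ⟨?_, ?_⟩
  · rw [memLp_two_iff_integrable_sq_norm hf]
    refine h4'.mono' (hf.norm.pow 2) ?_
    filter_upwards [hle] with p hp
    rwa [Real.norm_of_nonneg (by positivity)]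
  · refine (integral_mono_of_nonneg (ae_of_all _ fun _ => by positivity) h4' hle).trans
      (le_of_eq ?_)
    refine h5.trans ?_
    rw [Measure.volume_eq_prod, integral_prod_mul (fun x => W x ^ 2),
      integral_indicator measurableSet_Icc, setIntegral_const]
    simp only [measureReal_def, Real.volume_Icc, smul_eq_mul, mul_one]
    rw [ENNReal.toReal_ofReal (by linarith)]
    ring

/-! ### Weak formulations -/

/-- `Y` is a square integrable field with `-div Y = F + ν δ_{y = ζ(x)}` in the weak sense. -/
structure WeakData (Y : Space d × ℝ → GradSpace d) (ν ζ : Space d → ℝ) (F : Space d × ℝ → ℝ) :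
    Prop where
  memLp_field : MemLp Y 2 volume
  memLp_trace : MemLp ν 2 volume
  cont : Continuous ζ
  bdd : ∃ K : ℝ, ∀ x, |ζ x| ≤ K
  memLp_source : MemLp F 2 volume
  supp : ∃ R : ℝ, ∀ p, R < |p.2| → F p = 0
  eq : ∀ v : Space d × ℝ → ℝ, ContDiff ℝ ∞ v → HasCompactSupport v →
    ∫ p, inner ℝ (Y p) (fullGrad v p) = (∫ x, ν x * v (x, ζ x)) + ∫ p, F p * v p

/-- The pair `(v, g)`, where `g` stands for the gradient of `v`, is an admissible test object. -/
def WeakTest (Y : Space d × ℝ → GradSpace d) (ν ζ : Space d → ℝ) (F v : Space d × ℝ → ℝ)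
    (g : Space d × ℝ → GradSpace d) : Prop :=
  ∫ p, inner ℝ (Y p) (g p) = (∫ x, ν x * v (x, ζ x)) + ∫ p, F p * v p

/-- The gradients of the approximants split as c_n g + h_n. The first part converges by domination.
The errors h_n need only be bounded in L²: their supports eventually leave every point, so their
pairing with the fixed field `Y` tends to zero. The growth √(1 + |y|) is harmless in the other
terms, because `ζ` is bounded and `F` vanishes outside a slab. -/
theorem WeakData.weakTest_of_approx {Y : Space d × ℝ → GradSpace d} {ν ζ : Space d → ℝ}
    {F : Space d × ℝ → ℝ} (D : WeakData Y ν ζ F) {v : Space d × ℝ → ℝ}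
    {g : Space d × ℝ → GradSpace d} (hg : MemLp g 2 volume) {w : ℕ → Space d × ℝ → ℝ}
    (hw : ∀ n, Continuous (w n)) (hwt : ∀ n, WeakTest Y ν ζ F (w n) (fullGrad (w n)))
    {c : ℕ → Space d × ℝ → ℝ} (hc : ∀ n, Continuous (c n)) (hc1 : ∀ n p, |c n p| ≤ 1)
    (hclim : ∀ p, g p = 0 ∨ Tendsto (fun n => c n p) atTop (𝓝 1))
    {h : ℕ → Space d × ℝ → GradSpace d} (hh : ∀ n, MemLp (h n) 2 volume) {K : ℝ}
    (hK : ∀ n, ∫ p, ‖h n p‖ ^ 2 ≤ K) {A : ℕ → Set (Space d × ℝ)} (hA : ∀ n, MeasurableSet (A n))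
    (h0 : ∀ n, ∀ p ∉ A n, h n p = 0) (hev : ∀ p, ∀ᶠ n in atTop, p ∉ A n)
    (hgrad : ∀ n p, fullGrad (w n) p = c n p • g p + h n p)
    {W : Space d → ℝ} (hW : MemLp W 2 volume)
    (hbd : ∀ᵐ x, ∀ n y, |w n (x, y)| ≤ √(1 + |y|) * W x)
    (hlim : ∀ p, Tendsto (fun n => w n p) atTop (𝓝 (v p))) : WeakTest Y ν ζ F v g := by
  have hcg : ∀ n, MemLp (fun p => c n p • g p) 2 volume := fun n =>
    hg.of_le ((hc n).aestronglyMeasurable.smul hg.1) (ae_of_all _ fun p => by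
      rw [norm_smul, Real.norm_eq_abs]
      exact mul_le_of_le_one_left (norm_nonneg _) (hc1 n p))
  have hL : Tendsto (fun n => ∫ p, inner ℝ (Y p) (fullGrad (w n) p)) atTop
      (𝓝 (∫ p, inner ℝ (Y p) (g p))) := by
    have h1 : Tendsto (fun n => ∫ p, inner ℝ (Y p) (c n p • g p)) atTop
        (𝓝 (∫ p, inner ℝ (Y p) (g p))) := by
      refine tendsto_integral_of_dominated_convergence (fun p => ‖Y p‖ * ‖g p‖)
        (fun n => D.memLp_field.1.inner (hcg n).1)
        (D.memLp_field.norm.integrable_mul hg.norm) (fun n => ae_of_all _ fun p => ?_)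
        (ae_of_all _ fun p => ?_)
      · refine (norm_inner_le_norm _ _).trans ?_
        rw [norm_smul, Real.norm_eq_abs]
        exact mul_le_mul_of_nonneg_left (mul_le_of_le_one_left (norm_nonneg _) (hc1 n p))
          (norm_nonneg _)
      · rcases hclim p with hp | hp
        · simp [hp]
        · have := (tendsto_const_nhds (x := Y p)).inner (hp.smul_const (g p)) (𝕜 := ℝ)
          simpa using this
    have h2 := tendsto_integral_inner_zero D.memLp_field hh hK hA h0 (ae_of_all _ hev)
    have h3 := h1.add h2
    rw [add_zero] at h3
    refine h3.congr fun n => ?_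
    rw [← integral_add (integrable_inner_of_memLp D.memLp_field (hcg n))
      (integrable_inner_of_memLp D.memLp_field (hh n))]
    simp only [hgrad, inner_add_right]
  have hT : Tendsto (fun n => ∫ x, ν x * w n (x, ζ x)) atTop (𝓝 (∫ x, ν x * v (x, ζ x))) := by
    obtain ⟨K, hK⟩ := D.bdd
    refine tendsto_integral_of_dominated_convergence (fun x => ‖ν x‖ * ‖√(1 + K) * W x‖)
      (fun n => D.memLp_trace.1.mul
        ((hw n).comp (continuous_id.prodMk D.cont)).aestronglyMeasurable)
      (D.memLp_trace.norm.integrable_mul (hW.const_mul _).norm) (fun n => ?_)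
      (ae_of_all _ fun x => (hlim _).const_mul _)
    filter_upwards [hbd] with x hx
    rw [norm_mul]
    refine mul_le_mul_of_nonneg_left ?_ (norm_nonneg _)
    rw [Real.norm_eq_abs, Real.norm_eq_abs]
    have hW0 : 0 ≤ W x := by
      have := (abs_nonneg _).trans (hx 0 0)
      simpa using this
    refine (hx n _).trans (le_trans ?_ (le_abs_self _))
    gcongr
    exact hK x
  have hS : Tendsto (fun n => ∫ p, F p * w n p) atTop (𝓝 (∫ p, F p * v p)) := by
    obtain ⟨R, hR⟩ := D.supp
    have hm : MemLp (fun p : Space d × ℝ => (Icc (-|R|) |R|).indicator (fun _ => √(1 + |R|)) p.2 * W p.1)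
        2 volume := by
      refine (memLp_of_shell_bound (W := fun x => √(1 + |R|) * |W x|) (ζ := fun _ => 0) (R := |R|)
        ?_ (hW.norm.const_mul _) continuous_const (abs_nonneg _) (ae_of_all _ fun p => ?_)
        fun p hp => ?_).1
      · exact ((measurable_const.indicator measurableSet_Icc).comp
          measurable_snd).aestronglyMeasurable.mul hW.1.comp_fst
      · rw [norm_mul, Real.norm_eq_abs, Real.norm_eq_abs]
        refine mul_le_mul_of_nonneg_right ?_ (abs_nonneg _)
        refine (norm_indicator_le_norm_self (fun _ => √(1 + |R|)) p.2).trans (le_of_eq ?_)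
        rw [Real.norm_of_nonneg (Real.sqrt_nonneg _)]
      · rw [sub_zero] at hp
        have hn : p.2 ∉ Icc (-|R|) |R| := fun h => absurd (abs_le.2 h) (not_le.2 hp)
        rw [indicator_of_notMem hn, zero_mul]
    refine tendsto_integral_of_dominated_convergence
      (fun p => ‖F p‖ * ‖(Icc (-|R|) |R|).indicator (fun _ => √(1 + |R|)) p.2 * W p.1‖)
      (fun n => D.memLp_source.1.mul (hw n).aestronglyMeasurable)
      (D.memLp_source.norm.integrable_mul hm.norm) (fun n => ?_)
      (ae_of_all _ fun p => (hlim _).const_mul _)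
    have hbd' : ∀ᵐ p : Space d × ℝ, ∀ n y, |w n (p.1, y)| ≤ √(1 + |y|) * W p.1 :=
      Measure.quasiMeasurePreserving_fst.ae hbd
    filter_upwards [hbd'] with p hp
    rw [norm_mul]
    by_cases hy : R < |p.2|
    · simp [hR p hy]
    · have hy' : |p.2| ≤ |R| := (not_lt.1 hy).trans (le_abs_self _)
      have hmem : p.2 ∈ Icc (-|R|) |R| := abs_le.1 hy'
      refine mul_le_mul_of_nonneg_left ?_ (norm_nonneg _)
      rw [indicator_of_mem hmem, Real.norm_eq_abs, Real.norm_eq_abs]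
      have hW0 : 0 ≤ W p.1 := by
        have := (abs_nonneg _).trans (hp 0 0)
        simpa using this
      refine (hp n p.2).trans (le_trans ?_ (le_abs_self _))
      gcongr
  exact tendsto_nhds_unique hL ((hT.add hS).congr fun n => (hwt n).symm)

instance : (volume : Measure (Space d × ℝ)).IsAddRightInvariant :=
  inferInstanceAs ((volume : Measure (Space d)).prod (volume : Measure ℝ)).IsAddRightInvariant

/-! ### Cutoff at infinity and vertical translation in the weak formulations -/

theorem fullGrad_const (a : ℝ) (p : Space d × ℝ) : fullGrad (fun _ => a) p = 0 := by
  rw [fullGrad_eq (differentiableAt_const a), fderiv_fun_const, Pi.zero_apply]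
  have := gradOf_smul (0 : ℝ) (0 : Space d × ℝ →L[ℝ] ℝ)
  simpa using this

/-- A smooth cutoff at scale `n + 1` on `ℝ^d × ℝ`. -/
def bigCutoff (d n : ℕ) (p : Space d × ℝ) : ℝ :=
  (⟨1, 2, one_pos, one_lt_two⟩ : ContDiffBump (0 : Space d × ℝ)) (((n : ℝ) + 1)⁻¹ • p)

theorem contDiff_bigCutoff (d n : ℕ) : ContDiff ℝ ∞ (bigCutoff d n) :=
  (ContDiffBump.contDiff _).comp (contDiff_const_smul _)

theorem abs_bigCutoff_le (n : ℕ) (p : Space d × ℝ) : |bigCutoff d n p| ≤ 1 := by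
  rw [bigCutoff, abs_of_nonneg (ContDiffBump.nonneg _)]
  exact ContDiffBump.le_one _

theorem bigCutoff_eq_one {n : ℕ} {p : Space d × ℝ} (hp : ‖p‖ ≤ n + 1) : bigCutoff d n p = 1 := by
  refine ContDiffBump.one_of_mem_closedBall _ ?_
  rw [mem_closedBall_zero_iff, norm_smul, Real.norm_of_nonneg (by positivity)]
  exact inv_mul_le_one_of_le₀ hp (by positivity)

theorem bigCutoff_eq_zero {n : ℕ} {p : Space d × ℝ} (hp : 2 * ((n : ℝ) + 1) ≤ ‖p‖) :
    bigCutoff d n p = 0 := by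
  refine ContDiffBump.zero_of_le_dist _ ?_
  rw [dist_zero_right, norm_smul, Real.norm_of_nonneg (by positivity)]
  have : (0 : ℝ) < (n : ℝ) + 1 := by positivity
  rw [le_inv_mul_iff₀ this]
  linarith

theorem hasCompactSupport_bigCutoff (d n : ℕ) : HasCompactSupport (bigCutoff d n) := by
  refine HasCompactSupport.intro (isCompact_closedBall (0 : Space d × ℝ) (2 * ((n : ℝ) + 1)))
    fun p hp => bigCutoff_eq_zero ?_
  rw [mem_closedBall_zero_iff, not_le] at hp
  exact hp.le

theorem exists_norm_fullGrad_bigCutoff_le (d : ℕ) :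
    ∃ C : ℝ, 0 ≤ C ∧ ∀ n p, ‖fullGrad (bigCutoff d n) p‖ ≤ C / (n + 1) := by
  let Θ : ContDiffBump (0 : Space d × ℝ) := ⟨1, 2, one_pos, one_lt_two⟩
  obtain ⟨C, hC⟩ := (Θ.contDiff.continuous_fderiv (n := ∞) (by simp)).bounded_above_of_compact_support
    (Θ.hasCompactSupport.fderiv ℝ)
  have hC0 : 0 ≤ C := (norm_nonneg _).trans (hC 0)
  refine ⟨2 * C, by positivity, fun n p => ?_⟩
  refine (norm_fullGrad_le ((contDiff_bigCutoff d n).differentiable (by simp) p)).trans ?_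
  have h1 : fderiv ℝ (bigCutoff d n) p = ((n : ℝ) + 1)⁻¹ • fderiv ℝ Θ (((n : ℝ) + 1)⁻¹ • p) := by
    have := fderiv_comp_smul (f := Θ) (𝕜 := ℝ) (x := p) ((n : ℝ) + 1)⁻¹
    exact this
  rw [h1, norm_smul, Real.norm_of_nonneg (by positivity)]
  have := hC (((n : ℝ) + 1)⁻¹ • p)
  calc 2 * (((n : ℝ) + 1)⁻¹ * ‖fderiv ℝ Θ (((n : ℝ) + 1)⁻¹ • p)‖)
      ≤ 2 * (((n : ℝ) + 1)⁻¹ * C) := by gcongr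
    _ = 2 * C / (n + 1) := by field_simp

theorem fullGrad_bigCutoff_of_lt {n : ℕ} {p : Space d × ℝ} (hp : ‖p‖ < n + 1) :
    fullGrad (bigCutoff d n) p = 0 := by
  rw [fullGrad_congr (b := fun _ => 1), fullGrad_const]
  filter_upwards [(isOpen_lt continuous_norm continuous_const).mem_nhds hp] with q hq
  exact bigCutoff_eq_one (le_of_lt hq)

theorem fullGrad_bigCutoff_of_gt {n : ℕ} {p : Space d × ℝ} (hp : 2 * ((n : ℝ) + 1) < ‖p‖) :
    fullGrad (bigCutoff d n) p = 0 := by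
  rw [fullGrad_congr (b := fun _ => 0), fullGrad_const]
  filter_upwards [(isOpen_lt continuous_const continuous_norm).mem_nhds hp] with q hq
  exact bigCutoff_eq_zero (le_of_lt hq)

/-- A cutoff at scale n + 1 has gradient at most C / (n + 1), while |w| ≤ √(3(n + 1)) W in the slab
|y| ≤ 2(n + 1), of thickness 4(n + 1). Hence the error w ∇(cutoff) has squared L² norm at most 12 C²
∫ W²: bounded, though not shown to be small, which is all that the approximation lemma requires. -/
theorem WeakData.weakTest_smooth {Y : Space d × ℝ → GradSpace d} {ν ζ : Space d → ℝ}
    {F : Space d × ℝ → ℝ} (D : WeakData Y ν ζ F) {w : Space d × ℝ → ℝ} (hw : ContDiff ℝ ∞ w)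
    (hg : MemLp (fullGrad w) 2 volume) {W : Space d → ℝ} (hW : MemLp W 2 volume)
    (hbd : ∀ᵐ x, ∀ y, |w (x, y)| ≤ √(1 + |y|) * W x) : WeakTest Y ν ζ F w (fullGrad w) := by
  obtain ⟨C, hC0, hC⟩ := exists_norm_fullGrad_bigCutoff_le d
  have hh : ∀ n : ℕ, MemLp (fun p => w p • fullGrad (bigCutoff d n) p) 2 volume ∧
      ∫ p, ‖w p • fullGrad (bigCutoff d n) p‖ ^ 2 ≤ 12 * C ^ 2 * ∫ x, W x ^ 2 := fun n => by
    have hn : (0 : ℝ) < (n : ℝ) + 1 := by positivity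
    have hbd' : ∀ᵐ p : Space d × ℝ, ∀ y, |w (p.1, y)| ≤ √(1 + |y|) * W p.1 :=
      Measure.quasiMeasurePreserving_fst.ae hbd
    have h := memLp_of_shell_bound (f := fun p => w p • fullGrad (bigCutoff d n) p)
      (W := fun x => √(3 * (n + 1)) * (C / (n + 1)) * W x) (ζ := fun _ => 0) (R := 2 * (n + 1))
      (hw.continuous.smul (continuous_fullGrad (contDiff_bigCutoff d n))).aestronglyMeasurable
      (hW.const_mul _) continuous_const (by positivity) ?_ ?_
    · refine ⟨h.1, h.2.trans (le_of_eq ?_)⟩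
      simp only [mul_pow, Real.sq_sqrt (show (0 : ℝ) ≤ 3 * (n + 1) by positivity)]
      rw [integral_const_mul]
      field_simp
      ring
    · filter_upwards [hbd'] with p hp
      have hW0 : 0 ≤ W p.1 := by
        have := (abs_nonneg _).trans (hp 0)
        simpa using this
      rw [norm_smul, Real.norm_eq_abs]
      by_cases hy : 2 * ((n : ℝ) + 1) < |p.2|
      · rw [fullGrad_bigCutoff_of_gt (hy.trans_le (norm_snd_le p)), norm_zero, mul_zero]
        positivity
      · calc |w p| * ‖fullGrad (bigCutoff d n) p‖ ≤ (√(1 + |p.2|) * W p.1) * (C / (n + 1)) :=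
              mul_le_mul (hp p.2) (hC n p) (norm_nonneg _) (by positivity)
          _ ≤ (√(3 * (n + 1)) * W p.1) * (C / (n + 1)) := by
              gcongr
              rw [not_lt] at hy
              have : (0 : ℝ) ≤ n := n.cast_nonneg
              linarith
          _ = _ := by ring
    · intro p hp
      rw [sub_zero] at hp
      rw [fullGrad_bigCutoff_of_gt (hp.trans_le (norm_snd_le p)), smul_zero]
  have hlim1 : ∀ p : Space d × ℝ, ∀ᶠ n : ℕ in atTop, ‖p‖ < n + 1 := fun p => by
    filter_upwards [eventually_ge_atTop ⌈‖p‖⌉₊] with n hn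
    have := (Nat.le_ceil ‖p‖).trans (Nat.cast_le.2 hn)
    linarith
  have hlim2 : ∀ p : Space d × ℝ, Tendsto (fun n => bigCutoff d n p) atTop (𝓝 1) := fun p => by
    refine tendsto_const_nhds.congr' ?_
    filter_upwards [hlim1 p] with n hn
    exact (bigCutoff_eq_one hn.le).symm
  refine D.weakTest_of_approx hg (w := fun n p => bigCutoff d n p * w p)
    (fun n => ((contDiff_bigCutoff d n).mul hw).continuous)
    (fun n => D.eq _ ((contDiff_bigCutoff d n).mul hw)
      (hasCompactSupport_bigCutoff d n).mul_right)
    (c := fun n => bigCutoff d n) (fun n => (contDiff_bigCutoff d n).continuous)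
    (fun n p => abs_bigCutoff_le n p) (fun p => Or.inr (hlim2 p)) (fun n => (hh n).1)
    (fun n => (hh n).2) (A := fun n => {p | (n : ℝ) + 1 ≤ ‖p‖})
    (fun n => measurableSet_le measurable_const measurable_norm) (fun n p hp => ?_) (fun p => ?_)
    (fun n p => ?_) hW ?_ (fun p => ?_)
  · rw [mem_ofPred_eq, not_le] at hp
    rw [fullGrad_bigCutoff_of_lt hp, smul_zero]
  · filter_upwards [hlim1 p] with n hn
    exact fun h => absurd hn (not_lt.2 h)
  · exact fullGrad_mul ((contDiff_bigCutoff d n).differentiable (by simp) p)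
      (hw.differentiable (by simp) p)
  · filter_upwards [hbd] with x hx n y
    rw [abs_mul]
    exact (mul_le_of_le_one_left (abs_nonneg _) (abs_bigCutoff_le n _)).trans (hx y)
  · simpa using (hlim2 p).mul_const (w p)

theorem GoodExt.weakTest {Y : Space d × ℝ → GradSpace d} {ν ζ : Space d → ℝ}
    {F : Space d × ℝ → ℝ} (D : WeakData Y ν ζ F) {c : Space d × ℝ → ℝ} (hc : GoodExt c) :
    WeakTest Y ν ζ F c (fullGrad c) := by
  obtain ⟨W, hW, h⟩ := hc.dom 0
  refine D.weakTest_smooth hc.smooth hc.memLp_fullGrad hW (ae_of_all _ fun x y => ?_)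
  have h1 := h (x, y)
  rw [norm_iteratedFDeriv_zero, Real.norm_eq_abs] at h1
  refine h1.trans (le_mul_of_one_le_left ((abs_nonneg _).trans h1) ?_)
  rw [Real.one_le_sqrt]
  linarith [abs_nonneg y]

theorem WeakData.translate {Y : Space d × ℝ → GradSpace d} {ν ζ : Space d → ℝ}
    {F : Space d × ℝ → ℝ} (D : WeakData Y ν ζ F) (δ : ℝ) :
    WeakData (fun p => Y (p + (0, δ))) ν (fun x => ζ x - δ) (fun p => F (p + (0, δ))) where
  memLp_field := D.memLp_field.comp_measurePreserving (measurePreserving_add_right volume (0, δ))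
  memLp_trace := D.memLp_trace
  cont := D.cont.sub continuous_const
  bdd := by
    obtain ⟨K, hK⟩ := D.bdd
    exact ⟨K + |δ|, fun x => (abs_sub _ _).trans (by gcongr; exact hK x)⟩
  memLp_source := D.memLp_source.comp_measurePreserving
    (measurePreserving_add_right volume (0, δ))
  supp := by
    obtain ⟨R, hR⟩ := D.supp
    refine ⟨R + |δ|, fun p hp => hR _ ?_⟩
    have := abs_sub_abs_le_abs_sub p.2 (-δ)
    rw [abs_neg, sub_neg_eq_add] at this
    simp only [Prod.snd_add]
    linarith
  eq v hv hvc := by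
    set a : Space d × ℝ := (0, δ)
    have hv' : ContDiff ℝ ∞ (fun p => v (p - a)) := hv.comp (contDiff_id.sub contDiff_const)
    have hvc' : HasCompactSupport (fun p => v (p - a)) :=
      hvc.comp_homeomorph (Homeomorph.subRight a)
    have h := D.eq _ hv' hvc'
    have hgrad : ∀ p, fullGrad (fun p => v (p - a)) p = fullGrad v (p - a) := fun p => by
      rw [fullGrad_eq (hv'.differentiable (by simp) p),
        fullGrad_eq (hv.differentiable (by simp) (p - a)), fderiv_comp_sub]
    have h1 := integral_add_right_eq_self (μ := (volume : Measure (Space d × ℝ)))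
      (fun p => (inner ℝ (Y p) (fullGrad v (p - a)) : ℝ)) a
    have h2 := integral_add_right_eq_self (μ := (volume : Measure (Space d × ℝ)))
      (fun p => F p * v (p - a)) a
    simp only [add_sub_cancel_right] at h1 h2
    simp only [hgrad] at h
    rw [h1, h2, h]
    simp [a]

/-! ### The remainder at a fixed time -/

/-- The data of the problem at a fixed time: `N` is the normal derivative on the graph of `η` of
the variational solution `φ` with trace `ψ`. -/
structure SliceData (η ψ N : Space d → ℝ) (φ : Space d × ℝ → ℝ) : Prop where
  eta : TameL2 η
  psi : TameL2 ψ
  nrm : TameL2 N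
  ext : IsHarmonicExtension η ψ φ
  green : ∀ Φ : Space d × ℝ → ℝ, ContDiff ℝ ∞ Φ → HasCompactSupport Φ →
      ∫ p in fluidDomain η, (inner ℝ (gradX φ p) (gradX Φ p) + derivY φ p * derivY Φ p) =
        ∫ x : Space d, N x * Φ (x, η x)

/-- The explicit smooth extension with the Cauchy data `(ψ, N)`. -/
def chi (η ψ N : Space d → ℝ) : Space d × ℝ → ℝ := cauchyExt η ψ (vertVel η ψ N)

/-- The difference between `φ` and the explicit extension, extended by zero. -/
def remainder (η ψ N : Space d → ℝ) (φ : Space d × ℝ → ℝ) : Space d × ℝ → ℝ :=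
  (fluidDomain η).indicator fun p => φ p - chi η ψ N p

/-- The gradient of the remainder. -/
def remGrad (η ψ N : Space d → ℝ) (φ : Space d × ℝ → ℝ) : Space d × ℝ → GradSpace d :=
  (fluidDomain η).indicator fun p => fullGrad φ p - fullGrad (chi η ψ N) p

/-- The source term in the equation for the remainder. -/
def remSource (η ψ N : Space d → ℝ) : Space d × ℝ → ℝ :=
  (fluidDomain η).indicator (laplaceSum (chi η ψ N))

/-- The size of the vertical derivative of the remainder on vertical lines. -/
def remSize (η ψ N : Space d → ℝ) (φ : Space d × ℝ → ℝ) (x : Space d) : ℝ :=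
  √(∫ y, (remGrad η ψ N φ (x, y)).snd ^ 2)

theorem norm_snd_gradSpace_le (a : GradSpace d) : |a.snd| ≤ ‖a‖ := by
  refine abs_le_of_sq_le_sq ?_ (norm_nonneg _)
  rw [WithLp.prod_norm_sq_eq_of_L2, Real.norm_eq_abs, sq_abs]
  nlinarith [sq_nonneg ‖a.fst‖]

theorem sq_intervalIntegral_le {f : ℝ → ℝ} (hf : MemLp f 2 volume) {a b : ℝ} (hab : a ≤ b) :
    (∫ y in a..b, f y) ^ 2 ≤ (b - a) * ∫ y in Ioc a b, f y ^ 2 := by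
  have h1 := abs_integral_inner_le (μ := volume.restrict (Ioc a b)) (f := fun _ => (1 : ℝ)) (g := f)
    (memLp_const 1) (hf.restrict _)
  simp only [Real.norm_eq_abs, sq_abs, RCLike.inner_apply, conj_trivial, mul_one, abs_one, one_pow,
    integral_const, smul_eq_mul, measureReal_def, Measure.restrict_apply_univ, Real.volume_Ioc,
    ENNReal.toReal_ofReal (sub_nonneg.2 hab)] at h1
  rw [intervalIntegral.integral_of_le hab, ← sq_abs]
  have h2 : 0 ≤ ∫ y in Ioc a b, f y ^ 2 := integral_nonneg fun _ => sq_nonneg _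
  calc |∫ y in Ioc a b, f y| ^ 2 ≤ (√(b - a) * √(∫ y in Ioc a b, f y ^ 2)) ^ 2 := by gcongr
    _ = _ := by rw [mul_pow, Real.sq_sqrt (sub_nonneg.2 hab), Real.sq_sqrt h2]

namespace SliceData

variable {η ψ N : Space d → ℝ} {φ : Space d × ℝ → ℝ}

theorem isOpen_dom (S : SliceData η ψ N φ) : IsOpen (fluidDomain η) :=
  isOpen_fluidDomain S.eta.smooth.continuous

theorem goodExt (S : SliceData η ψ N φ) : GoodExt (chi η ψ N) :=
  goodExt_cauchyExt S.eta.toTameB S.psi (tameL2_vertVel S.eta.toTameB S.psi S.nrm)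

theorem exists_bound_eta (S : SliceData η ψ N φ) : ∃ K : ℝ, 0 ≤ K ∧ ∀ x, |η x| ≤ K := by
  obtain ⟨K, hK⟩ := S.eta.bdd 0
  refine ⟨K, (norm_nonneg _).trans (hK 0), fun x => ?_⟩
  have := hK x
  rwa [norm_iteratedFDeriv_zero] at this

theorem differentiableAt_phi (S : SliceData η ψ N φ) {p : Space d × ℝ} (hp : p ∈ fluidDomain η) :
    DifferentiableAt ℝ φ p :=
  (S.ext.smooth.differentiableOn (by simp)).differentiableAt (S.isOpen_dom.mem_nhds hp)

theorem memLp_fullGrad_phi (S : SliceData η ψ N φ) :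
    MemLp ((fluidDomain η).indicator (fullGrad φ)) 2 volume := by
  rw [memLp_indicator_iff_restrict S.isOpen_dom.measurableSet]
  have hm : AEStronglyMeasurable (fullGrad φ) (volume.restrict (fluidDomain η)) :=
    (continuousOn_fullGrad S.isOpen_dom S.ext.smooth).aestronglyMeasurable
      S.isOpen_dom.measurableSet
  rw [memLp_two_iff_integrable_sq_norm hm]
  simp only [norm_sq_fullGrad]
  exact S.ext.finite_energy

theorem remGrad_eq (η ψ N : Space d → ℝ) (φ : Space d × ℝ → ℝ) : remGrad η ψ N φ = fun p =>
    (fluidDomain η).indicator (fullGrad φ) p -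
      (fluidDomain η).indicator (fullGrad (chi η ψ N)) p := by
  ext1 p
  by_cases hp : p ∈ fluidDomain η <;> simp [remGrad, hp]

theorem memLp_remGrad (S : SliceData η ψ N φ) : MemLp (remGrad η ψ N φ) 2 volume := by
  rw [remGrad_eq]
  exact S.memLp_fullGrad_phi.sub (S.goodExt.memLp_fullGrad.indicator S.isOpen_dom.measurableSet)

theorem weakData_phi (S : SliceData η ψ N φ) :
    WeakData ((fluidDomain η).indicator (fullGrad φ)) N η (fun _ => 0) where
  memLp_field := S.memLp_fullGrad_phi
  memLp_trace := S.nrm.memLp_self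
  cont := S.eta.smooth.continuous
  bdd := let ⟨K, _, hK⟩ := S.exists_bound_eta; ⟨K, hK⟩
  memLp_source := MemLp.zero
  supp := ⟨0, fun _ _ => rfl⟩
  eq v hv hvc := by
    have h := S.green v hv hvc
    simp only [← inner_fullGrad] at h
    simp only [zero_mul, integral_zero, add_zero]
    rw [← h, ← integral_indicator S.isOpen_dom.measurableSet]
    refine integral_congr_ae (ae_of_all _ fun p => ?_)
    by_cases hp : p ∈ fluidDomain η <;> simp [hp]

theorem memLp_laplaceSum (S : SliceData η ψ N φ) : MemLp (laplaceSum (chi η ψ N)) 2 volume :=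
  ((S.goodExt.memLp_iteratedFDeriv 2).norm.const_mul ((d : ℝ) + 1)).of_le
    (continuous_laplaceSum S.goodExt.smooth).aestronglyMeasurable (ae_of_all _ fun p => by
      rw [Real.norm_eq_abs, Real.norm_of_nonneg (by positivity)]
      exact abs_laplaceSum_le S.goodExt.smooth p)

theorem memLp_remSource (S : SliceData η ψ N φ) : MemLp (remSource η ψ N) 2 volume :=
  S.memLp_laplaceSum.indicator S.isOpen_dom.measurableSet

/-- Green's formulas for φ and for χ have the same surface term ∫ N v, so it cancels in the
difference. This is why the zero extension solves an equation on the whole space whose source is a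
square integrable function. -/
theorem weakData_remainder (S : SliceData η ψ N φ) :
    WeakData (remGrad η ψ N φ) (fun _ => 0) η (remSource η ψ N) where
  memLp_field := S.memLp_remGrad
  memLp_trace := MemLp.zero
  cont := S.eta.smooth.continuous
  bdd := let ⟨K, _, hK⟩ := S.exists_bound_eta; ⟨K, hK⟩
  memLp_source := S.memLp_remSource
  supp := by
    obtain ⟨R, hR⟩ := S.goodExt.supp
    refine ⟨R, fun p hp => ?_⟩
    have h1 := abs_laplaceSum_le S.goodExt.smooth p
    rw [GoodExt.iteratedFDeriv_eq_zero hR 2 hp, norm_zero, mul_zero] at h1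
    have h2 : laplaceSum (chi η ψ N) p = 0 := abs_nonpos_iff.1 h1
    by_cases hp : p ∈ fluidDomain η <;> simp [remSource, hp, h2]
  eq v hv hvc := by
    have h1 := S.weakData_phi.eq v hv hvc
    have h2 := integral_inner_fullGrad_cauchyExt S.eta.toTameB S.psi S.nrm hv hvc
    have hvm : MemLp (fullGrad v) 2 volume :=
      (continuous_fullGrad hv).memLp_of_hasCompactSupport (by
        refine HasCompactSupport.intro hvc.isCompact fun p hp => ?_
        rw [fullGrad_congr (b := fun _ => 0), fullGrad_const]
        exact notMem_tsupport_iff_eventuallyEq.1 hp)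
    have hχm := S.goodExt.memLp_fullGrad.indicator S.isOpen_dom.measurableSet
    simp only [zero_mul, integral_zero, add_zero] at h1
    simp only [zero_mul, integral_zero, zero_add, remGrad_eq, inner_sub_left]
    rw [integral_sub (integrable_inner_of_memLp S.memLp_fullGrad_phi hvm)
      (integrable_inner_of_memLp hχm hvm), h1]
    have e1 : ∫ p, inner ℝ ((fluidDomain η).indicator (fullGrad (chi η ψ N)) p) (fullGrad v p) =
        ∫ p in fluidDomain η, inner ℝ (fullGrad (chi η ψ N) p) (fullGrad v p) := by
      rw [← integral_indicator S.isOpen_dom.measurableSet]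
      refine integral_congr_ae (ae_of_all _ fun p => ?_)
      by_cases hp : p ∈ fluidDomain η <;> simp [hp]
    have e2 : ∫ p, remSource η ψ N p * v p =
        ∫ p in fluidDomain η, laplaceSum (chi η ψ N) p * v p := by
      rw [← integral_indicator S.isOpen_dom.measurableSet]
      refine integral_congr_ae (ae_of_all _ fun p => ?_)
      by_cases hp : p ∈ fluidDomain η <;> simp [hp, remSource]
    rw [e1, e2]
    simp only [chi] at h2 ⊢
    rw [h2]
    ring

theorem aestronglyMeasurable_remY (S : SliceData η ψ N φ) :
    AEStronglyMeasurable (fun p => (remGrad η ψ N φ p).snd) volume := by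
  have hc : Continuous fun a : GradSpace d => a.snd := by fun_prop
  exact hc.comp_aestronglyMeasurable S.memLp_remGrad.1

theorem memLp_remY (S : SliceData η ψ N φ) :
    MemLp (fun p => (remGrad η ψ N φ p).snd) 2 volume :=
  S.memLp_remGrad.of_le S.aestronglyMeasurable_remY (ae_of_all _ fun _ => norm_snd_gradSpace_le _)

theorem ae_memLp_vertical (S : SliceData η ψ N φ) :
    ∀ᵐ x : Space d, MemLp (fun y => (remGrad η ψ N φ (x, y)).snd) 2 volume := by
  have h1 := S.memLp_remY.integrable_sq
  rw [Measure.volume_eq_prod] at h1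
  have h3 := S.aestronglyMeasurable_remY
  rw [Measure.volume_eq_prod] at h3
  filter_upwards [h1.prod_right_ae, h3.prodMk_left] with x hx hx2
  exact (memLp_two_iff_integrable_sq hx2).2 hx

theorem memLp_remSize (S : SliceData η ψ N φ) : MemLp (remSize η ψ N φ) 2 volume := by
  have h1 := S.memLp_remY.integrable_sq
  rw [Measure.volume_eq_prod] at h1
  have h2 := h1.integral_prod_left
  have hm : AEStronglyMeasurable (remSize η ψ N φ) volume :=
    Real.continuous_sqrt.comp_aestronglyMeasurable h2.aestronglyMeasurable
  rw [memLp_two_iff_integrable_sq hm]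
  refine h2.congr (ae_of_all _ fun x => ?_)
  exact (Real.sq_sqrt (integral_nonneg fun _ => sq_nonneg _)).symm

/-- The traces of φ and of χ along almost every vertical line are both ψ, so the remainder tends to
zero at the graph and is recovered by integrating its vertical derivative from there. -/
theorem ae_remainder_eq (S : SliceData η ψ N φ) : ∀ᵐ x : Space d, ∀ y,
    remainder η ψ N φ (x, y) = - ∫ σ in y..(η x), (remGrad η ψ N φ (x, σ)).snd := by
  filter_upwards [S.ae_memLp_vertical, S.ext.trace] with x hx htr y
  have hint : ∀ a b : ℝ, IntervalIntegrable (fun σ => (remGrad η ψ N φ (x, σ)).snd) volume a b :=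
    fun a b => by
      have := hx.locallyIntegrable (by norm_num)
      exact (this.integrableOn_isCompact isCompact_uIcc).intervalIntegrable
  rcases lt_or_ge y (η x) with hy | hy
  · have hχ := S.goodExt.smooth
    have hder : ∀ σ ∈ Ioo y (η x), HasDerivAt (fun σ => φ (x, σ) - chi η ψ N (x, σ))
        (remGrad η ψ N φ (x, σ)).snd σ := fun σ hσ => by
      have hmem : (x, σ) ∈ fluidDomain η := hσ.2
      rw [remGrad, indicator_of_mem hmem]
      exact (hasDerivAt_vertical (S.differentiableAt_phi hmem)).sub
        (hasDerivAt_vertical (hχ.differentiable (by simp) (x, σ)))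
    have hmem : (x, y) ∈ fluidDomain η := hy
    have ha : Tendsto (fun σ => φ (x, σ) - chi η ψ N (x, σ)) (𝓝[>] y)
        (𝓝 (φ (x, y) - chi η ψ N (x, y))) :=
      ((hasDerivAt_vertical (S.differentiableAt_phi hmem)).sub
        (hasDerivAt_vertical (hχ.differentiable (by simp) (x, y)))).continuousAt.tendsto.mono_left
        nhdsWithin_le_nhds
    have hb : Tendsto (fun σ => φ (x, σ) - chi η ψ N (x, σ)) (𝓝[<] (η x)) (𝓝 0) := by
      have h1 : Tendsto (fun σ => chi η ψ N (x, σ)) (𝓝[<] (η x)) (𝓝 (chi η ψ N (x, η x))) :=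
        ((hχ.continuous.comp (continuous_const.prodMk continuous_id)).tendsto (η x)).mono_left
          nhdsWithin_le_nhds
      have h2 := htr.sub h1
      rwa [chi, cauchyExt_graph, sub_self] at h2
    rw [intervalIntegral.integral_eq_sub_of_hasDerivAt_of_tendsto hy hder (hint _ _) ha hb,
      remainder, indicator_of_mem hmem]
    ring
  · have hmem : (x, y) ∉ fluidDomain η := not_lt.2 hy
    rw [remainder, indicator_of_notMem hmem, intervalIntegral.integral_of_ge hy,
      setIntegral_eq_zero_of_forall_eq_zero, neg_zero, neg_zero]
    intro σ hσ
    have : (x, σ) ∉ fluidDomain η := not_lt.2 hσ.1.le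
    rw [remGrad, indicator_of_notMem this]
    rfl

theorem ae_remainder_sub (S : SliceData η ψ N φ) : ∀ᵐ x : Space d, ∀ y y',
    remainder η ψ N φ (x, y') - remainder η ψ N φ (x, y) =
      ∫ σ in y..y', (remGrad η ψ N φ (x, σ)).snd := by
  filter_upwards [S.ae_memLp_vertical, S.ae_remainder_eq] with x hx h y y'
  have hint : ∀ a b : ℝ, IntervalIntegrable (fun σ => (remGrad η ψ N φ (x, σ)).snd) volume a b :=
    fun a b => by
      have := hx.locallyIntegrable (by norm_num)
      exact (this.integrableOn_isCompact isCompact_uIcc).intervalIntegrable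
  rw [h, h, ← intervalIntegral.integral_add_adjacent_intervals (hint y y') (hint y' (η x))]
  ring

theorem remainder_of_le {x : Space d} {y : ℝ} (h : η x ≤ y) : remainder η ψ N φ (x, y) = 0 := by
  have hn : (x, y) ∉ fluidDomain η := not_lt.2 h
  rw [remainder, indicator_of_notMem hn]

theorem ae_sq_remainder_le (S : SliceData η ψ N φ) : ∀ᵐ x : Space d, ∀ y, y ≤ η x →
    remainder η ψ N φ (x, y) ^ 2 ≤
      (η x - y) * ∫ σ in Ioc y (η x), (remGrad η ψ N φ (x, σ)).snd ^ 2 := by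
  filter_upwards [S.ae_memLp_vertical, S.ae_remainder_eq] with x hx h y hy
  rw [h, neg_sq]
  exact sq_intervalIntegral_le hx hy

/-- Cauchy–Schwarz on the segment up to the graph. No restriction on `y` is needed: above the graph
the remainder vanishes and the real square root of a negative number is 0. -/
theorem ae_abs_remainder_le (S : SliceData η ψ N φ) : ∀ᵐ x : Space d, ∀ y,
    |remainder η ψ N φ (x, y)| ≤ √(η x - y) * remSize η ψ N φ x := by
  filter_upwards [S.ae_memLp_vertical, S.ae_sq_remainder_le] with x hx h y
  rcases le_or_gt y (η x) with hy | hy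
  · rw [remSize, ← Real.sqrt_mul (sub_nonneg.2 hy)]
    refine Real.abs_le_sqrt ((h y hy).trans ?_)
    refine mul_le_mul_of_nonneg_left ?_ (sub_nonneg.2 hy)
    exact setIntegral_le_integral hx.integrable_sq (ae_of_all _ fun _ => sq_nonneg _)
  · rw [remainder_of_le hy.le, abs_zero]
    exact mul_nonneg (Real.sqrt_nonneg _) (Real.sqrt_nonneg _)

end SliceData

/-! ### Cutoff near the graph -/

theorem exists_bound_deriv_smoothTransition :
    ∃ B : ℝ, 0 ≤ B ∧ ∀ z, |deriv Real.smoothTransition z| ≤ B := by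
  have hc : Continuous (deriv Real.smoothTransition) :=
    (Real.smoothTransition.contDiff (n := 1)).continuous_deriv (by simp)
  have hs : HasCompactSupport (deriv Real.smoothTransition) := by
    refine HasCompactSupport.intro (isCompact_Icc (a := (0 : ℝ)) (b := 1)) fun z hz => ?_
    rw [mem_Icc, not_and_or, not_le, not_le] at hz
    rcases hz with hz | hz
    · have : Real.smoothTransition =ᶠ[𝓝 z] fun _ => 0 := by
        filter_upwards [Iio_mem_nhds hz] with s hs
        exact Real.smoothTransition.zero_of_nonpos (le_of_lt hs)
      rw [this.deriv_eq, deriv_const]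
    · have : Real.smoothTransition =ᶠ[𝓝 z] fun _ => 1 := by
        filter_upwards [Ioi_mem_nhds hz] with s hs
        exact Real.smoothTransition.one_of_one_le (le_of_lt hs)
      rw [this.deriv_eq, deriv_const]
  obtain ⟨B, hB⟩ := hc.bounded_above_of_compact_support hs
  exact ⟨B, (norm_nonneg _).trans (hB 0), hB⟩

/-- A smooth cutoff vanishing above depth `1 / (n + 1)` and equal to one below depth
`2 / (n + 1)`. -/
def depthCutoff (η : Space d → ℝ) (n : ℕ) (p : Space d × ℝ) : ℝ :=
  Real.smoothTransition (((n : ℝ) + 1) * (η p.1 - p.2) - 1)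

theorem contDiff_depthCutoff {η : Space d → ℝ} (hη : ContDiff ℝ ∞ η) (n : ℕ) :
    ContDiff ℝ ∞ (depthCutoff η n) :=
  Real.smoothTransition.contDiff.comp
    ((contDiff_const.mul ((hη.comp contDiff_fst).sub contDiff_snd)).sub contDiff_const)

theorem abs_depthCutoff_le (η : Space d → ℝ) (n : ℕ) (p : Space d × ℝ) :
    |depthCutoff η n p| ≤ 1 := by
  rw [depthCutoff, abs_of_nonneg (Real.smoothTransition.nonneg _)]
  exact Real.smoothTransition.le_one _

theorem depthCutoff_eventuallyEq_zero {η : Space d → ℝ} (hη : Continuous η) {n : ℕ}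
    {p : Space d × ℝ} (hp : ((n : ℝ) + 1) * (η p.1 - p.2) < 1) :
    depthCutoff η n =ᶠ[𝓝 p] fun _ => 0 := by
  have hc : Continuous fun p : Space d × ℝ => ((n : ℝ) + 1) * (η p.1 - p.2) := by fun_prop
  filter_upwards [(isOpen_lt hc continuous_const).mem_nhds hp] with q hq
  exact Real.smoothTransition.zero_of_nonpos (sub_nonpos.2 (le_of_lt hq))

theorem depthCutoff_eventuallyEq_one {η : Space d → ℝ} (hη : Continuous η) {n : ℕ}
    {p : Space d × ℝ} (hp : 2 < ((n : ℝ) + 1) * (η p.1 - p.2)) :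
    depthCutoff η n =ᶠ[𝓝 p] fun _ => 1 := by
  have hc : Continuous fun p : Space d × ℝ => ((n : ℝ) + 1) * (η p.1 - p.2) := by fun_prop
  filter_upwards [(isOpen_lt continuous_const hc).mem_nhds hp] with q hq
  have hq' : 2 < ((n : ℝ) + 1) * (η q.1 - q.2) := hq
  exact Real.smoothTransition.one_of_one_le (by linarith)

theorem exists_norm_fullGrad_depthCutoff_le {η : Space d → ℝ} (hη : TameB η) :
    ∃ C : ℝ, 0 ≤ C ∧ ∀ n p, ‖fullGrad (depthCutoff η n) p‖ ≤ C * (n + 1) := by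
  obtain ⟨B, hB0, hB⟩ := exists_bound_deriv_smoothTransition
  obtain ⟨K, hK⟩ := hη.bdd 1
  have hK0 : 0 ≤ K := (norm_nonneg _).trans (hK 0)
  refine ⟨2 * (B * (K + 1)), by positivity, fun n p => ?_⟩
  refine (norm_fullGrad_le ((contDiff_depthCutoff hη.smooth n).differentiable
    (by simp) p)).trans ?_
  have h1 : HasFDerivAt (fun q : Space d × ℝ => ((n : ℝ) + 1) * (η q.1 - q.2) - 1)
      (((n : ℝ) + 1) • ((fderiv ℝ η p.1).comp (ContinuousLinearMap.fst ℝ (Space d) ℝ) -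
        ContinuousLinearMap.snd ℝ (Space d) ℝ)) p :=
    (((HasFDerivAt.comp p (g := η) (f := Prod.fst)
      (hη.smooth.differentiable (by simp) p.1).hasFDerivAt hasFDerivAt_fst).sub
        hasFDerivAt_snd).const_mul _).sub_const _
  have h2 : HasDerivAt Real.smoothTransition (deriv Real.smoothTransition
      (((n : ℝ) + 1) * (η p.1 - p.2) - 1)) (((n : ℝ) + 1) * (η p.1 - p.2) - 1) :=
    ((Real.smoothTransition.contDiff (n := 1)).differentiable (by simp) _).hasDerivAt
  have h3 := (h2.comp_hasFDerivAt p h1).fderiv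
  have h4 : fderiv ℝ (depthCutoff η n) p = _ := h3
  have h5 : ‖(fderiv ℝ η p.1).comp (ContinuousLinearMap.fst ℝ (Space d) ℝ) -
        ContinuousLinearMap.snd ℝ (Space d) ℝ‖ ≤ K + 1 := by
    refine (norm_sub_le _ _).trans (add_le_add ?_ (ContinuousLinearMap.norm_snd_le ℝ (Space d) ℝ))
    refine (ContinuousLinearMap.opNorm_comp_le _ _).trans ?_
    have := hK p.1
    rw [norm_iteratedFDeriv_one] at this
    exact (mul_le_of_le_one_right (norm_nonneg _)
      (ContinuousLinearMap.norm_fst_le ℝ (Space d) ℝ)).trans this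
  rw [h4, norm_smul, norm_smul, Real.norm_eq_abs, Real.norm_of_nonneg (by positivity)]
  calc 2 * (|deriv Real.smoothTransition (((n : ℝ) + 1) * (η p.1 - p.2) - 1)| *
        (((n : ℝ) + 1) * _)) ≤ 2 * (B * (((n : ℝ) + 1) * (K + 1))) := by gcongr; exact hB _
    _ = _ := by ring

namespace SliceData

variable {η ψ N : Space d → ℝ} {φ : Space d × ℝ → ℝ}

theorem aestronglyMeasurable_remainder (S : SliceData η ψ N φ) :
    AEStronglyMeasurable (remainder η ψ N φ) volume := by
  rw [remainder, aestronglyMeasurable_indicator_iff S.isOpen_dom.measurableSet]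
  exact (S.ext.smooth.continuousOn.sub S.goodExt.smooth.continuous.continuousOn).aestronglyMeasurable
    S.isOpen_dom.measurableSet

theorem remainder_eventuallyEq (S : SliceData η ψ N φ) {p : Space d × ℝ}
    (hp : p ∈ fluidDomain η) : remainder η ψ N φ =ᶠ[𝓝 p] fun q => φ q - chi η ψ N q := by
  filter_upwards [S.isOpen_dom.mem_nhds hp] with q hq
  rw [remainder, indicator_of_mem hq]

theorem contDiff_depthCutoff_mul (S : SliceData η ψ N φ) (n : ℕ) :
    ContDiff ℝ ∞ (fun p => depthCutoff η n p * remainder η ψ N φ p) := by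
  rw [contDiff_iff_contDiffAt]
  intro p
  by_cases hp : p ∈ fluidDomain η
  · refine (contDiff_depthCutoff S.eta.smooth n).contDiffAt.mul ?_
    refine ContDiffAt.congr_of_eventuallyEq ?_ (S.remainder_eventuallyEq hp)
    exact (S.ext.smooth.contDiffAt (S.isOpen_dom.mem_nhds hp)).sub S.goodExt.smooth.contDiffAt
  · have h : ((n : ℝ) + 1) * (η p.1 - p.2) < 1 := by
      have : η p.1 - p.2 ≤ 0 := sub_nonpos.2 (not_lt.1 hp)
      nlinarith [(n.cast_nonneg : (0 : ℝ) ≤ n)]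
    refine (contDiffAt_const (c := (0 : ℝ))).congr_of_eventuallyEq ?_
    filter_upwards [depthCutoff_eventuallyEq_zero S.eta.smooth.continuous h] with q hq
    rw [hq, zero_mul]

theorem fullGrad_depthCutoff_mul (S : SliceData η ψ N φ) (n : ℕ) (p : Space d × ℝ) :
    fullGrad (fun p => depthCutoff η n p * remainder η ψ N φ p) p =
      depthCutoff η n p • remGrad η ψ N φ p +
        remainder η ψ N φ p • fullGrad (depthCutoff η n) p := by
  by_cases hp : p ∈ fluidDomain η
  · have h1 := S.remainder_eventuallyEq hp
    have hd1 := S.differentiableAt_phi hp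
    have hd2 : DifferentiableAt ℝ (chi η ψ N) p := S.goodExt.smooth.differentiable (by simp) p
    have hd : DifferentiableAt ℝ (remainder η ψ N φ) p :=
      (hd1.fun_sub hd2).congr_of_eventuallyEq h1
    rw [fullGrad_mul ((contDiff_depthCutoff S.eta.smooth n).differentiable (by simp) p) hd,
      fullGrad_congr h1, fullGrad_sub hd1 hd2, remGrad, indicator_of_mem hp]
  · have h : ((n : ℝ) + 1) * (η p.1 - p.2) < 1 := by
      have : η p.1 - p.2 ≤ 0 := sub_nonpos.2 (not_lt.1 hp)
      nlinarith [(n.cast_nonneg : (0 : ℝ) ≤ n)]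
    have hev : (fun p => depthCutoff η n p * remainder η ψ N φ p) =ᶠ[𝓝 p] fun _ => 0 := by
      filter_upwards [depthCutoff_eventuallyEq_zero S.eta.smooth.continuous h] with q hq
      rw [hq, zero_mul]
    rw [fullGrad_congr hev, fullGrad_const, remGrad, remainder, indicator_of_notMem hp,
      indicator_of_notMem hp, smul_zero, zero_smul, add_zero]

theorem remainder_smul_fullGrad_eq_zero (S : SliceData η ψ N φ) {n : ℕ} {p : Space d × ℝ}
    (hp : p ∉ {p : Space d × ℝ | 0 < η p.1 - p.2 ∧ ((n : ℝ) + 1) * (η p.1 - p.2) ≤ 2}) :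
    remainder η ψ N φ p • fullGrad (depthCutoff η n) p = 0 := by
  by_cases h0 : p ∈ fluidDomain η
  · have h1 : 0 < η p.1 - p.2 := sub_pos.2 h0
    have h2 : 2 < ((n : ℝ) + 1) * (η p.1 - p.2) := by
      by_contra h
      exact hp ⟨h1, not_lt.1 h⟩
    rw [fullGrad_congr (depthCutoff_eventuallyEq_one S.eta.smooth.continuous h2), fullGrad_const,
      smul_zero]
  · rw [remainder, indicator_of_notMem h0, zero_smul]

/-- The remainder is an admissible test function in all weak formulations. -/
theorem weakTest_remainder (S : SliceData η ψ N φ) {Y : Space d × ℝ → GradSpace d}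
    {ν ζ : Space d → ℝ} {F : Space d × ℝ → ℝ} (D : WeakData Y ν ζ F) :
    WeakTest Y ν ζ F (remainder η ψ N φ) (remGrad η ψ N φ) := by
  obtain ⟨C, hC0, hC⟩ := exists_norm_fullGrad_depthCutoff_le S.eta.toTameB
  obtain ⟨K, hK0, hK⟩ := S.exists_bound_eta
  have hηc := S.eta.smooth.continuous
  have hcc := fun n => (contDiff_depthCutoff S.eta.smooth n).continuous
  -- The scales balance: the cutoff gradient is at most C(n + 1), the remainder at most √(2/(n + 1))
  -- `remSize`, and the set lies in a shell with thickness parameter 4/(n + 1). The product of the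
  -- squares is 8C², independent of n.
  have hh : ∀ n : ℕ,
      MemLp (fun p => remainder η ψ N φ p • fullGrad (depthCutoff η n) p) 2 volume ∧
      ∫ p, ‖remainder η ψ N φ p • fullGrad (depthCutoff η n) p‖ ^ 2 ≤
        8 * C ^ 2 * ∫ x, remSize η ψ N φ x ^ 2 := fun n => by
    have hn : (0 : ℝ) < (n : ℝ) + 1 := by positivity
    have hbd' : ∀ᵐ p : Space d × ℝ, ∀ y,
        |remainder η ψ N φ (p.1, y)| ≤ √(η p.1 - y) * remSize η ψ N φ p.1 :=
      Measure.quasiMeasurePreserving_fst.ae S.ae_abs_remainder_le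
    have h := memLp_of_shell_bound
      (f := fun p => remainder η ψ N φ p • fullGrad (depthCutoff η n) p)
      (W := fun x => √(2 / (n + 1)) * (C * (n + 1)) * remSize η ψ N φ x) (ζ := η)
      (R := 2 / (n + 1))
      (S.aestronglyMeasurable_remainder.smul (continuous_fullGrad
        (contDiff_depthCutoff S.eta.smooth n)).aestronglyMeasurable)
      (S.memLp_remSize.const_mul _) hηc (by positivity) ?_ ?_
    · refine ⟨h.1, h.2.trans (le_of_eq ?_)⟩
      simp only [mul_pow, Real.sq_sqrt (show (0 : ℝ) ≤ 2 / (n + 1) by positivity)]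
      rw [integral_const_mul]
      field_simp
      ring
    · filter_upwards [hbd'] with p hp
      have hs0 : 0 ≤ remSize η ψ N φ p.1 := Real.sqrt_nonneg _
      by_cases hA : p ∈ {p : Space d × ℝ | 0 < η p.1 - p.2 ∧ ((n : ℝ) + 1) * (η p.1 - p.2) ≤ 2}
      · rw [norm_smul, Real.norm_eq_abs]
        calc |remainder η ψ N φ p| * ‖fullGrad (depthCutoff η n) p‖
            ≤ (√(η p.1 - p.2) * remSize η ψ N φ p.1) * (C * (n + 1)) :=
              mul_le_mul (hp p.2) (hC n p) (norm_nonneg _) (by positivity)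
          _ ≤ (√(2 / (n + 1)) * remSize η ψ N φ p.1) * (C * (n + 1)) := by
              gcongr
              rw [le_div_iff₀ hn]
              linarith [hA.2]
          _ = _ := by ring
      · rw [S.remainder_smul_fullGrad_eq_zero hA, norm_zero]
        positivity
    · intro p hp
      refine S.remainder_smul_fullGrad_eq_zero fun hA => ?_
      rw [abs_sub_comm, abs_of_pos hA.1, div_lt_iff₀ hn] at hp
      linarith [hA.2]
  have hbound : ∀ᵐ x, ∀ n y, |depthCutoff η n (x, y) * remainder η ψ N φ (x, y)| ≤
      √(1 + |y|) * (√(1 + K) * remSize η ψ N φ x) := by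
    filter_upwards [S.ae_abs_remainder_le] with x hx n y
    rw [abs_mul]
    refine (mul_le_of_le_one_left (abs_nonneg _) (abs_depthCutoff_le η n _)).trans
      ((hx y).trans ?_)
    rw [← mul_assoc, ← Real.sqrt_mul (by positivity)]
    refine mul_le_mul_of_nonneg_right (Real.sqrt_le_sqrt ?_) (Real.sqrt_nonneg _)
    have h1 := (le_abs_self _).trans (hK x)
    have h2 := neg_le_abs y
    nlinarith [abs_nonneg y, mul_nonneg hK0 (abs_nonneg y)]
  have hWm : MemLp (fun x => √(1 + K) * remSize η ψ N φ x) 2 volume := S.memLp_remSize.const_mul _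
  have hlim1 : ∀ p ∈ fluidDomain η, ∀ᶠ n : ℕ in atTop, 2 < ((n : ℝ) + 1) * (η p.1 - p.2) :=
    fun p hp => by
      have hpos : 0 < η p.1 - p.2 := sub_pos.2 hp
      filter_upwards [eventually_ge_atTop ⌈2 / (η p.1 - p.2)⌉₊] with n hn
      have h1 := (Nat.le_ceil (2 / (η p.1 - p.2))).trans (Nat.cast_le.2 hn)
      rw [div_le_iff₀ hpos] at h1
      linarith
  have hlim2 : ∀ p ∈ fluidDomain η, Tendsto (fun n => depthCutoff η n p) atTop (𝓝 1) :=
    fun p hp => by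
      refine tendsto_const_nhds.congr' ?_
      filter_upwards [hlim1 p hp] with n hn
      exact (depthCutoff_eventuallyEq_one hηc hn).eq_of_nhds.symm
  refine D.weakTest_of_approx S.memLp_remGrad
    (w := fun n p => depthCutoff η n p * remainder η ψ N φ p)
    (fun n => (S.contDiff_depthCutoff_mul n).continuous) (fun n => ?_)
    (c := fun n => depthCutoff η n) hcc (abs_depthCutoff_le η) (fun p => ?_)
    (fun n => (hh n).1) (fun n => (hh n).2)
    -- Strict positivity of the depth matters: with points of the graph excluded, every point leaves
    -- these sets eventually.
    (A := fun n => {p : Space d × ℝ | 0 < η p.1 - p.2 ∧ ((n : ℝ) + 1) * (η p.1 - p.2) ≤ 2})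
    (fun n => ?_) (fun n p hp => S.remainder_smul_fullGrad_eq_zero hp) (fun p => ?_)
    (S.fullGrad_depthCutoff_mul) hWm hbound (fun p => ?_)
  · refine D.weakTest_smooth (S.contDiff_depthCutoff_mul n) ?_ hWm
      (hbound.mono fun x hx y => hx n y)
    have : fullGrad (fun p => depthCutoff η n p * remainder η ψ N φ p) = fun p =>
        depthCutoff η n p • remGrad η ψ N φ p +
          remainder η ψ N φ p • fullGrad (depthCutoff η n) p :=
      funext (S.fullGrad_depthCutoff_mul n)
    rw [this]
    refine MemLp.add ?_ (hh n).1
    refine S.memLp_remGrad.of_le ((hcc n).aestronglyMeasurable.smul S.memLp_remGrad.1)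
      (ae_of_all _ fun p => ?_)
    rw [norm_smul, Real.norm_eq_abs]
    exact mul_le_of_le_one_left (norm_nonneg _) (abs_depthCutoff_le η n p)
  · by_cases hp : p ∈ fluidDomain η
    · exact Or.inr (hlim2 p hp)
    · left
      rw [remGrad, indicator_of_notMem hp]
  · have hm : Measurable fun p : Space d × ℝ => η p.1 - p.2 := by
      exact ((hηc.comp continuous_fst).sub continuous_snd).measurable
    exact (measurableSet_lt measurable_const hm).inter
      (measurableSet_le (hm.const_mul _) measurable_const)
  · by_cases hp : p ∈ fluidDomain η
    · filter_upwards [hlim1 p hp] with n hn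
      exact fun h => absurd h.2 (not_le.2 hn)
    · exact Eventually.of_forall fun n h => hp (sub_pos.1 h.1)
  · by_cases hp : p ∈ fluidDomain η
    · simpa using (hlim2 p hp).mul_const (remainder η ψ N φ p)
    · simp [remainder, hp]

end SliceData

/-! ### Vertical translations of the remainder -/

/-- The mean square over the line of an integral over a window of length `δ`. -/
theorem integral_sq_window_le {h : ℝ → ℝ} (hh : MemLp h 2 volume) {δ : ℝ} (hδ : 0 ≤ δ)
    {D : ℝ → ℝ} (hD : ∀ y, D y = ∫ σ in (y - δ)..y, h σ) :
    Integrable (fun y => D y ^ 2) ∧ ∫ y, D y ^ 2 ≤ δ ^ 2 * ∫ y, h y ^ 2 := by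
  have hint : ∀ a b : ℝ, IntervalIntegrable h volume a b := fun a b =>
    ((hh.locallyIntegrable (by norm_num)).integrableOn_isCompact isCompact_uIcc).intervalIntegrable
  -- By Cauchy–Schwarz, D(y)² is at most δ times the integral of h² over the window. That integral
  -- is the convolution of h² with the indicator of [0, δ), whose total integral is δ ∫ h².
  have hf : Integrable ((Ico 0 δ).indicator (fun _ => (1 : ℝ))) volume :=
    (integrable_indicator_iff measurableSet_Ico).2 (integrableOn_const (by simp))
  have hc := hf.integrable_convolution (ContinuousLinearMap.mul ℝ ℝ) hh.integrable_sq
  have hi := integral_convolution (ContinuousLinearMap.mul ℝ ℝ) (μ := volume) (ν := volume) hf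
    hh.integrable_sq
  have hval : ∀ y, convolution ((Ico 0 δ).indicator (fun _ => (1 : ℝ))) (fun y => h y ^ 2)
      (ContinuousLinearMap.mul ℝ ℝ) volume y = ∫ σ in Ioc (y - δ) y, h σ ^ 2 := fun y => by
    rw [convolution_def, ← integral_sub_left_eq_self _ volume y,
      ← integral_indicator measurableSet_Ioc]
    refine integral_congr_ae (ae_of_all _ fun σ => ?_)
    by_cases hσ : σ ∈ Ioc (y - δ) y
    · have : y - σ ∈ Ico 0 δ := ⟨by linarith [hσ.2], by linarith [hσ.1]⟩
      simp [hσ, this]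
    · have : y - σ ∉ Ico 0 δ := fun h => hσ ⟨by linarith [h.2], by linarith [h.1]⟩
      simp [hσ, this]
  have hle : ∀ y, D y ^ 2 ≤ δ * convolution ((Ico 0 δ).indicator (fun _ => (1 : ℝ)))
      (fun y => h y ^ 2) (ContinuousLinearMap.mul ℝ ℝ) volume y := fun y => by
    rw [hval, hD]
    have := sq_intervalIntegral_le hh (a := y - δ) (b := y) (by linarith)
    simpa using this
  have hDc : Continuous D := by
    have h1 : Continuous fun y => ∫ σ in (0 : ℝ)..y, h σ :=
      intervalIntegral.continuous_primitive hint 0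
    have h2 : D = fun y => (∫ σ in (0 : ℝ)..y, h σ) - ∫ σ in (0 : ℝ)..(y - δ), h σ := by
      ext y
      rw [hD, intervalIntegral.integral_interval_sub_left (hint _ _) (hint _ _)]
    rw [h2]
    exact h1.sub (h1.comp (continuous_id.sub continuous_const))
  have hI : Integrable (fun y => D y ^ 2) := by
    refine (hc.const_mul δ).mono' (hDc.pow 2).aestronglyMeasurable (ae_of_all _ fun y => ?_)
    rw [Real.norm_of_nonneg (sq_nonneg _)]
    exact hle y
  refine ⟨hI, (integral_mono hI (hc.const_mul δ) hle).trans (le_of_eq ?_)⟩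
  rw [integral_const_mul, hi, integral_indicator measurableSet_Ico]
  simp [hδ]
  ring

namespace SliceData

variable {η ψ N : Space d → ℝ} {φ : Space d × ℝ → ℝ}

/-- The remainder is controlled in L² only on horizontal slabs, since its bound grows like √|y|; the
source vanishes outside such a slab. -/
theorem integrable_source_mul_remainder (S : SliceData η ψ N φ) (δ : ℝ) :
    Integrable (fun p => remSource η ψ N p * remainder η ψ N φ (p + (0, δ))) := by
  obtain ⟨R, hR⟩ := S.weakData_remainder.supp
  obtain ⟨K, hK0, hK⟩ := S.exists_bound_eta
  have hms : MeasurableSet {p : Space d × ℝ | |p.2| ≤ R} :=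
    measurableSet_le (measurable_snd.abs) measurable_const
  have h1 : MemLp ({p : Space d × ℝ | |p.2| ≤ R}.indicator
      fun p => remainder η ψ N φ (p + (0, δ))) 2 volume := by
    refine memLp_prod_of_slab_bound (W := fun x => √(K + R + |δ|) * remSize η ψ N φ x) (R := R)
      ?_ (S.memLp_remSize.const_mul _) ?_ ?_
    · exact (S.aestronglyMeasurable_remainder.comp_measurePreserving
        (measurePreserving_add_right volume ((0 : Space d), δ))).indicator hms
    · have hbd' : ∀ᵐ p : Space d × ℝ, ∀ y,
          |remainder η ψ N φ (p.1, y)| ≤ √(η p.1 - y) * remSize η ψ N φ p.1 :=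
        Measure.quasiMeasurePreserving_fst.ae S.ae_abs_remainder_le
      filter_upwards [hbd'] with p hp
      have hs0 : 0 ≤ remSize η ψ N φ p.1 := Real.sqrt_nonneg _
      by_cases hpR : p ∈ {p : Space d × ℝ | |p.2| ≤ R}
      · rw [indicator_of_mem hpR, Real.norm_eq_abs]
        have h2 := hp (p.2 + δ)
        have h3 : p + (0, δ) = (p.1, p.2 + δ) := by ext <;> simp
        rw [h3]
        refine h2.trans (mul_le_mul_of_nonneg_right (Real.sqrt_le_sqrt ?_) hs0)
        have h4 : |p.2| ≤ R := hpR
        linarith [(abs_le.1 (hK p.1)).2, (abs_le.1 h4).1, neg_abs_le δ]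
      · rw [indicator_of_notMem hpR, norm_zero]
        positivity
    · intro p hp
      exact indicator_of_notMem (by simpa using hp) _
  have h2 := S.memLp_remSource.integrable_mul h1
  refine h2.congr (ae_of_all _ fun p => ?_)
  by_cases hpR : p ∈ {p : Space d × ℝ | |p.2| ≤ R}
  · simp [hpR]
  · have : R < |p.2| := by simpa using hpR
    simp [hR p this]

/-- Test the translated equation of the remainder with the remainder itself, then move the
translation from the source to the test function. -/
theorem integral_inner_translate (S : SliceData η ψ N φ) (δ : ℝ) :
    ∫ p, inner ℝ (remGrad η ψ N φ (p + (0, δ))) (remGrad η ψ N φ p) =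
      ∫ p, remSource η ψ N p * remainder η ψ N φ (p + (0, -δ)) := by
  have h := S.weakTest_remainder (S.weakData_remainder.translate δ)
  simp only [WeakTest, zero_mul, integral_zero, zero_add] at h
  rw [h, ← integral_add_right_eq_self _ ((0 : Space d), -δ)]
  have hz : ∀ p : Space d × ℝ, p + (0, -δ) + (0, δ) = p := fun p => by ext <;> simp
  simp only [hz]

/-- The increments of the gradient of the remainder in the vertical direction are controlled by
the source term. -/
theorem integral_sq_translate_sub_le (S : SliceData η ψ N φ) {δ : ℝ} (hδ : 0 < δ) :
    ∫ p, ‖remGrad η ψ N φ (p + (0, δ)) - remGrad η ψ N φ p‖ ^ 2 ≤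
      δ ^ 2 * ∫ p, remSource η ψ N p ^ 2 := by
  set Q := remGrad η ψ N φ with hQ
  set u := remainder η ψ N φ with hu
  set F := remSource η ψ N with hF
  have hQm : MemLp Q 2 volume := S.memLp_remGrad
  have hQδ : MemLp (fun p => Q (p + (0, δ))) 2 volume :=
    hQm.comp_measurePreserving (measurePreserving_add_right volume (0, δ))
  have i0 := S.integrable_source_mul_remainder 0
  have i1 := S.integrable_source_mul_remainder δ
  have i2 := S.integrable_source_mul_remainder (-δ)
  have e0 := S.integral_inner_translate 0
  have e1 := S.integral_inner_translate δ
  have e2 := S.integral_inner_translate (-δ)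
  simp only [neg_neg, neg_zero] at e0 e2
  have hz : ∀ p : Space d × ℝ, p + (0, (0 : ℝ)) = p := fun p => by ext <;> simp
  simp only [hz] at e0 i0
  rw [← integral_add_right_eq_self _ ((0 : Space d), δ)] at e2
  have hz2 : ∀ p : Space d × ℝ, p + (0, δ) + (0, -δ) = p := fun p => by ext <;> simp
  simp only [hz2] at e2
  have e2' : ∫ p, inner ℝ (Q (p + (0, δ))) (Q p) = ∫ p, F p * u (p + (0, δ)) := by
    rw [← e2]
    exact integral_congr_ae (ae_of_all _ fun p => real_inner_comm _ _)
  -- Expanding the square and using the pairings at shifts 0, δ and -δ turns the left side into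
  -- minus the source paired with the second vertical difference of u.
  have hsq : ∫ p, ‖Q (p + (0, δ)) - Q p‖ ^ 2 =
      ∫ p, -(F p * (u (p + (0, δ)) - u p - (u p - u (p + (0, -δ))))) := by
    have j0 := MemLp.integrable_sq_norm hQm
    have j1 := MemLp.integrable_sq_norm hQδ
    have j2 := integrable_inner_of_memLp hQδ hQm
    have k0 : ∫ p, ‖Q (p + (0, δ))‖ ^ 2 = ∫ p, ‖Q p‖ ^ 2 :=
      integral_add_right_eq_self (fun p => ‖Q p‖ ^ 2) ((0 : Space d), δ)
    have k1 : ∫ p, ‖Q p‖ ^ 2 = ∫ p, F p * u p := by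
      rw [← e0]
      exact integral_congr_ae (ae_of_all _ fun p => (real_inner_self_eq_norm_sq _).symm)
    have l1 : ∫ p, ‖Q (p + (0, δ)) - Q p‖ ^ 2 =
        ∫ p, (‖Q (p + (0, δ))‖ ^ 2 + ‖Q p‖ ^ 2 - 2 * inner ℝ (Q (p + (0, δ))) (Q p)) :=
      integral_congr_ae (ae_of_all _ fun p => by
        simp only
        rw [norm_sub_sq_real]
        ring)
    have l2 : ∫ p, -(F p * (u (p + (0, δ)) - u p - (u p - u (p + (0, -δ))))) =
        ∫ p, (2 * (F p * u p) - F p * u (p + (0, δ)) - F p * u (p + (0, -δ))) :=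
      integral_congr_ae (ae_of_all _ fun p => by
        simp only
        ring)
    rw [l1, l2, integral_sub (by exact j1.add j0) (j2.const_mul 2), integral_add j1 j0, k0,
      integral_sub (by exact (i0.const_mul 2).sub i1) i2, integral_sub (i0.const_mul 2) i1,
      integral_const_mul, integral_const_mul, ← e1, ← e2', k1]
    ring
  have hFD : Integrable fun p => -(F p * (u (p + (0, δ)) - u p - (u p - u (p + (0, -δ))))) := by
    refine (((i0.const_mul 2).sub i1).sub i2).congr (ae_of_all _ fun p => ?_)
    simp only [Pi.sub_apply]
    ring
  have hF2 : Integrable fun p => F p ^ 2 := S.memLp_remSource.integrable_sq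
  have hd2 := MemLp.integrable_sq_norm (hQδ.sub hQm)
  have hh : MemLp (fun p => (Q (p + (0, δ))).snd - (Q p).snd) 2 volume :=
    (S.memLp_remY.comp_measurePreserving (measurePreserving_add_right volume (0, δ))).sub S.memLp_remY
  have hh2 := hh.integrable_sq
  have hle : ∫ p, ((Q (p + (0, δ))).snd - (Q p).snd) ^ 2 ≤ ∫ p, ‖Q (p + (0, δ)) - Q p‖ ^ 2 := by
    refine integral_mono hh2 hd2 fun p => ?_
    have := norm_snd_gradSpace_le (Q (p + (0, δ)) - Q p)
    exact sq_le_sq.2 (by simpa using this)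
  -- Young's inequality with weight δ leaves half of the squared increment of the vertical
  -- derivative, which is absorbed by the left side of `hsq` through `hle`. It is applied on
  -- vertical lines, where the second difference is known to be square integrable.
  have key : ∫ p, -(F p * (u (p + (0, δ)) - u p - (u p - u (p + (0, -δ))))) ≤
      ∫ p, (1 / 2 * (δ ^ 2 * F p ^ 2) + 1 / 2 * ((Q (p + (0, δ))).snd - (Q p).snd) ^ 2) := by
    have hr : Integrable fun p =>
        1 / 2 * (δ ^ 2 * F p ^ 2) + 1 / 2 * ((Q (p + (0, δ))).snd - (Q p).snd) ^ 2 :=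
      ((hF2.const_mul _).const_mul _).add (hh2.const_mul _)
    have hF2' := hF2
    have hFD' := hFD
    have hr' := hr
    rw [Measure.volume_eq_prod] at hF2' hFD' hr'
    rw [Measure.volume_eq_prod, integral_prod _ hFD', integral_prod _ hr']
    refine integral_mono_ae hFD'.integral_prod_left hr'.integral_prod_left ?_
    filter_upwards [hF2'.prod_right_ae, hFD'.prod_right_ae, S.ae_memLp_vertical,
      S.ae_remainder_sub] with x x1 x2 x3 x4
    have m1 : MemLp (fun y => (Q (x, y + δ)).snd - (Q (x, y)).snd) 2 volume :=
      (x3.comp_measurePreserving (measurePreserving_add_right volume δ)).sub x3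
    have hint : ∀ a b : ℝ, IntervalIntegrable (fun y => (Q (x, y)).snd) volume a b := fun a b =>
      ((x3.locallyIntegrable (by norm_num)).integrableOn_isCompact
        isCompact_uIcc).intervalIntegrable
    -- The second difference of u is the integral of the increment of ∂_y u over the window [y - δ,
    -- y], so it is smaller than that increment by a factor δ in L².
    obtain ⟨w1, w2⟩ := integral_sq_window_le m1 hδ.le
      (D := fun y => u (x, y + δ) - u (x, y) - (u (x, y) - u (x, y - δ))) fun y => by
        rw [x4, x4, intervalIntegral.integral_sub, intervalIntegral.integral_comp_add_right
          (fun y => (Q (x, y)).snd), sub_add_cancel]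
        · simpa using (hint (y - δ + δ) (y + δ)).comp_add_right δ
        · exact hint _ _
    have hadd : ∀ y a : ℝ, ((x, y) : Space d × ℝ) + (0, a) = (x, y + a) := fun y a => by
      ext <;> simp
    simp only [hadd, ← sub_eq_add_neg] at x2 ⊢
    have m2 := m1.integrable_sq
    calc ∫ y, -(F (x, y) * (u (x, y + δ) - u (x, y) - (u (x, y) - u (x, y - δ))))
        ≤ ∫ y, (1 / 2 * (δ ^ 2 * F (x, y) ^ 2) +
            1 / 2 * ((δ ^ 2)⁻¹ * (u (x, y + δ) - u (x, y) - (u (x, y) - u (x, y - δ))) ^ 2)) := by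
          refine integral_mono x2 (((x1.const_mul _).const_mul _).add
            ((w1.const_mul _).const_mul _)) fun y => ?_
          have hD : (0 : ℝ) < δ ^ 2 := by positivity
          have h3 := sq_nonneg (δ * F (x, y) +
            δ⁻¹ * (u (x, y + δ) - u (x, y) - (u (x, y) - u (x, y - δ))))
          have h4 : δ * δ⁻¹ = 1 := mul_inv_cancel₀ hδ.ne'
          simp only
          rw [← inv_pow]
          linear_combination (1 / 2) * h3 + (F (x, y) *
            (u (x, y + δ) - u (x, y) - (u (x, y) - u (x, y - δ)))) * h4
      _ = 1 / 2 * (δ ^ 2 * ∫ y, F (x, y) ^ 2) + 1 / 2 * ((δ ^ 2)⁻¹ *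
            ∫ y, (u (x, y + δ) - u (x, y) - (u (x, y) - u (x, y - δ))) ^ 2) := by
          rw [integral_add ((x1.const_mul _).const_mul _) ((w1.const_mul _).const_mul _)]
          simp only [integral_const_mul]
      _ ≤ 1 / 2 * (δ ^ 2 * ∫ y, F (x, y) ^ 2) + 1 / 2 * ((δ ^ 2)⁻¹ *
            (δ ^ 2 * ∫ y, ((Q (x, y + δ)).snd - (Q (x, y)).snd) ^ 2)) := by gcongr
      _ = _ := by
          rw [integral_add ((x1.const_mul _).const_mul _) (m2.const_mul _)]
          simp only [integral_const_mul]
          field_simp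
  rw [integral_add ((hF2.const_mul _).const_mul _) (hh2.const_mul _)] at key
  simp only [integral_const_mul] at key
  linarith [hsq]

theorem remGrad_of_le {x : Space d} {y : ℝ} (h : η x ≤ y) : remGrad η ψ N φ (x, y) = 0 := by
  have hn : (x, y) ∉ fluidDomain η := not_lt.2 h
  rw [remGrad, indicator_of_notMem hn]

/-- The gradient of the remainder is small near the graph. -/
theorem setIntegral_shell_le (S : SliceData η ψ N φ) {δ : ℝ} (hδ : 0 < δ) :
    ∫ p in {p : Space d × ℝ | η p.1 - δ ≤ p.2}, ‖remGrad η ψ N φ p‖ ^ 2 ≤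
      δ ^ 2 * ∫ p, remSource η ψ N p ^ 2 := by
  refine le_trans ?_ (S.integral_sq_translate_sub_le hδ)
  have hηc := S.eta.smooth.continuous
  have hms : MeasurableSet {p : Space d × ℝ | η p.1 - δ ≤ p.2} :=
    measurableSet_le ((hηc.comp continuous_fst).sub continuous_const).measurable measurable_snd
  have hQδ : MemLp (fun p => remGrad η ψ N φ (p + (0, δ))) 2 volume :=
    S.memLp_remGrad.comp_measurePreserving (measurePreserving_add_right volume (0, δ))
  have hd2 := MemLp.integrable_sq_norm (hQδ.sub S.memLp_remGrad)
  refine le_trans (le_of_eq ?_) (setIntegral_le_integral (s := {p : Space d × ℝ | η p.1 - δ ≤ p.2})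
    hd2 (ae_of_all _ fun p => by positivity))
  refine setIntegral_congr_fun hms fun p hp => ?_
  have hp' : η p.1 - δ ≤ p.2 := hp
  have h1 : p + (0, δ) = (p.1, p.2 + δ) := by ext <;> simp
  -- Raising a point of the shell by δ brings it onto or above the graph, so on the shell the
  -- increment is just minus the gradient itself.
  have h2 : remGrad η ψ N φ (p + (0, δ)) = 0 := by
    rw [h1]
    exact remGrad_of_le (by linarith)
  simp only [h2, zero_sub, norm_neg]

end SliceData

/-! ### Comparison of the energies of two slices -/

namespace SliceData

variable {η ψ N : Space d → ℝ} {φ : Space d × ℝ → ℝ}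

theorem indicator_fullGrad_phi_eq (η ψ N : Space d → ℝ) (φ : Space d × ℝ → ℝ) (p : Space d × ℝ) :
    (fluidDomain η).indicator (fullGrad φ) p =
      (fluidDomain η).indicator (fullGrad (chi η ψ N)) p + remGrad η ψ N φ p := by
  simp only [remGrad_eq, add_sub_cancel]

/-- The kinetic energy is the Dirichlet energy. -/
theorem integral_mul_eq (S : SliceData η ψ N φ) :
    ∫ x, N x * ψ x = ∫ p, ‖(fluidDomain η).indicator (fullGrad φ) p‖ ^ 2 := by
  -- φ is tested against itself as χ + u: χ contributes the trace ψ, and u contributes nothing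
  -- because it vanishes on the graph.
  have h1 := S.goodExt.weakTest S.weakData_phi
  have h2 := S.weakTest_remainder S.weakData_phi
  have hg : ∀ x, chi η ψ N (x, η x) = ψ x := cauchyExt_graph η ψ _
  simp only [WeakTest, zero_mul, integral_zero, add_zero, hg] at h1
  simp only [WeakTest, zero_mul, integral_zero, add_zero, remainder_of_le le_rfl, mul_zero] at h2
  rw [← h1, ← add_zero (∫ p, inner ℝ _ _), ← h2, ← integral_add
    (integrable_inner_of_memLp S.memLp_fullGrad_phi S.goodExt.memLp_fullGrad)
    (integrable_inner_of_memLp S.memLp_fullGrad_phi S.memLp_remGrad)]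
  refine integral_congr_ae (ae_of_all _ fun p => ?_)
  simp only
  rw [← real_inner_self_eq_norm_sq]
  by_cases hp : p ∈ fluidDomain η
  · simp only [indicator_of_mem hp, remGrad, inner_sub_right]
    ring
  · simp [hp]

/-- The part of the Dirichlet energy density that involves the remainder. -/
def remDensity (η ψ N : Space d → ℝ) (φ : Space d × ℝ → ℝ) (p : Space d × ℝ) : ℝ :=
  2 * inner ℝ (fullGrad (chi η ψ N) p) (remGrad η ψ N φ p) + ‖remGrad η ψ N φ p‖ ^ 2

theorem integrable_remDensity (S : SliceData η ψ N φ) : Integrable (remDensity η ψ N φ) :=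
  ((integrable_inner_of_memLp S.goodExt.memLp_fullGrad S.memLp_remGrad).const_mul 2).add
    (MemLp.integrable_sq_norm S.memLp_remGrad)

theorem integrable_sq_fullGrad_chi (S : SliceData η ψ N φ) :
    Integrable fun p => ‖fullGrad (chi η ψ N) p‖ ^ 2 :=
  MemLp.integrable_sq_norm S.goodExt.memLp_fullGrad

theorem integral_mul_eq_add (S : SliceData η ψ N φ) :
    ∫ x, N x * ψ x =
      (∫ p in fluidDomain η, ‖fullGrad (chi η ψ N) p‖ ^ 2) + ∫ p, remDensity η ψ N φ p := by
  rw [S.integral_mul_eq, ← integral_indicator S.isOpen_dom.measurableSet,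
    ← integral_add (S.integrable_sq_fullGrad_chi.indicator S.isOpen_dom.measurableSet)
      S.integrable_remDensity]
  refine integral_congr_ae (ae_of_all _ fun p => ?_)
  simp only
  rw [indicator_fullGrad_phi_eq η ψ N φ p]
  by_cases hp : p ∈ fluidDomain η
  · simp only [indicator_of_mem hp, remDensity, norm_add_sq_real]
    ring
  · simp [hp, remDensity, remGrad]

/-- Dirichlet principle: |∇φ'|² ≥ 2∇φ'·∇v - |∇v|² is integrated over the second domain with v = χ +
u taken from the first slice, and the cross term is evaluated by Green's formula for φ'. The
competitor is admissible there because u, extended by zero, is a test object for any weak datum. -/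
theorem integral_mul_ge (S : SliceData η ψ N φ) {η' ψ' N' : Space d → ℝ} {φ' : Space d × ℝ → ℝ}
    (S' : SliceData η' ψ' N' φ') :
    2 * (∫ x, N' x * chi η ψ N (x, η' x)) + 2 * (∫ x, N' x * remainder η ψ N φ (x, η' x)) -
      (∫ p in fluidDomain η', ‖fullGrad (chi η ψ N) p‖ ^ 2) -
      (∫ p in fluidDomain η', remDensity η ψ N φ p) ≤ ∫ x, N' x * ψ' x := by
  have h1 := S.goodExt.weakTest S'.weakData_phi
  have h2 := S.weakTest_remainder S'.weakData_phi
  simp only [WeakTest, zero_mul, integral_zero, add_zero] at h1 h2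
  have hm := S'.isOpen_dom.measurableSet
  have j1 := MemLp.integrable_sq_norm S'.memLp_fullGrad_phi
  have j2 := integrable_inner_of_memLp S'.memLp_fullGrad_phi S.goodExt.memLp_fullGrad
  have j3 := integrable_inner_of_memLp S'.memLp_fullGrad_phi S.memLp_remGrad
  have j4 := S.integrable_sq_fullGrad_chi.indicator hm
  have j5 := S.integrable_remDensity.indicator hm
  rw [S'.integral_mul_eq, ← h1, ← h2, ← integral_indicator hm, ← integral_indicator hm,
    ← integral_const_mul, ← integral_const_mul,
    ← integral_add (j2.const_mul 2) (j3.const_mul 2),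
    ← integral_sub (by exact (j2.const_mul 2).add (j3.const_mul 2)) j4,
    ← integral_sub (by exact ((j2.const_mul 2).add (j3.const_mul 2)).sub j4) j5]
  refine integral_mono ((((j2.const_mul 2).add (j3.const_mul 2)).sub j4).sub j5) j1 fun p => ?_
  by_cases hp : p ∈ fluidDomain η'
  · simp only [indicator_of_mem hp, remDensity]
    have h := sq_nonneg ‖fullGrad φ' p - (fullGrad (chi η ψ N) p + remGrad η ψ N φ p)‖
    rw [norm_sub_sq_real, norm_add_sq_real, inner_add_right] at h
    linarith
  · simp [hp]

theorem measurableSet_shell (S : SliceData η ψ N φ) (ρ : ℝ) :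
    MeasurableSet {p : Space d × ℝ | η p.1 - ρ ≤ p.2} :=
  measurableSet_le ((S.eta.smooth.continuous.comp continuous_fst).sub
    continuous_const).measurable measurable_snd

/-- The density vanishes outside the first domain, so what is lost lies in the layer of depth ρ
below its graph. There ∇χ has L² norm of order √ρ and ∇u of order ρ, so the cross term is
O(ρ^{3/2}); the purely quadratic term is O(ρ²). -/
theorem setIntegral_compl_remDensity_ge (S : SliceData η ψ N φ) {W : Space d → ℝ}
    (hW : MemLp W 2 volume) (hχ : ∀ p, ‖fullGrad (chi η ψ N) p‖ ≤ W p.1) {ρ : ℝ} (hρ : 0 < ρ)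
    (hρ1 : ρ ≤ 1) {η' : Space d → ℝ} (hc : Continuous η') (hη : ∀ x, |η' x - η x| ≤ ρ) :
    (∫ p in fluidDomain η', remDensity η ψ N φ p) ≤ (∫ p, remDensity η ψ N φ p) +
      ρ * √ρ * (2 * (∫ x, W x ^ 2) + 2 * ∫ p, remSource η ψ N p ^ 2) := by
  have hm := (isOpen_fluidDomain hc).measurableSet
  have hms := S.measurableSet_shell ρ
  set M := {p : Space d × ℝ | η p.1 - ρ ≤ p.2} with hM
  set f := (M ∩ fluidDomain η).indicator (fullGrad (chi η ψ N)) with hf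
  have hW0 : ∀ p : Space d × ℝ, 0 ≤ W p.1 := fun p => (norm_nonneg _).trans (hχ p)
  obtain ⟨f1, f2⟩ := memLp_of_shell_bound (f := f) (R := ρ) (ζ := η) (W := W)
    (S.goodExt.memLp_fullGrad.1.indicator (hms.inter S.isOpen_dom.measurableSet)) hW
    S.eta.smooth.continuous hρ.le
    (ae_of_all _ fun p => (norm_indicator_le_norm_self _ _).trans (hχ p)) (fun p hp => by
      refine indicator_of_notMem (fun h => ?_) _
      have h1 : η p.1 - ρ ≤ p.2 := h.1
      have h2 : p.2 < η p.1 := h.2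
      rw [abs_sub_comm, abs_of_pos (sub_pos.2 h2)] at hp
      linarith)
  have h3 := S.setIntegral_shell_le hρ
  rw [← hM, ← integral_indicator hms] at h3
  have i1 := MemLp.integrable_sq_norm f1
  have i2 := (MemLp.integrable_sq_norm S.memLp_remGrad).indicator hms
  have h4 := integral_add_compl hm S.integrable_remDensity
  have hs : 0 < √ρ := Real.sqrt_pos.2 hρ
  have hss : √ρ * √ρ = ρ := Real.mul_self_sqrt hρ.le
  have hs1 : √ρ ≤ 1 := Real.sqrt_le_one.2 hρ1
  have h5 : ‖∫ p in (fluidDomain η')ᶜ, remDensity η ψ N φ p‖ ≤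
      ∫ p, (√ρ * ‖f p‖ ^ 2 +
        ((√ρ)⁻¹ + 1) * M.indicator (fun p => ‖remGrad η ψ N φ p‖ ^ 2) p) := by
    rw [← integral_indicator hm.compl]
    refine norm_integral_le_of_norm_le ((i1.const_mul _).add (i2.const_mul _))
      (ae_of_all _ fun p => ?_)
    by_cases hp : p ∈ M ∩ fluidDomain η
    · refine (norm_indicator_le_norm_self _ _).trans ?_
      rw [hf, indicator_of_mem hp, indicator_of_mem hp.1, remDensity, Real.norm_eq_abs]
      have a1 := abs_real_inner_le_norm (fullGrad (chi η ψ N) p) (remGrad η ψ N φ p)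
      set a := ‖fullGrad (chi η ψ N) p‖
      set b := ‖remGrad η ψ N φ p‖
      -- With ∫ a² = O(ρ) and ∫ b² = O(ρ²) on the layer, this weight makes both terms O(ρ^{3/2}).
      have a2 : 2 * (a * b) ≤ √ρ * a ^ 2 + (√ρ)⁻¹ * b ^ 2 := by
        have a3 := mul_nonneg (inv_nonneg.2 hs.le) (sq_nonneg (√ρ * a - b))
        have a4 : (√ρ)⁻¹ * √ρ = 1 := inv_mul_cancel₀ hs.ne'
        linear_combination a3 + (√ρ * a ^ 2 - 2 * a * b) * a4
      calc |2 * inner ℝ (fullGrad (chi η ψ N) p) (remGrad η ψ N φ p) + b ^ 2|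
          ≤ |2 * inner ℝ (fullGrad (chi η ψ N) p) (remGrad η ψ N φ p)| + |b ^ 2| := abs_add_le _ _
        _ ≤ 2 * (a * b) + b ^ 2 := by
            rw [abs_mul, abs_two, abs_of_nonneg (sq_nonneg b)]
            linarith
        _ ≤ _ := by linarith
    · have hz : ((fluidDomain η')ᶜ).indicator (remDensity η ψ N φ) p = 0 := by
        by_cases hp' : p ∈ fluidDomain η'
        · simp [hp']
        · have h1 : p ∉ fluidDomain η := fun h => hp ⟨by
            have h2 : η' p.1 ≤ p.2 := not_lt.1 hp'
            have h3 := (abs_le.1 (hη p.1)).1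
            show η p.1 - ρ ≤ p.2
            linarith, h⟩
          have h2 : p ∈ (fluidDomain η')ᶜ := hp'
          rw [indicator_of_mem h2]
          simp [remDensity, remGrad, h1]
      rw [hz, norm_zero]
      have : 0 ≤ M.indicator (fun p => ‖remGrad η ψ N φ p‖ ^ 2) p :=
        indicator_nonneg (fun _ _ => by positivity) _
      positivity
  rw [integral_add (i1.const_mul _) (i2.const_mul _), integral_const_mul, integral_const_mul] at h5
  have h6 := neg_le_of_abs_le h5
  have hA : 0 ≤ ∫ p, remSource η ψ N p ^ 2 := integral_nonneg fun _ => sq_nonneg _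
  have h7 : √ρ * ∫ p, ‖f p‖ ^ 2 ≤ √ρ * (2 * ρ * ∫ x, W x ^ 2) := by gcongr
  have h8 : ((√ρ)⁻¹ + 1) * ∫ p, M.indicator (fun p => ‖remGrad η ψ N φ p‖ ^ 2) p ≤
      ((√ρ)⁻¹ + 1) * (ρ ^ 2 * ∫ p, remSource η ψ N p ^ 2) := by gcongr
  have h9 : ((√ρ)⁻¹ + 1) * ρ ^ 2 ≤ 2 * (ρ * √ρ) := by
    have e1 : (√ρ)⁻¹ * ρ ^ 2 = ρ * √ρ := by
      rw [inv_mul_eq_iff_eq_mul₀ hs.ne']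
      linear_combination (-ρ) * hss
    have e2 : ρ ^ 2 ≤ ρ * √ρ := by
      rw [sq]
      refine mul_le_mul_of_nonneg_left ?_ hρ.le
      nlinarith
    linarith
  have h10 := mul_le_mul_of_nonneg_right h9 hA
  linarith

/-- On the new graph, u² is at most ρ times the integral of |∇u|² over the layer portion of the
vertical line, so its trace has L² norm at most of order ρ^{3/2}. Young's inequality with matching
weights separates it from `N'`. -/
theorem abs_integral_mul_remainder_le (S : SliceData η ψ N φ) {ρ : ℝ} (hρ : 0 < ρ)
    {η' N' : Space d → ℝ} (hη : ∀ x, |η' x - η x| ≤ ρ) (hN : MemLp N' 2 volume) :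
    2 * |∫ x, N' x * remainder η ψ N φ (x, η' x)| ≤
      ρ * √ρ * ((∫ x, N' x ^ 2) + ∫ p, remSource η ψ N p ^ 2) := by
  have hms := S.measurableSet_shell ρ
  set M := {p : Space d × ℝ | η p.1 - ρ ≤ p.2} with hM
  have h3 := S.setIntegral_shell_le hρ
  rw [← hM, ← integral_indicator hms] at h3
  have i2 := (MemLp.integrable_sq_norm S.memLp_remGrad).indicator hms
  have i2' := i2
  rw [Measure.volume_eq_prod] at i2'
  have hs : 0 < √ρ := Real.sqrt_pos.2 hρ
  have hss : √ρ * √ρ = ρ := Real.mul_self_sqrt hρ.le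
  have hpt : ∀ᵐ x, ‖N' x * remainder η ψ N φ (x, η' x)‖ ≤ 1 / 2 * (ρ * √ρ * N' x ^ 2) +
      1 / 2 * ((√ρ)⁻¹ * ∫ y, M.indicator (fun p => ‖remGrad η ψ N φ p‖ ^ 2) (x, y)) := by
    filter_upwards [S.ae_sq_remainder_le, i2'.prod_right_ae, S.ae_memLp_vertical] with x h1 h2 h4
    have hI0 : 0 ≤ ∫ y, M.indicator (fun p => ‖remGrad η ψ N φ p‖ ^ 2) (x, y) :=
      integral_nonneg fun y => indicator_nonneg (fun _ _ => by positivity) _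
    have key : remainder η ψ N φ (x, η' x) ^ 2 ≤
        ρ * ∫ y, M.indicator (fun p => ‖remGrad η ψ N φ p‖ ^ 2) (x, y) := by
      rcases le_or_gt (η' x) (η x) with hx | hx
      · refine (h1 _ hx).trans ?_
        have hb : η x - η' x ≤ ρ := by linarith [(abs_le.1 (hη x)).1]
        refine mul_le_mul hb ?_ (integral_nonneg fun _ => sq_nonneg _) hρ.le
        rw [← integral_indicator measurableSet_Ioc]
        refine integral_mono (h4.integrable_sq.indicator measurableSet_Ioc) h2 fun y => ?_
        by_cases hy : y ∈ Ioc (η' x) (η x)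
        · have hyM : (x, y) ∈ M := by
            show η x - ρ ≤ y
            linarith [hy.1]
          rw [indicator_of_mem hy, indicator_of_mem hyM]
          have := norm_snd_gradSpace_le (remGrad η ψ N φ (x, y))
          exact sq_le_sq.2 (by simpa using this)
        · rw [indicator_of_notMem hy]
          exact indicator_nonneg (fun _ _ => by positivity) _
      · rw [remainder_of_le hx.le]
        have := mul_nonneg hρ.le hI0
        simpa using this
    set I := ∫ y, M.indicator (fun p => ‖remGrad η ψ N φ p‖ ^ 2) (x, y)
    set r := remainder η ψ N φ (x, η' x)
    rw [Real.norm_eq_abs, abs_mul]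
    have a3 := mul_nonneg (by positivity : (0 : ℝ) ≤ (√ρ)⁻¹ * ρ⁻¹)
      (sq_nonneg (ρ * √ρ * |N' x| - |r|))
    have a4 : (√ρ)⁻¹ * √ρ = 1 := inv_mul_cancel₀ hs.ne'
    have a5 : ρ⁻¹ * ρ = 1 := inv_mul_cancel₀ hρ.ne'
    have a6 : (√ρ)⁻¹ * ρ⁻¹ * r ^ 2 ≤ (√ρ)⁻¹ * I := by
      calc (√ρ)⁻¹ * ρ⁻¹ * r ^ 2 ≤ (√ρ)⁻¹ * ρ⁻¹ * (ρ * I) := by gcongr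
        _ = (√ρ)⁻¹ * I * (ρ⁻¹ * ρ) := by ring
        _ = _ := by rw [a5, mul_one]
    have a7 : (√ρ)⁻¹ * ρ⁻¹ * (ρ * √ρ * |N' x| - |r|) ^ 2 =
        ρ * √ρ * N' x ^ 2 - 2 * (|N' x| * |r|) + (√ρ)⁻¹ * ρ⁻¹ * r ^ 2 := by
      have : (√ρ)⁻¹ * ρ⁻¹ * (ρ * √ρ * |N' x| - |r|) ^ 2 =
        ((√ρ)⁻¹ * √ρ) * (ρ⁻¹ * ρ) * (ρ * √ρ * |N' x| ^ 2) -
          2 * (((√ρ)⁻¹ * √ρ) * (ρ⁻¹ * ρ)) * (|N' x| * |r|) + (√ρ)⁻¹ * ρ⁻¹ * |r| ^ 2 := by ring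
      rw [this, a4, a5, sq_abs, sq_abs]
      ring
    linarith
  have j1 := hN.integrable_sq
  have j2 := i2'.integral_prod_left
  have h5 := norm_integral_le_of_norm_le
    (((j1.const_mul (ρ * √ρ)).const_mul (1 / 2)).add ((j2.const_mul (√ρ)⁻¹).const_mul (1 / 2))) hpt
  rw [integral_add' ((j1.const_mul _).const_mul _) ((j2.const_mul _).const_mul _)] at h5
  simp only [integral_const_mul] at h5
  rw [← integral_prod _ i2', ← Measure.volume_eq_prod, Real.norm_eq_abs] at h5
  have h6 : (√ρ)⁻¹ * ∫ p, M.indicator (fun p => ‖remGrad η ψ N φ p‖ ^ 2) p ≤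
      (√ρ)⁻¹ * (ρ ^ 2 * ∫ p, remSource η ψ N p ^ 2) := by gcongr
  have e1 : (√ρ)⁻¹ * ρ ^ 2 = ρ * √ρ := by
    rw [inv_mul_eq_iff_eq_mul₀ hs.ne']
    linear_combination (-ρ) * hss
  rw [← mul_assoc, e1] at h6
  linarith

/-- Lower bound for the energy of a nearby slice, up to an error of order `ρ ^ (3 / 2)`. -/
theorem exists_energy_lower_bound (S : SliceData η ψ N φ) (B : ℝ) :
    ∃ K : ℝ, ∀ ρ, 0 < ρ → ρ ≤ 1 → ∀ (η' ψ' N' : Space d → ℝ) (φ' : Space d × ℝ → ℝ),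
      SliceData η' ψ' N' φ' → (∀ x, |η' x - η x| ≤ ρ) → ∫ x, N' x ^ 2 ≤ B →
      2 * (∫ x, N' x * chi η ψ N (x, η' x)) -
        (∫ p in fluidDomain η', ‖fullGrad (chi η ψ N) p‖ ^ 2) - (∫ p, remDensity η ψ N φ p) -
        ρ * √ρ * K ≤ ∫ x, N' x * ψ' x := by
  obtain ⟨W, hW, hχ⟩ := S.goodExt.fderiv_le
  refine ⟨(2 * (∫ x, W x ^ 2) + 2 * ∫ p, remSource η ψ N p ^ 2) +
    (B + ∫ p, remSource η ψ N p ^ 2), fun ρ h0 h1 η' ψ' N' φ' S' hη hB => ?_⟩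
  have e1 := S.integral_mul_ge S'
  have e2 := S.setIntegral_compl_remDensity_ge hW hχ h0 h1 S'.eta.smooth.continuous hη
  have e3 := S.abs_integral_mul_remainder_le h0 hη S'.nrm.memLp_self
  have e4 := neg_abs_le (∫ x, N' x * remainder η ψ N φ (x, η' x))
  have e5 : ρ * √ρ * ((∫ x, N' x ^ 2) + ∫ p, remSource η ψ N p ^ 2) ≤
      ρ * √ρ * (B + ∫ p, remSource η ψ N p ^ 2) := by gcongr
  linarith

end SliceData

/-! ### Differentiation in time -/

theorem IsSobolevSmooth.hasDerivAt_integral_mul {T : ℝ} (hT : 0 < T) {a b : ℝ → Space d → ℝ}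
    (ha : IsSobolevSmooth T a) (hb : IsSobolevSmooth T b) {t : ℝ} (ht : t ∈ Ioo 0 T) :
    HasDerivAt (fun s => ∫ x, a s x * b s x)
      ((∫ x, WaterWave.dt T a t x * b t x) + ∫ x, a t x * WaterWave.dt T b t x) t := by
  obtain ⟨A, hA, hA'⟩ := ha.exists_dominating hT
  obtain ⟨B, hB, hB'⟩ := hb.exists_dominating hT
  obtain ⟨A₁, hA₁, hA₁'⟩ := (ha.dt hT).exists_dominating hT
  obtain ⟨B₁, hB₁, hB₁'⟩ := (hb.dt hT).exists_dominating hT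
  have ht' : t ∈ Icc 0 T := Ioo_subset_Icc_self ht
  have m1 := (ha.tameL2 hT ht').memLp_self
  have m2 := (hb.tameL2 hT ht').memLp_self
  have m3 := ((ha.dt hT).tameL2 hT ht').memLp_self
  have m4 := ((hb.dt hT).tameL2 hT ht').memLp_self
  have h := hasDerivAt_integral_of_dominated_loc_of_deriv_le (μ := volume) (x₀ := t)
    (F := fun s x => a s x * b s x)
    (F' := fun s x => WaterWave.dt T a s x * b s x + a s x * WaterWave.dt T b s x)
    (bound := fun x => A₁ x * B x + A x * B₁ x) (isOpen_Ioo.mem_nhds ht)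
    (by
      filter_upwards [isOpen_Ioo.mem_nhds ht] with s hs
      have hs' : s ∈ Icc 0 T := Ioo_subset_Icc_self hs
      exact ((ha.contDiff_slice hs').continuous.mul
        (hb.contDiff_slice hs').continuous).aestronglyMeasurable)
    (m1.integrable_mul m2) ((m3.integrable_mul m2).add (m1.integrable_mul m4)).1
    (ae_of_all _ fun x s hs => by
      have hs' : s ∈ Icc 0 T := Ioo_subset_Icc_self hs
      rw [Real.norm_eq_abs]
      refine (abs_add_le _ _).trans ?_
      rw [abs_mul, abs_mul]
      exact add_le_add
        (mul_le_mul (hA₁' s hs' x) (hB' s hs' x) (abs_nonneg _)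
          ((abs_nonneg _).trans (hA₁' s hs' x)))
        (mul_le_mul (hA' s hs' x) (hB₁' s hs' x) (abs_nonneg _)
          ((abs_nonneg _).trans (hA' s hs' x))))
    ((hA₁.integrable_mul hB).add (hA.integrable_mul hB₁))
    (ae_of_all _ fun x s hs => (ha.hasDerivAt_dt hs x).mul (hb.hasDerivAt_dt hs x))
  have hadd := integral_add (m3.integrable_mul m2) (m1.integrable_mul m4)
  simp only [Pi.mul_apply] at hadd
  rw [← hadd]
  exact h.2

theorem IsSobolevSmooth.continuousOn_integral_mul {T : ℝ} (hT : 0 < T) {a b : ℝ → Space d → ℝ}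
    (ha : IsSobolevSmooth T a) (hb : IsSobolevSmooth T b) :
    ContinuousOn (fun s => ∫ x, a s x * b s x) (Icc 0 T) := by
  obtain ⟨A, hA, hA'⟩ := ha.exists_dominating hT
  obtain ⟨B, hB, hB'⟩ := hb.exists_dominating hT
  refine continuousOn_of_dominated (bound := fun x => A x * B x) (fun s hs => ?_)
    (fun s hs => ae_of_all _ fun x => ?_) (hA.integrable_mul hB) (ae_of_all _ fun x s hs => ?_)
  · exact ((ha.contDiff_slice hs).continuous.mul
      (hb.contDiff_slice hs).continuous).aestronglyMeasurable
  · rw [norm_mul]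
    exact mul_le_mul (hA' s hs x) (hB' s hs x) (norm_nonneg _)
      ((abs_nonneg _).trans (hA' s hs x))
  · exact (ha.hasDerivWithinAt_dt hs x).continuousWithinAt.mul
      (hb.hasDerivWithinAt_dt hs x).continuousWithinAt

theorem IsSobolevSmooth.hasDerivAt_integral_mul_comp {T : ℝ} (hT : 0 < T)
    {η N : ℝ → Space d → ℝ} (hη : IsSobolevSmooth T η) (hN : IsSobolevSmooth T N)
    {c : Space d × ℝ → ℝ} (hc : GoodExt c) {t : ℝ} (ht : t ∈ Ioo 0 T) :
    HasDerivAt (fun s => ∫ x, N s x * c (x, η s x))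
      ((∫ x, WaterWave.dt T N t x * c (x, η t x)) +
        ∫ x, N t x * (derivY c (x, η t x) * WaterWave.dt T η t x)) t := by
  obtain ⟨W, hW, hW'⟩ := hc.dom 0
  obtain ⟨V, hV, hV'⟩ := hc.fderiv_le
  obtain ⟨K, hK⟩ := (hη.dt hT).exists_bound hT
  obtain ⟨A, hA, hA'⟩ := hN.exists_dominating hT
  obtain ⟨A₁, hA₁, hA₁'⟩ := (hN.dt hT).exists_dominating hT
  have ht' : t ∈ Icc 0 T := Ioo_subset_Icc_self ht
  have hcb : ∀ p, |c p| ≤ W p.1 := fun p => by simpa using hW' p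
  have hdb : ∀ p, |derivY c p| ≤ V p.1 := fun p => (norm_snd_gradSpace_le (fullGrad c p)).trans (hV' p)
  have hcd : Continuous (derivY c) := by
    have h1 := continuous_fullGrad hc.smooth
    have h2 : Continuous fun a : GradSpace d => a.snd := by fun_prop
    exact h2.comp h1
  have hηc : ∀ s ∈ Icc 0 T, Continuous fun x => ((x, η s x) : Space d × ℝ) := fun s hs =>
    continuous_id.prodMk (hη.contDiff_slice hs).continuous
  have i1 : Integrable fun x => WaterWave.dt T N t x * c (x, η t x) :=
    (hA₁.integrable_mul hW).mono' (((hN.dt hT).contDiff_slice ht').continuous.mul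
      (hc.smooth.continuous.comp (hηc t ht'))).aestronglyMeasurable (ae_of_all _ fun x => by
        rw [norm_mul]
        exact mul_le_mul (hA₁' t ht' x) (hcb _) (norm_nonneg _)
          ((abs_nonneg _).trans (hA₁' t ht' x)))
  have hb2 : ∀ s ∈ Icc 0 T, ∀ x, ‖N s x * (derivY c (x, η s x) * WaterWave.dt T η s x)‖ ≤
      A x * (V x * K) := fun s hs x => by
    rw [norm_mul, norm_mul]
    exact mul_le_mul (hA' s hs x) (mul_le_mul (hdb _) (hK s hs x) (norm_nonneg _)
      ((abs_nonneg _).trans (hdb (x, 0)))) (by positivity) ((abs_nonneg _).trans (hA' s hs x))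
  have i2 : Integrable fun x => N t x * (derivY c (x, η t x) * WaterWave.dt T η t x) :=
    (hA.integrable_mul (hV.mul_const K)).mono' ((hN.contDiff_slice ht').continuous.mul
      ((hcd.comp (hηc t ht')).mul
        ((hη.dt hT).contDiff_slice ht').continuous)).aestronglyMeasurable
      (ae_of_all _ fun x => hb2 t ht' x)
  have h := hasDerivAt_integral_of_dominated_loc_of_deriv_le (μ := volume) (x₀ := t)
    (F := fun s x => N s x * c (x, η s x))
    (F' := fun s x => WaterWave.dt T N s x * c (x, η s x) +
      N s x * (derivY c (x, η s x) * WaterWave.dt T η s x))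
    (bound := fun x => A₁ x * W x + A x * (V x * K)) (isOpen_Ioo.mem_nhds ht)
    (by
      filter_upwards [isOpen_Ioo.mem_nhds ht] with s hs
      have hs' : s ∈ Icc 0 T := Ioo_subset_Icc_self hs
      exact ((hN.contDiff_slice hs').continuous.mul
        (hc.smooth.continuous.comp (hηc s hs'))).aestronglyMeasurable)
    ((hA.integrable_mul hW).mono' ((hN.contDiff_slice ht').continuous.mul
      (hc.smooth.continuous.comp (hηc t ht'))).aestronglyMeasurable (ae_of_all _ fun x => by
        rw [norm_mul]
        exact mul_le_mul (hA' t ht' x) (hcb _) (norm_nonneg _)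
          ((abs_nonneg _).trans (hA' t ht' x))))
    (i1.add i2).1
    (ae_of_all _ fun x s hs => by
      have hs' : s ∈ Icc 0 T := Ioo_subset_Icc_self hs
      refine (norm_add_le _ _).trans (add_le_add ?_ (hb2 s hs' x))
      rw [norm_mul]
      exact mul_le_mul (hA₁' s hs' x) (hcb _) (norm_nonneg _)
        ((abs_nonneg _).trans (hA₁' s hs' x)))
    ((hA₁.integrable_mul hW).add (hA.integrable_mul (hV.mul_const K)))
    (ae_of_all _ fun x s hs => by
      have h1 : HasDerivAt (fun y => c (x, y)) (derivY c (x, η s x)) (η s x) :=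
        hasDerivAt_vertical (hc.smooth.differentiable (by simp) (x, η s x))
      have h2 := h1.comp s (hη.hasDerivAt_dt hs x)
      exact (hN.hasDerivAt_dt hs x).mul h2)
  rw [← integral_add i1 i2]
  exact h.2

/-- The derivative of an integral over the moving domain. -/
theorem IsSobolevSmooth.hasDerivAt_setIntegral_fluidDomain {T : ℝ} (hT : 0 < T)
    {η : ℝ → Space d → ℝ} (hη : IsSobolevSmooth T η) {q : Space d × ℝ → ℝ} (hq : Continuous q)
    (hqi : Integrable q) {R : ℝ} (hR : ∀ p, R < |p.2| → q p = 0) {W : Space d → ℝ}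
    (hW : Integrable W) (hqW : ∀ p, |q p| ≤ W p.1) {t : ℝ} (ht : t ∈ Ioo 0 T) :
    HasDerivAt (fun s => ∫ p in fluidDomain (η s), q p)
      (∫ x, q (x, η t x) * WaterWave.dt T η t x) t := by
  obtain ⟨K, hK⟩ := (hη.dt hT).exists_bound hT
  have ht' : t ∈ Icc 0 T := Ioo_subset_Icc_self ht
  have hηc : ∀ s ∈ Icc 0 T, Continuous fun x => ((x, η s x) : Space d × ℝ) := fun s hs =>
    continuous_id.prodMk (hη.contDiff_slice hs).continuous
  have hline : ∀ x : Space d, Continuous fun y => q (x, y) := fun x =>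
    hq.comp (continuous_const.prodMk continuous_id)
  have hcs : ∀ x : Space d, HasCompactSupport fun y => q (x, y) := fun x =>
    HasCompactSupport.intro (isCompact_Icc (a := -R) (b := R)) fun y hy => hR _ (by
      by_contra h
      exact hy (abs_le.1 (not_lt.1 h)))
  have hint : ∀ x : Space d, Integrable fun y => q (x, y) := fun x =>
    (hline x).integrable_of_hasCompactSupport (hcs x)
  -- The lower limit -(|R| + 1) lies below the support of q; replacing the half-line by an interval
  -- makes the usual derivative of a primitive available.
  have hval : ∀ (x : Space d) (a : ℝ), ∫ y in Iio a, q (x, y) =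
      ∫ y in (-(|R| + 1))..a, q (x, y) := fun x a => by
    rw [← integral_Iic_eq_integral_Iio, ← intervalIntegral.integral_Iic_sub_Iic
      (hint x).integrableOn (hint x).integrableOn, sub_eq_self.2]
    refine setIntegral_eq_zero_of_forall_eq_zero fun y hy => hR _ ?_
    have h1 : y ≤ -(|R| + 1) := hy
    show R < |y|
    have h2 := neg_le_abs y
    have h3 := le_abs_self R
    linarith
  have hprod : ∀ s ∈ Icc 0 T, ∫ p in fluidDomain (η s), q p =
      ∫ x, ∫ y in Iio (η s x), q (x, y) := fun s hs => by
    have hm := (isOpen_fluidDomain (hη.contDiff_slice hs).continuous).measurableSet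
    have hi := hqi.indicator hm
    rw [Measure.volume_eq_prod] at hi
    rw [← integral_indicator hm, Measure.volume_eq_prod, integral_prod _ hi]
    refine integral_congr_ae (ae_of_all _ fun x => ?_)
    simp only
    rw [← integral_indicator measurableSet_Iio]
    rfl
  have hintx : ∀ s ∈ Icc 0 T, Integrable fun x => ∫ y in Iio (η s x), q (x, y) := fun s hs => by
    have hm := (isOpen_fluidDomain (hη.contDiff_slice hs).continuous).measurableSet
    have hi := hqi.indicator hm
    rw [Measure.volume_eq_prod] at hi
    refine hi.integral_prod_left.congr (ae_of_all _ fun x => ?_)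
    simp only
    rw [← integral_indicator measurableSet_Iio]
    rfl
  have hbd : ∀ s ∈ Icc 0 T, ∀ x, ‖q (x, η s x) * WaterWave.dt T η s x‖ ≤ W x * K :=
    fun s hs x => by
      rw [norm_mul]
      exact mul_le_mul (hqW _) (hK s hs x) (norm_nonneg _) ((abs_nonneg _).trans (hqW (x, 0)))
  have h := hasDerivAt_integral_of_dominated_loc_of_deriv_le (μ := volume) (x₀ := t)
    (F := fun s x => ∫ y in Iio (η s x), q (x, y))
    (F' := fun s x => q (x, η s x) * WaterWave.dt T η s x)
    (bound := fun x => W x * K) (isOpen_Ioo.mem_nhds ht)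
    (by
      filter_upwards [isOpen_Ioo.mem_nhds ht] with s hs
      exact (hintx s (Ioo_subset_Icc_self hs)).1)
    (hintx t ht')
    ((hq.comp (hηc t ht')).mul
      ((hη.dt hT).contDiff_slice ht').continuous).aestronglyMeasurable
    (ae_of_all _ fun x s hs => hbd s (Ioo_subset_Icc_self hs) x)
    (hW.mul_const K)
    (ae_of_all _ fun x s hs => by
      have h1 : HasDerivAt (fun a => ∫ y in Iio a, q (x, y)) (q (x, η s x)) (η s x) := by
        simp only [hval]
        exact intervalIntegral.integral_hasDerivAt_right ((hline x).intervalIntegrable _ _)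
          ((hline x).stronglyMeasurableAtFilter _ _) (hline x).continuousAt
      exact h1.comp s (hη.hasDerivAt_dt hs x))
  refine h.2.congr_of_eventuallyEq ?_
  filter_upwards [isOpen_Ioo.mem_nhds ht] with s hs
  exact hprod s (Ioo_subset_Icc_self hs)

/-- Adding K|s - t|^{3/2}, whose derivative at t is zero, turns t into a local minimum. A one-sided
bound of f suffices because it holds on both sides of t. -/
theorem hasDerivAt_eq_zero_of_ge {f : ℝ → ℝ} {f' t K : ℝ} (hf : HasDerivAt f f' t) (h0 : f t = 0)
    (hK : ∀ᶠ s in 𝓝 t, -(K * (|s - t| * √|s - t|)) ≤ f s) : f' = 0 := by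
  have hr : HasDerivAt (fun s : ℝ => K * (|s - t| * √|s - t|)) 0 t := by
    rw [hasDerivAt_iff_isLittleO]
    simp only [sub_self, abs_zero, zero_mul, mul_zero, sub_zero, smul_zero]
    refine Asymptotics.IsLittleO.const_mul_left ?_ K
    have h1 : Tendsto (fun s : ℝ => √|s - t|) (𝓝 t) (𝓝 0) := by
      have : Continuous fun s : ℝ => √|s - t| := by fun_prop
      simpa using this.tendsto t
    have h2 := (Asymptotics.isBigO_refl (fun s : ℝ => s - t) (𝓝 t)).abs_left.mul_isLittleO
      ((Asymptotics.isLittleO_one_iff ℝ).2 h1)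
    simpa using h2
  have hm : IsLocalMin (fun s => f s + K * (|s - t| * √|s - t|)) t := by
    filter_upwards [hK] with s hs
    simp only [sub_self, abs_zero, zero_mul, mul_zero, h0]
    linarith
  simpa using hm.hasDerivAt_eq_zero (hf.add hr)

theorem IsSobolevSmooth.exists_lipschitz {T : ℝ} (hT : 0 < T) {η : ℝ → Space d → ℝ}
    (hη : IsSobolevSmooth T η) : ∃ C : ℝ, 0 < C ∧ ∀ s ∈ Icc 0 T, ∀ t ∈ Icc 0 T, ∀ x,
      |η s x - η t x| ≤ C * |s - t| := by
  obtain ⟨K, hK⟩ := (hη.dt hT).exists_bound hT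
  refine ⟨|K| + 1, by positivity, fun s hs t ht x => ?_⟩
  have h := (convex_Icc (0 : ℝ) T).norm_image_sub_le_of_norm_hasDerivWithin_le
    (f := fun τ => η τ x) (C := |K| + 1) (fun τ hτ => hη.hasDerivWithinAt_dt hτ x)
    (fun τ hτ => (hK τ hτ x).trans ((le_abs_self K).trans (by linarith))) ht hs
  simpa using h

/-- Differentiation of the kinetic energy by comparison with a fixed extension. -/
theorem deriv_kinetic_eq {T : ℝ} (hT : 0 < T) {η ψ : ℝ → Space d → ℝ}
    (hη : IsSobolevSmooth T η) (hψ : IsSobolevSmooth T ψ)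
    (hS : ∀ t ∈ Icc 0 T, ∃ φ, SliceData (η t) (ψ t) (WaterWave.dt T η t) φ)
    {t : ℝ} (ht : t ∈ Ioo 0 T) :
    (∫ x, WaterWave.dt T (WaterWave.dt T η) t x * ψ t x) +
        ∫ x, WaterWave.dt T η t x * WaterWave.dt T ψ t x =
      2 * ((∫ x, WaterWave.dt T (WaterWave.dt T η) t x * ψ t x) +
        ∫ x, WaterWave.dt T η t x *
          (vertVel (η t) (ψ t) (WaterWave.dt T η t) x * WaterWave.dt T η t x)) -
      ∫ x, ‖fullGrad (chi (η t) (ψ t) (WaterWave.dt T η t)) (x, η t x)‖ ^ 2 *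
        WaterWave.dt T η t x := by
  have ht' : t ∈ Icc 0 T := Ioo_subset_Icc_self ht
  have hN := hη.dt hT
  obtain ⟨φ, S⟩ := hS t ht'
  obtain ⟨A, hA, hA'⟩ := hN.exists_dominating hT
  obtain ⟨C, hC0, hC⟩ := hη.exists_lipschitz hT
  obtain ⟨K, hK⟩ := S.exists_energy_lower_bound (∫ x, A x ^ 2)
  obtain ⟨V, hV, hV'⟩ := S.goodExt.fderiv_le
  obtain ⟨R, hR⟩ := S.goodExt.supp
  have hcg : ∀ x, chi (η t) (ψ t) (WaterWave.dt T η t) (x, η t x) = ψ t x :=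
    cauchyExt_graph _ _ _
  have hdY : ∀ x, derivY (chi (η t) (ψ t) (WaterWave.dt T η t)) (x, η t x) =
      vertVel (η t) (ψ t) (WaterWave.dt T η t) x := fun x => by
    rw [derivY_eq (S.goodExt.smooth.differentiable (by simp) _)]
    exact fderiv_cauchyExt_vertical S.eta.toTameB S.psi
      (tameL2_vertVel S.eta.toTameB S.psi S.nrm) x
  have d1 := hN.hasDerivAt_integral_mul hT hψ ht
  have d2 := hη.hasDerivAt_integral_mul_comp hT hN S.goodExt ht
  have d3 := hη.hasDerivAt_setIntegral_fluidDomain hT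
    (q := fun p => ‖fullGrad (chi (η t) (ψ t) (WaterWave.dt T η t)) p‖ ^ 2)
    ((continuous_fullGrad S.goodExt.smooth).norm.pow 2) S.integrable_sq_fullGrad_chi (R := R)
    (fun p hp => by
      have h1 := norm_fullGrad_le (S.goodExt.smooth.differentiable (by simp) p)
      have h2 := GoodExt.iteratedFDeriv_eq_zero hR 1 hp
      rw [← norm_iteratedFDeriv_one, h2, norm_zero, mul_zero] at h1
      simp [norm_le_zero_iff.1 h1])
    hV.integrable_sq (fun p => by
      rw [abs_of_nonneg (by positivity)]
      gcongr
      exact hV' p) ht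
  simp only [hcg, hdY] at d2
  -- The kinetic energy minus its lower bound without the error term; the contribution of the
  -- remainder is the constant frozen at time t, so it disappears on differentiation.
  have hd := d1.sub (((d2.const_mul 2).sub d3).sub_const
    (∫ p, SliceData.remDensity (η t) (ψ t) (WaterWave.dt T η t) φ p))
  have hz := hasDerivAt_eq_zero_of_ge (K := C * √C * K) hd ?_ ?_
  · linarith
  · have := S.integral_mul_eq_add
    simp only [Pi.sub_apply, hcg]
    linarith
  · have hev : ∀ᶠ s in 𝓝 t, C * |s - t| ≤ 1 := by
      have hc : Continuous fun s : ℝ => C * |s - t| := by fun_prop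
      have := hc.tendsto t
      simp only [sub_self, abs_zero, mul_zero] at this
      exact this.eventually_le_const one_pos
    filter_upwards [isOpen_Ioo.mem_nhds ht, hev] with s hs hs1
    have hs' : s ∈ Icc 0 T := Ioo_subset_Icc_self hs
    obtain ⟨φ', S'⟩ := hS s hs'
    -- The comparison requires a positive displacement ρ, so s = t is treated by the exact identity
    -- for the energy.
    rcases eq_or_ne s t with rfl | hst
    · have := S.integral_mul_eq_add
      simp only [Pi.sub_apply, hcg, sub_self, abs_zero, zero_mul, mul_zero, neg_zero]
      linarith
    · have hpos : 0 < |s - t| := abs_pos.2 (sub_ne_zero.2 hst)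
      have h := hK (C * |s - t|) (by positivity) hs1 _ _ _ φ' S' (fun x => hC s hs' t ht' x) ?_
      · rw [Real.sqrt_mul hC0.le] at h
        simp only [Pi.sub_apply]
        linarith
      -- The time-independent majorant of ∂ₜη makes the error constant uniform in s.
      · refine integral_mono (S'.nrm.memLp_self.integrable_sq) hA.integrable_sq fun x => ?_
        exact sq_le_sq' (neg_le_of_abs_le (hA' s hs' x)) ((le_abs_self _).trans (hA' s hs' x))

/-! ### Conservation of the energy -/

theorem isDirichletNeumann_G {η f : Space d → ℝ} (h : ∃ N, IsDirichletNeumann η f N) :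
    IsDirichletNeumann η f (G η f) := by
  rw [G, dif_pos h]
  exact h.choose_spec

/-- The regularity of G(η)ψ comes from the equation: it equals ∂ₜη almost everywhere, and Green's
formula sees only the almost everywhere class. -/
theorem IsSmoothSolution.exists_sliceData {g T : ℝ} (hT : 0 < T) {η ψ : ℝ → Space d → ℝ}
    (h : IsSmoothSolution g T η ψ) {t : ℝ} (ht : t ∈ Icc 0 T) :
    ∃ φ, SliceData (η t) (ψ t) (WaterWave.dt T η t) φ := by
  obtain ⟨φ, hφ, hN⟩ := isDirichletNeumann_G (h.mem_domain t ht)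
  refine ⟨φ, h.smooth_eta.tameL2 hT ht, h.smooth_psi.tameL2 hT ht,
    (h.smooth_eta.dt hT).tameL2 hT ht, hφ, fun Φ hΦ hΦc => ?_⟩
  rw [hN.2 Φ hΦ hΦc]
  refine integral_congr_ae ?_
  filter_upwards [h.kinematic t ht] with x hx
  rw [sub_eq_zero.1 hx]

theorem IsSmoothSolution.energyDensity_ae_eq {g T : ℝ} {η ψ : ℝ → Space d → ℝ}
    (h : IsSmoothSolution g T η ψ) {t : ℝ} (ht : t ∈ Icc 0 T) :
    energyDensity g (η t) (ψ t) =ᵐ[volume]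
      fun x => g * (η t x * η t x) + WaterWave.dt T η t x * ψ t x := by
  filter_upwards [h.kinematic t ht] with x hx
  rw [energyDensity, sq_abs, ← sub_eq_zero.1 hx]
  ring

theorem IsSmoothSolution.integrable_energyDensity {g T : ℝ} (hT : 0 < T)
    {η ψ : ℝ → Space d → ℝ} (h : IsSmoothSolution g T η ψ) {t : ℝ} (ht : t ∈ Icc 0 T) :
    Integrable (energyDensity g (η t) (ψ t)) := by
  have m1 := (h.smooth_eta.tameL2 hT ht).memLp_self
  have m2 := (h.smooth_psi.tameL2 hT ht).memLp_self
  have m3 := ((h.smooth_eta.dt hT).tameL2 hT ht).memLp_self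
  exact (((m1.integrable_mul m1).const_mul g).add (m3.integrable_mul m2)).congr
    (h.energyDensity_ae_eq ht).symm

theorem IsSmoothSolution.H_eq {g T : ℝ} (hT : 0 < T) {η ψ : ℝ → Space d → ℝ}
    (h : IsSmoothSolution g T η ψ) {t : ℝ} (ht : t ∈ Icc 0 T) :
    H g (η t) (ψ t) = g * (∫ x, η t x * η t x) + ∫ x, WaterWave.dt T η t x * ψ t x := by
  have m1 := (h.smooth_eta.tameL2 hT ht).memLp_self
  have m2 := (h.smooth_psi.tameL2 hT ht).memLp_self
  have m3 := ((h.smooth_eta.dt hT).tameL2 hT ht).memLp_self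
  have i1 : Integrable fun x => η t x * η t x := m1.integrable_mul m1
  have i2 : Integrable fun x => WaterWave.dt T η t x * ψ t x := m3.integrable_mul m2
  rw [H, integral_congr_ae (h.energyDensity_ae_eq ht), integral_add (i1.const_mul g) i2,
    integral_const_mul]

/-- The dynamic equation expresses the Dirichlet density on the graph. -/
theorem IsSmoothSolution.ae_norm_sq_fullGrad_chi {g T : ℝ} (hT : 0 < T) {η ψ : ℝ → Space d → ℝ}
    (h : IsSmoothSolution g T η ψ) {t : ℝ} (ht : t ∈ Icc 0 T) :
    ∀ᵐ x, ‖fullGrad (chi (η t) (ψ t) (WaterWave.dt T η t)) (x, η t x)‖ ^ 2 =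
      2 * (vertVel (η t) (ψ t) (WaterWave.dt T η t) x * WaterWave.dt T η t x) -
        2 * WaterWave.dt T ψ t x - 2 * (g * η t x) := by
  have hη := h.smooth_eta.tameL2 hT ht
  filter_upwards [h.kinematic t ht, h.dynamic t ht] with x h1 h2
  have h3 := norm_sq_fullGrad_cauchyExt hη.toTameB (h.smooth_psi.tameL2 hT ht)
    ((h.smooth_eta.dt hT).tameL2 hT ht) x
  rw [← sub_eq_zero.1 h1, mul_comm 2, ← div_div] at h2
  rw [chi, h3]
  linarith

theorem IsSmoothSolution.hasDerivAt_energy {g T : ℝ} (hT : 0 < T) {η ψ : ℝ → Space d → ℝ}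
    (h : IsSmoothSolution g T η ψ) {t : ℝ} (ht : t ∈ Ioo 0 T) :
    HasDerivAt (fun s => g * (∫ x, η s x * η s x) + ∫ x, WaterWave.dt T η s x * ψ s x) 0 t := by
  have ht' : t ∈ Icc 0 T := Ioo_subset_Icc_self ht
  have hη := h.smooth_eta
  have hN := hη.dt hT
  have hψ := h.smooth_psi
  have d1 := hη.hasDerivAt_integral_mul hT hη ht
  have d2 := hN.hasDerivAt_integral_mul hT hψ ht
  have key := deriv_kinetic_eq hT hη hψ (fun s hs => h.exists_sliceData hT hs) ht
  have m1 := hη.tameL2 hT ht'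
  have m2 := hψ.tameL2 hT ht'
  have m3 := hN.tameL2 hT ht'
  have m4 := ((hψ.dt hT).tameL2 hT ht').memLp_self
  have mb := tameL2_vertVel m1.toTameB m2 m3
  have i1 : Integrable fun x => WaterWave.dt T η t x *
      (vertVel (η t) (ψ t) (WaterWave.dt T η t) x * WaterWave.dt T η t x) :=
    m3.memLp_self.integrable_mul (mb.toTameB.mul_tameL2 m3).memLp_self
  have i2 : Integrable fun x => WaterWave.dt T η t x * WaterWave.dt T ψ t x :=
    m3.memLp_self.integrable_mul m4
  have i3 : Integrable fun x => WaterWave.dt T η t x * η t x :=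
    m3.memLp_self.integrable_mul m1.memLp_self
  have e : ∫ x, ‖fullGrad (chi (η t) (ψ t) (WaterWave.dt T η t)) (x, η t x)‖ ^ 2 *
        WaterWave.dt T η t x =
      2 * (∫ x, WaterWave.dt T η t x *
        (vertVel (η t) (ψ t) (WaterWave.dt T η t) x * WaterWave.dt T η t x)) -
      2 * (∫ x, WaterWave.dt T η t x * WaterWave.dt T ψ t x) -
      2 * g * ∫ x, WaterWave.dt T η t x * η t x := by
    rw [← integral_const_mul, ← integral_const_mul, ← integral_const_mul,
      ← integral_sub (i1.const_mul 2) (i2.const_mul 2),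
      ← integral_sub (by exact (i1.const_mul 2).sub (i2.const_mul 2)) (i3.const_mul (2 * g))]
    refine integral_congr_ae ?_
    filter_upwards [h.ae_norm_sq_fullGrad_chi hT ht'] with x hx
    rw [hx]
    ring
  have ec : ∫ x, η t x * WaterWave.dt T η t x = ∫ x, WaterWave.dt T η t x * η t x :=
    integral_congr_ae (ae_of_all _ fun x => mul_comm _ _)
  -- With `e` inserted, `key` reads E' = 2E' + 2g ∫ ∂ₜη η for the kinetic energy E, which is the
  -- vanishing of the total derivative.
  refine ((d1.const_mul g).add d2).congr_deriv ?_
  rw [ec]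
  linarith

theorem IsSmoothSolution.H_eq_initial {g T : ℝ} (hT : 0 < T) {η ψ : ℝ → Space d → ℝ}
    (h : IsSmoothSolution g T η ψ) {t : ℝ} (ht : t ∈ Icc 0 T) :
    H g (η t) (ψ t) = H g (η 0) (ψ 0) := by
  rw [h.H_eq hT ht, h.H_eq hT (left_mem_Icc.2 hT.le)]
  rcases ht.1.eq_or_lt with rfl | h0
  · rfl
  have hη := h.smooth_eta
  have hc : ContinuousOn
      (fun s => g * (∫ x, η s x * η s x) + ∫ x, WaterWave.dt T η s x * ψ s x) (Icc 0 t) :=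
    ((continuousOn_const.mul (hη.continuousOn_integral_mul hT hη)).add
      ((hη.dt hT).continuousOn_integral_mul hT h.smooth_psi)).mono (Icc_subset_Icc_right ht.2)
  -- The derivative is computed only at interior times, where comparison from both sides is
  -- possible; continuity reaches the endpoints through the mean value theorem.
  obtain ⟨s, hs, hs'⟩ := exists_hasDerivAt_eq_slope _ (fun _ => 0) h0 hc
    fun s hs => h.hasDerivAt_energy hT ⟨hs.1, hs.2.trans_le ht.2⟩
  have := (div_eq_zero_iff.1 hs'.symm).resolve_right (by linarith)
  exact sub_eq_zero.1 this

end WaterWave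

end

theorem proposition8p1 (d : ℕ) (hd : 1 ≤ d) (g T : ℝ) (hT : 0 < T)
    (η ψ : ℝ → WaterWave.Space d → ℝ) (η₀ ψ₀ : WaterWave.Space d → ℝ)
    (hsol : WaterWave.IsSmoothSolution g T η ψ) (hη₀ : η 0 = η₀) (hψ₀ : ψ 0 = ψ₀) :
    ∀ t ∈ Icc 0 T,
      Integrable (WaterWave.energyDensity g (η t) (ψ t)) volume ∧
        WaterWave.H g (η t) (ψ t) = WaterWave.H g η₀ ψ₀ := by
  subst hη₀ hψ₀
  exact fun t ht => ⟨hsol.integrable_energyDensity hT ht, hsol.H_eq_initial hT ht⟩
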